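/- **Setting.** Let $\mathcal M$ be a set of models, $\Pi$ a finite set of policies and $\mathcal O$ an observation space. Each $M\in\mathcal M$ has observation likelihoods $M(o\mid\pi)$ with respect to a fixed base measure, and a value function $V_M:\Pi\to[0,1]$. Write $\mathbb E^{\pi,M}$ for the expectation over $o\sim M(\cdot\mid\pi)$. Let $\Phi$ be a finite family of pairwise disjoint subsets $\phi\subseteq\mathcal M\times\Pi$, each containing a single policy $\pi_\phi$; put $\Psi=\bigcup_{\phi\in\Phi}\phi$, and write $M\in\phi$ for $(M,\pi_\phi)\in\phi$. For a (discrete) $\nu\in\Delta(\Psi)$ let $\nu(\phi\mid\pi,o)\propto\sum_{(M,\pi^\star)\in\phi}\nu(M,\pi^\star)M(o\mid\pi)$ be the posterior. **Assumption.** Let $H\ge1$, $B>0$, let $\xi_h:\Phi\times\Phi\times\mathcal O\to[0,B^2]$ for $h=1,\dots,H$ and $\mathcal T_M:\Phi\to\Phi$ for $M\in\mathcal M$ be such that $\mathcal T_M\phi=\phi$ whenever $M\in\phi$, and for all $h,\phi',\phi,M,\pi$ $$4B^2\,\mathbb E^{\pi,M}\big[\xi_h(\phi',\phi;o)-\xi_h(\mathcal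 T_M\phi,\phi;o)\big]\ \ge\ \mathbb E^{\pi,M}\big[(\xi_h(\phi',\phi;o)-\xi_h(\mathcal T_M\phi,\phi;o))^2\big].$$ Put $\overline D_{\rm sq}^\pi(\phi\|M)=\frac1{B^2H}\sum_{h=1}^H\mathbb E^{\pi,M}[\xi_h(\phi,\phi;o)-\xi_h(\mathcal T_M\phi,\phi;o)]$ and, for $\eta>0$, $$D^\pi(\nu\|\rho)=\mathbb E_{M\sim\nu}\mathbb E_{o\sim M(\cdot|\pi)}\big[\mathrm{KL}(\nu(\cdot\mid\pi,o),\rho)+\mathbb E_{\phi\sim\rho}\overline D_{\rm sq}^\pi(\phi\|M)\big],$$ $$\mathsf{AIR}(p,\nu;\rho)=\mathbb E_{\pi\sim p}\mathbb E_{(M,\pi^\star)\sim\nu}\big[V_M(\pi^\star)-V_M(\pi)-\tfrac1\eta D^\pi(\nu\|\rho)\big],\qquad \mathsf{digdec}_\eta=\max_{\rho\in\Delta(\Phi)}\min_{p\in\Delta(\Pi)}\max_{\nu\in\Delta(\Psi)}\mathsf{AIR}(p,\nu;\rho).$$ **Game and algorithm.** The environment commits to $\phi^\star\in\Phi$. In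 round $t=1,\dots,T$ it chooses, based on the history, $M_t$ with $M_t\in\phi^\star$, subject to $\mathcal T_{M_t}\phi=\mathcal T_{M_{t'}}\phi$ for all $\phi,t,t'$. Starting from uniform $\rho_1$ and $q_1(\cdot\mid\phi)$, the learner takes a solution $(p_t,\nu_t)$ of $\min_{p}\max_{\nu}\mathsf{AIR}(p,\nu;\rho_t)$, draws $\pi_t\sim p_t$ and observes $o_t\sim M_t(\cdot\mid\pi_t)$. With $\iota=64\log|\Phi|$, $\gamma=\frac1{4\iota}$, $$\Delta_t(\phi',\phi)=\tfrac1{B^2H}\sum_h\xi_h(\phi',\phi;o_t),\quad L_t(\phi)=\Delta_t(\phi,\phi)-\mathbb E_{\phi'\sim q_t(\cdot|\phi)}\Delta_t(\phi',\phi),\quad b_t(\phi)=\tfrac{[\rho_t(\phi)-\max_{s<t}\rho_s(\phi)]_+}{\rho_t(\phi)}\,\iota$$ (the empty maximum being $0$), it updates $$\rho_{t+1}\in\arg\min_{\rho\in\Delta(\Phi)}\Big\{\langle\rho,L_t+4\gamma L_t^2+b_t\rangle+\mathrm{KL}(\rho,\nu_t(\cdot\mid\pi_t,o_t))+\tfrac1\gamma\mathrm{KL}(\rho,\rho_t)\Big\},$$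 $$q_{t+1}(\phi'\mid\phi)\propto\exp\Big(-\tfrac{1}{16\max_{s\le t}\rho_s(\phi)}\sum_{s=1}^t\rho_s(\phi)\Delta_s(\phi',\phi)\Big).$$ Suppose that almost surely each observation $o_t$ has positive likelihood under $\nu_t$ when $\pi_t$ is played, so that the posterior $\nu_t(\cdot\mid\pi_t,o_t)$ is defined. Let $$\mathrm{Est}=\sum_{t=1}^T\mathbb E_{\pi\sim p_t}\Big[D^\pi(\delta_{M_t,\pi_{\phi^\star}}\|\rho_t)-\mathrm{Breg}_{D^\pi(\cdot\|\rho_t)}(\delta_{M_t,\pi_{\phi^\star}},\nu_t)\Big],$$ where $\mathrm{Breg}_F(x,y)=F(x)-F(y)-\langle\nabla F(y),x-y\rangle$ is the Bregman divergence (with the derivative of $F$ at $y$ in the direction $x-y$), and $\mathrm{Reg}=\sum_{t=1}^T(V_{M_t}(\pi_{\phi^\star})-V_{M_t}(\pi_t))$. **Theorem.** There is a universal constant $C>0$ such that $\mathrm{Est}$ is almost surely well defined, is integrable, and $$\mathbb E[\mathrm{Est}]\le C\log^2|\Phi|.$$ Moreover $\mathbb E[\mathrm{Reg}]\le T\,\mathsf{digdec}_\eta+C\log^2|\Phi|/\eta$.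 In particular, if $\mathsf{digdec}_\eta\le d\,\eta$ for some $d>0$ at $\eta=\log|\Phi|/\sqrt{dT}$, then $\mathbb E[\mathrm{Reg}]\le C\sqrt{dT}\,\log|\Phi|$. -/

import Mathlib

open MeasureTheory Set
open scoped ENNReal

universe u₁ u₂ u₃ u₄ u₅

noncomputable section

namespace DigDEC

/-- Decision making with structured observations. Every model `M` maps a policy `π` to a
distribution over observations, given by its likelihood `M(o | π)` with respect to a base measure
(counting measure for discrete observations; no finiteness of the base measure is required), and
has a value function `V_M : Π → [0,1]`. The measurable structure on models is only used to speak of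
adversaries that choose the model at random or as a function of the history. -/
structure DMSO (Mod Pol Obs : Type*) [MeasurableSpace Mod] [MeasurableSpace Obs] where
  base : Measure Obs
  lik : Mod → Pol → Obs → ℝ≥0∞
  measurable_lik : ∀ M π, Measurable (lik M π)
  lintegral_lik : ∀ M π, ∫⁻ o, lik M π o ∂base = 1
  measurable_law : ∀ π, Measurable fun M => base.withDensity (lik M π)
  value : Mod → Pol → ℝ
  value_mem : ∀ M π, value M π ∈ Icc (0 : ℝ) 1
  measurable_value : ∀ π, Measurable fun M => value M π

/-- A family `Φ` of disjoint information sets (subsets of models × policies), each of which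
contains a single policy `π_φ`. -/
structure InfoSets (Mod Pol Φ : Type*) where
  set : Φ → Set (Mod × Pol)
  policy : Φ → Pol
  disjoint : ∀ φ φ', φ ≠ φ' → Disjoint (set φ) (set φ')
  policy_eq : ∀ φ, ∀ x ∈ set φ, x.2 = policy φ

variable {Mod Pol Obs Φ Ω : Type*} [MeasurableSpace Mod] [MeasurableSpace Obs]

/-- The union `Ψ` of all information sets. -/
def InfoSets.union (I : InfoSets Mod Pol Φ) : Set (Mod × Pol) := ⋃ φ, I.set φ

/-- The observation distribution `M(· | π)`. -/
def DMSO.law (E : DMSO Mod Pol Obs) (M : Mod) (π : Pol) : Measure Obs :=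
  E.base.withDensity (E.lik M π)

open Classical in
/-- The Kullback-Leibler divergence `KL(a, b)` of two vectors of probabilities on a finite set. -/
def kl [Fintype Φ] (a b : Φ → ℝ) : ℝ≥0∞ :=
  if ∀ φ, b φ = 0 → a φ = 0 then ENNReal.ofReal (∑ φ, a φ * Real.log (a φ / b φ)) else ⊤

/-! ### Posterior, divergence, AIR

A distribution `ν` on models × policies enters the definitions through its weights
`w : Mod × Pol → ℝ≥0∞`. -/

/-- `∑_{(M,π⋆) ∈ φ} ν(M,π⋆) M(o | π)`. -/
def infoLik (E : DMSO Mod Pol Obs) (I : InfoSets Mod Pol Φ) (w : Mod × Pol → ℝ≥0∞)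
    (π : Pol) (o : Obs) (φ : Φ) : ℝ≥0∞ :=
  ∑' x : Mod × Pol, (I.set φ).indicator (fun x => w x * E.lik x.1 π o) x

/-- The likelihood of the observation `o` under `ν`, when the policy `π` is played. -/
def mixLik [Fintype Φ] (E : DMSO Mod Pol Obs) (I : InfoSets Mod Pol Φ) (w : Mod × Pol → ℝ≥0∞)
    (π : Pol) (o : Obs) : ℝ≥0∞ :=
  ∑ φ, infoLik E I w π o φ

/-- The posterior `ν(φ | π, o)` over information sets, by Bayes' rule. -/
def infoPosterior [Fintype Φ] (E : DMSO Mod Pol Obs) (I : InfoSets Mod Pol Φ) (w : Mod × Pol → ℝ≥0∞)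
    (π : Pol) (o : Obs) (φ : Φ) : ℝ :=
  (infoLik E I w π o φ / mixLik E I w π o).toReal

/-- `D^π(ν ‖ ρ) = E_{M∼ν} E_{o∼M(·|π)} [KL(ν(· | π, o), ρ) + E_{φ∼ρ} Dbar^π(φ ‖ M)]`. -/
def divergence [Fintype Φ] (E : DMSO Mod Pol Obs) (I : InfoSets Mod Pol Φ)
    (Dbar : Pol → Φ → Mod → ℝ) (π : Pol) (w : Mod × Pol → ℝ≥0∞) (ρ : Φ → ℝ) : EReal :=
  ((∑' x : Mod × Pol, w x * ∫⁻ o, kl (infoPosterior E I w π o) ρ ∂(E.law x.1 π) : ℝ≥0∞) : EReal)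
    + ((∑' x : Mod × Pol, (w x).toReal * ∑ φ, ρ φ * Dbar π φ x.1 : ℝ) : EReal)

/-- `AIR(p, ν; ρ) = E_{π∼p} E_{(M,π⋆)∼ν} [V_M(π⋆) - V_M(π) - D^π(ν ‖ ρ) / η]`. -/
def air [Fintype Pol] [Fintype Φ] (E : DMSO Mod Pol Obs) (I : InfoSets Mod Pol Φ)
    (Dbar : Pol → Φ → Mod → ℝ) (η : ℝ) (p : Pol → ℝ) (ν : PMF (Mod × Pol)) (ρ : Φ → ℝ) : EReal :=
  ((∑ π, p π * ∑' x : Mod × Pol, (ν x).toReal * (E.value x.1 x.2 - E.value x.1 π) : ℝ) : EReal)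
    - ((1 / η : ℝ) : EReal) * ∑ π, (p π : EReal) * divergence E I Dbar π ν ρ

/-- `max_{ν ∈ Δ(Ψ)} AIR(p, ν; ρ)`. -/
def airMax [Fintype Pol] [Fintype Φ] (E : DMSO Mod Pol Obs) (I : InfoSets Mod Pol Φ)
    (Dbar : Pol → Φ → Mod → ℝ) (η : ℝ) (p : Pol → ℝ) (ρ : Φ → ℝ) : EReal :=
  ⨆ (ν : PMF (Mod × Pol)) (_ : ν.support ⊆ I.union), air E I Dbar η p ν ρ

/-- `(p, ν)` solves `min_{p ∈ Δ(Π)} max_{ν ∈ Δ(Ψ)} AIR(p, ν; ρ)`. -/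
structure IsMinimax [Fintype Pol] [Fintype Φ] (E : DMSO Mod Pol Obs) (I : InfoSets Mod Pol Φ)
    (Dbar : Pol → Φ → Mod → ℝ) (η : ℝ) (p : Pol → ℝ) (ν : PMF (Mod × Pol)) (ρ : Φ → ℝ) :
    Prop where
  p_mem : p ∈ stdSimplex ℝ Pol
  ν_mem : ν.support ⊆ I.union
  p_min : ∀ p' ∈ stdSimplex ℝ Pol, airMax E I Dbar η p ρ ≤ airMax E I Dbar η p' ρ
  ν_max : ∀ ν' : PMF (Mod × Pol), ν'.support ⊆ I.union →
    air E I Dbar η p ν' ρ ≤ air E I Dbar η p ν ρ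

/-- The dual information gain decision-estimation coefficient
`max_{ρ ∈ Δ(Φ)} min_{p ∈ Δ(Π)} max_{ν ∈ Δ(Ψ)} AIR(p, ν; ρ)`. -/
def digDEC [Fintype Pol] [Fintype Φ] (E : DMSO Mod Pol Obs) (I : InfoSets Mod Pol Φ)
    (Dbar : Pol → Φ → Mod → ℝ) (η : ℝ) : EReal :=
  ⨆ ρ ∈ stdSimplex ℝ Φ, ⨅ p ∈ stdSimplex ℝ Pol, airMax E I Dbar η p ρ

/-! ### Squared estimation error -/

/-- The assumption on the estimation functions `ξ_h : Φ × Φ × O → [0, B²]` and the maps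
`T_M : Φ → Φ` (`bell`). -/
structure SquaredEstimation {H : ℕ} (E : DMSO Mod Pol Obs) (I : InfoSets Mod Pol Φ)
    (B : ℝ) (ξ : Fin H → Φ → Φ → Obs → ℝ) (bell : Mod → Φ → Φ) : Prop where
  measurable_ξ : ∀ h φ' φ, Measurable (ξ h φ' φ)
  ξ_mem : ∀ h φ' φ o, ξ h φ' φ o ∈ Icc 0 (B ^ 2)
  measurable_bell : ∀ φ φ', MeasurableSet {M | bell M φ = φ'}
  bell_eq : ∀ φ M, (M, I.policy φ) ∈ I.set φ → bell M φ = φ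
  bernstein : ∀ h φ' φ M π,
    ∫ o, (ξ h φ' φ o - ξ h (bell M φ) φ o) ^ 2 ∂(E.law M π)
      ≤ 4 * B ^ 2 * ∫ o, (ξ h φ' φ o - ξ h (bell M φ) φ o) ∂(E.law M π)

/-- `Dbar_sq^π(φ ‖ M) = (1 / (B² H)) ∑_h E^{π,M} [ξ_h(φ, φ; o) - ξ_h(T_M φ, φ; o)]`. -/
def sqDiv {H : ℕ} (E : DMSO Mod Pol Obs) (B : ℝ) (ξ : Fin H → Φ → Φ → Obs → ℝ)
    (bell : Mod → Φ → Φ) (π : Pol) (φ : Φ) (M : Mod) : ℝ :=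
  1 / (B ^ 2 * H) * ∑ h, ∫ o, (ξ h φ φ o - ξ h (bell M φ) φ o) ∂(E.law M π)

/-! ### The interaction

Rounds are numbered `0, …, T - 1`. -/

/-- All random quantities of the game: the models of the adversary, the policies played, the
observations, and the quantities `p_t, ν_t, ρ_t, q_t` of the algorithm; `q t ω φ φ'` is
`q_t(φ' | φ)`. -/
structure Play (Mod Pol Obs Φ Ω : Type*) where
  model : ℕ → Ω → Mod
  act : ℕ → Ω → Pol
  obs : ℕ → Ω → Obs
  p : ℕ → Ω → Pol → ℝ
  ν : ℕ → Ω → PMF (Mod × Pol)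
  ρ : ℕ → Ω → Φ → ℝ
  q : ℕ → Ω → Φ → Φ → ℝ

/-- The protocol: `ℱ t` is the information available at the beginning of round `t`. The adversary
has committed to `φ⋆`, chooses `M_t` with `(M_t, π_{φ⋆}) ∈ φ⋆` based on the history; given the
history, the learner draws `π_t ∼ p_t` and observes `o_t ∼ M_t(· | π_t)`. -/
structure IsInteraction [Fintype Φ] [mΩ : MeasurableSpace Ω] (P : Measure Ω)
    (ℱ : Filtration ℕ mΩ) (E : DMSO Mod Pol Obs) (I : InfoSets Mod Pol Φ) (T : ℕ) (φs : Φ)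
    (G : Play Mod Pol Obs Φ Ω) : Prop where
  measurable_model : ∀ t < T, Measurable[ℱ t] (G.model t)
  measurable_p : ∀ t < T, ∀ π, Measurable[ℱ t] fun ω => G.p t ω π
  measurable_ρ : ∀ t < T, ∀ φ, Measurable[ℱ t] fun ω => G.ρ t ω φ
  measurable_ν : ∀ t < T, ∀ π φ, @Measurable (Ω × Obs) ℝ≥0∞
    ((ℱ t).prod inferInstance) inferInstance fun z => infoLik E I (G.ν t z.1) π z.2 φ
  measurable_act : ∀ t < T, ∀ π, MeasurableSet[ℱ (t + 1)] {ω | G.act t ω = π}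
  measurable_obs : ∀ t < T, Measurable[ℱ (t + 1)] (G.obs t)
  restricted : ∀ᵐ ω ∂P, ∀ t < T, (G.model t ω, I.policy φs) ∈ I.set φs
  conditional_law : ∀ t < T, ∀ A, MeasurableSet[ℱ t] A → ∀ π S, MeasurableSet S →
    P (A ∩ {ω | G.act t ω = π ∧ G.obs t ω ∈ S})
      = ∫⁻ ω in A, ENNReal.ofReal (G.p t ω π) * E.law (G.model t ω) π S ∂P

/-! ### The bi-level posterior update -/

/-- `ι = 64 log |Φ|`. -/
def iota (Φ : Type*) [Fintype Φ] : ℝ := 64 * Real.log (Fintype.card Φ)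

/-- `γ = 1 / (4 ι)`. -/
def gam (Φ : Type*) [Fintype Φ] : ℝ := 1 / (4 * iota Φ)

/-- `Δ(φ', φ) = (1 / (B² H)) ∑_h ξ_h(φ', φ; o)`. -/
def delta {H : ℕ} (B : ℝ) (ξ : Fin H → Φ → Φ → Obs → ℝ) (o : Obs) (φ' φ : Φ) : ℝ :=
  1 / (B ^ 2 * H) * ∑ h, ξ h φ' φ o

/-- `L(φ) = Δ(φ, φ) - E_{φ'∼q(·|φ)} [Δ(φ', φ)]`. -/
def topLoss [Fintype Φ] {H : ℕ} (B : ℝ) (ξ : Fin H → Φ → Φ → Obs → ℝ) (q : Φ → Φ → ℝ) (o : Obs)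
    (φ : Φ) : ℝ :=
  delta B ξ o φ φ - ∑ φ', q φ φ' * delta B ξ o φ' φ

/-- `b_t(φ) = [ρ_t(φ) - max_{s<t} ρ_s(φ)]_+ / ρ_t(φ) · ι`, with maximum `0` over no rounds. -/
def bias [Fintype Φ] (ρ : ℕ → Φ → ℝ) (t : ℕ) (φ : Φ) : ℝ :=
  max (ρ t φ - ⨆ s : Fin t, ρ s φ) 0 / ρ t φ * iota Φ

/-- `α_t(φ) = 1 / (16 max_{s≤t} ρ_s(φ))`. -/
def rate (ρ : ℕ → Φ → ℝ) (t : ℕ) (φ : Φ) : ℝ :=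
  1 / (16 * ⨆ s : Fin (t + 1), ρ s φ)

/-- The objective `⟨r, L_t + 4 γ L_t² + b_t⟩ + KL(r, post) + KL(r, ρ_t) / γ` of the top-level
update. -/
def topObjective [Fintype Φ] (L b post ρt : Φ → ℝ) (r : Φ → ℝ) : EReal :=
  ((∑ φ, r φ * (L φ + 4 * gam Φ * L φ ^ 2 + b φ) : ℝ) : EReal) + ((kl r post : ℝ≥0∞) : EReal)
    + ((1 / gam Φ : ℝ) : EReal) * ((kl r ρt : ℝ≥0∞) : EReal)

/-- The weights `exp(-α_t(φ) ∑_{s≤t} ρ_s(φ) Δ_s(φ', φ))`. -/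
def expWeight {H : ℕ} (B : ℝ) (ξ : Fin H → Φ → Φ → Obs → ℝ) (ρ : ℕ → Φ → ℝ) (o : ℕ → Obs)
    (t : ℕ) (φ φ' : Φ) : ℝ :=
  Real.exp (-(rate ρ t φ) * ∑ s ∈ Finset.range (t + 1), ρ s φ * delta B ξ (o s) φ' φ)

/-- The general framework run with divergence `Dbar_sq` and the bi-level posterior update, in which
the convex function `F_t` is `KL(·, ν_t(· | π_t, o_t))`. -/
structure IsAlgorithm [Fintype Pol] [Fintype Φ] [MeasurableSpace Ω] (P : Measure Ω) {H : ℕ}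
    (E : DMSO Mod Pol Obs) (I : InfoSets Mod Pol Φ)
    (B : ℝ) (ξ : Fin H → Φ → Φ → Obs → ℝ) (bell : Mod → Φ → Φ) (η : ℝ) (T : ℕ)
    (G : Play Mod Pol Obs Φ Ω) : Prop where
  ρ_init : ∀ ω φ, G.ρ 0 ω φ = 1 / Fintype.card Φ
  q_init : ∀ ω φ φ', G.q 0 ω φ φ' = 1 / Fintype.card Φ
  minimax : ∀ᵐ ω ∂P, ∀ t < T,
    IsMinimax E I (sqDiv E B ξ bell) η (G.p t ω) (G.ν t ω) (G.ρ t ω)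
  ρ_mem : ∀ᵐ ω ∂P, ∀ t < T, G.ρ (t + 1) ω ∈ stdSimplex ℝ Φ
  ρ_step : ∀ᵐ ω ∂P, ∀ t < T, ∀ r ∈ stdSimplex ℝ Φ,
    let objective := topObjective (topLoss B ξ (G.q t ω) (G.obs t ω))
      (bias (fun s => G.ρ s ω) t) (infoPosterior E I (G.ν t ω) (G.act t ω) (G.obs t ω)) (G.ρ t ω)
    objective (G.ρ (t + 1) ω) ≤ objective r
  q_step : ∀ᵐ ω ∂P, ∀ t < T, ∀ φ φ', G.q (t + 1) ω φ φ'
    = expWeight B ξ (fun s => G.ρ s ω) (fun s => G.obs s ω) t φ φ'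
      / ∑ φ'', expWeight B ξ (fun s => G.ρ s ω) (fun s => G.obs s ω) t φ φ''

/-! ### Estimation term and regret -/

/-- The point `(1 - ε) y + ε x` of the segment from `y` to `x`. -/
def mixSegment {X : Type*} (x y : X → ℝ≥0∞) (ε : ℝ) : X → ℝ≥0∞ :=
  fun z => ENNReal.ofReal (1 - ε) * y z + ENNReal.ofReal ε * x z

/-- The Bregman divergence `Breg_F(x, y) = F(x) - F(y) - ⟨∇F(y), x - y⟩`, the last term being the
derivative at `y` in the direction `x - y`. -/
def breg {X : Type*} (F : (X → ℝ≥0∞) → ℝ) (x y : X → ℝ≥0∞) : ℝ :=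
  F x - F y - derivWithin (fun ε => F (mixSegment x y ε)) (Icc 0 1) 0

/-- `D^π(δ_x ‖ ρ)`, `D^π(ν ‖ ρ)` and the derivative in `Breg_{D^π(·‖ρ)}(δ_x, ν)` are finite. -/
def BregFinite [Fintype Φ] (E : DMSO Mod Pol Obs) (I : InfoSets Mod Pol Φ)
    (Dbar : Pol → Φ → Mod → ℝ) (π : Pol) (ρ : Φ → ℝ) (x : Mod × Pol) (ν : PMF (Mod × Pol)) :
    Prop :=
  divergence E I Dbar π (PMF.pure x) ρ ≠ ⊤ ∧ divergence E I Dbar π ν ρ ≠ ⊤ ∧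
    DifferentiableWithinAt ℝ
      (fun ε => (divergence E I Dbar π (mixSegment (PMF.pure x) ν ε) ρ).toReal) (Icc 0 1) 0

/-- `Est = ∑_t E_{π∼p_t} [D^π(δ_{M_t,π_{φ⋆}} ‖ ρ_t) - Breg_{D^π(·‖ρ_t)}(δ_{M_t,π_{φ⋆}}, ν_t)]`. -/
def est [Fintype Pol] [Fintype Φ] (E : DMSO Mod Pol Obs) (I : InfoSets Mod Pol Φ)
    (Dbar : Pol → Φ → Mod → ℝ) (T : ℕ) (φs : Φ) (G : Play Mod Pol Obs Φ Ω) (ω : Ω) : ℝ :=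
  ∑ t ∈ Finset.range T, ∑ π, G.p t ω π *
    ((divergence E I Dbar π (PMF.pure (G.model t ω, I.policy φs)) (G.ρ t ω)).toReal
      - breg (fun w => (divergence E I Dbar π w (G.ρ t ω)).toReal)
          (PMF.pure (G.model t ω, I.policy φs)) (G.ν t ω))

/-- `Reg(π⋆) = ∑_t (V_{M_t}(π⋆) - V_{M_t}(π_t))`. -/
def regret (E : DMSO Mod Pol Obs) (T : ℕ) (πs : Pol) (G : Play Mod Pol Obs Φ Ω) (ω : Ω) : ℝ :=
  ∑ t ∈ Finset.range T, (E.value (G.model t ω) πs - E.value (G.model t ω) (G.act t ω))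

end DigDEC

end

namespace DigDEC

/-! ### Relative entropy on a finite set -/

/-! The estimation term is rewritten as an expected log-likelihood gain of the true information set
φ⋆, and that gain is bounded path by path through two nested mirror descent arguments.

Rewriting. The entropy part of D^π(·‖ρ) is the integral of a convex, positively homogeneous function
of the unnormalised posterior. Its tangent at ν in the direction of (M, π_φ⋆) cancels D^π(ν‖ρ)
exactly, so D(δ) - Breg(δ, ν) equals E log ν(φ⋆ | π, o) - log ρ(φ⋆) + E_{φ∼ρ} Dbar(φ‖M)
(`bregFinite_and_eq`). This is the conditional mean of `roundGain`.

Pathwise bound (`pathwise_bound`). The top-level update has an explicit Gibbs solution, which gives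
an exact identity against the point mass at φ⋆ (`topUpdate_spec`). In it log ρ_{t+1}(φ⋆) - log
ρ_t(φ⋆) telescopes with the factor 1 + 1/γ, of order log |Φ|, and this produces log². The top-level
loss compares Δ(φ, φ) with its average under q_t, while the divergence compares it with Δ(T_M φ, φ).
The discrepancy is the regret of exponential weights against T_M φ (`expWeights_regret`): of order
log |Φ| · max_s ρ_s(φ) for each φ, plus a second-order term. Summed over φ the maxima may be of
order |Φ|, so they have to be cancelled. The bias does this. Weighted by ρ_t it is ι times the
increment of the running maximum, and half of it survives with a negative sign. At φ⋆ it costs only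
ι times a sum of relative increments, which is logarithmic (`sum_bias_le`). What remains is a sum of
nonnegative predictable weights times X²/4 - X, where X is an excess loss over T_M φ. The Bernstein
assumption E X² ≤ 4 E X makes its conditional mean nonpositive.

Regret. Since ν_t maximises AIR(p_t, ·; ρ_t), the derivative in the direction of (M_t, π_φ⋆) is
nonpositive. This bounds the gap of the round by the value of the game plus 1/η times the estimation
term (`IsMinimax.gap_le`), and minimality of p_t bounds the value by the coefficient.

Finiteness. The expectation of -log ν(φ⋆ | π, o) could a priori be infinite. Along the segment from
ν to the point mass it is finite, optimality of ν bounds it uniformly there, and Fatou's lemma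
carries the bound to the endpoint (`IsMinimax.logLoss_ne_top`). The first-order condition then
bounds its p_t-average by -log ρ_t(φ⋆) + 1 + 2η. This drives an induction showing that ρ_t(φ⋆) > 0
almost surely and that log ρ_t(φ⋆) is integrable (`IsRun.ae_pos_integrable`). -/

theorem sub_le_mul_log_div {a b : ℝ} (ha : 0 ≤ a) (hb : 0 ≤ b) (h : b = 0 → a = 0) :
    a - b ≤ a * Real.log (a / b) := by
  rcases ha.eq_or_lt with rfl | ha
  · simpa using hb
  · have hb' : 0 < b := hb.lt_of_ne fun h' => ha.ne' (h h'.symm)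
    have := Real.one_sub_inv_le_log_of_pos (div_pos ha hb')
    have h2 : a * (1 - (a / b)⁻¹) = a - b := by field_simp
    rw [← h2]
    exact mul_le_mul_of_nonneg_left this ha.le

theorem sub_lt_mul_log_div {a b : ℝ} (ha : 0 ≤ a) (hb : 0 ≤ b) (h : b = 0 → a = 0)
    (hab : a ≠ b) : a - b < a * Real.log (a / b) := by
  rcases ha.eq_or_lt with rfl | ha
  · simpa using hb.lt_of_ne hab
  · have hb' : 0 < b := hb.lt_of_ne fun h' => ha.ne' (h h'.symm)
    have hne : b / a ≠ 1 := fun h' => hab ((div_eq_one_iff_eq ha.ne').1 h').symm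
    have := Real.log_lt_sub_one_of_pos (div_pos hb' ha) hne
    have h3 : Real.log (a / b) = -Real.log (b / a) := by
      rw [← Real.log_inv, inv_div]
    have h2 : a * (1 - b / a) = a - b := by field_simp
    rw [← h2, h3]
    exact mul_lt_mul_of_pos_left (by linarith) ha

section Finite

variable {Φ : Type*} [Fintype Φ]

theorem sum_mul_log_div_ge {a b : Φ → ℝ} (ha : ∀ φ, 0 ≤ a φ) (hb : ∀ φ, 0 ≤ b φ)
    (h : ∀ φ, b φ = 0 → a φ = 0) :
    ∑ φ, a φ - ∑ φ, b φ ≤ ∑ φ, a φ * Real.log (a φ / b φ) := by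
  rw [← Finset.sum_sub_distrib]
  exact Finset.sum_le_sum fun φ _ => sub_le_mul_log_div (ha φ) (hb φ) (h φ)

theorem sum_mul_log_div_nonneg {a b : Φ → ℝ} (ha : a ∈ stdSimplex ℝ Φ) (hb : b ∈ stdSimplex ℝ Φ)
    (h : ∀ φ, b φ = 0 → a φ = 0) : 0 ≤ ∑ φ, a φ * Real.log (a φ / b φ) := by
  have := sum_mul_log_div_ge ha.1 hb.1 h
  rwa [ha.2, hb.2, sub_self] at this

theorem eq_of_sum_mul_log_div_le_zero {a b : Φ → ℝ} (ha : a ∈ stdSimplex ℝ Φ)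
    (hb : b ∈ stdSimplex ℝ Φ) (h : ∀ φ, b φ = 0 → a φ = 0)
    (hle : ∑ φ, a φ * Real.log (a φ / b φ) ≤ 0) : a = b := by
  by_contra hne
  obtain ⟨φ, hφ⟩ := Function.ne_iff.1 hne
  have := Finset.sum_lt_sum (s := Finset.univ) (f := fun φ => a φ - b φ)
    (g := fun φ => a φ * Real.log (a φ / b φ))
    (fun φ _ => sub_le_mul_log_div (ha.1 φ) (hb.1 φ) (h φ))
    ⟨φ, Finset.mem_univ _, sub_lt_mul_log_div (ha.1 φ) (hb.1 φ) (h φ) hφ⟩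
  rw [Finset.sum_sub_distrib, ha.2, hb.2] at this
  linarith

theorem kl_eq_ofReal {a b : Φ → ℝ} (h : ∀ φ, b φ = 0 → a φ = 0) :
    kl a b = ENNReal.ofReal (∑ φ, a φ * Real.log (a φ / b φ)) := if_pos h

theorem kl_eq_top {a b : Φ → ℝ} (h : ¬ ∀ φ, b φ = 0 → a φ = 0) : kl a b = ⊤ := if_neg h

theorem kl_ne_top_iff {a b : Φ → ℝ} : kl a b ≠ ⊤ ↔ ∀ φ, b φ = 0 → a φ = 0 := by
  refine ⟨fun h => ?_, fun h => ?_⟩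
  · by_contra h'
    exact h (kl_eq_top h')
  · rw [kl_eq_ofReal h]; exact ENNReal.ofReal_ne_top

/-! ### The top-level update -/

theorem topObjective_eq {L b post ρt r : Φ → ℝ} (hr : r ∈ stdSimplex ℝ Φ)
    (hpost : post ∈ stdSimplex ℝ Φ) (hρ : ρt ∈ stdSimplex ℝ Φ)
    (h1 : ∀ φ, post φ = 0 → r φ = 0) (h2 : ∀ φ, ρt φ = 0 → r φ = 0) :
    topObjective L b post ρt r =
      ((∑ φ, r φ * (L φ + 4 * gam Φ * L φ ^ 2 + b φ) + ∑ φ, r φ * Real.log (r φ / post φ)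
        + 1 / gam Φ * ∑ φ, r φ * Real.log (r φ / ρt φ) : ℝ) : EReal) := by
  rw [topObjective, kl_eq_ofReal h1, kl_eq_ofReal h2, EReal.coe_ennreal_ofReal,
    EReal.coe_ennreal_ofReal, max_eq_left (sum_mul_log_div_nonneg hr hpost h1),
    max_eq_left (sum_mul_log_div_nonneg hr hρ h2)]
  push_cast
  rfl

/-- Because both entropies enter with positive weight, a minimiser cannot charge a set to which the
posterior or ρ_t gives no mass. -/
theorem topObjective_eq_top {L b post ρt r : Φ → ℝ} (hγ : 0 < gam Φ)
    (h : ¬ ((∀ φ, post φ = 0 → r φ = 0) ∧ ∀ φ, ρt φ = 0 → r φ = 0)) :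
    topObjective L b post ρt r = ⊤ := by
  have hpos : (0 : EReal) < ((1 / gam Φ : ℝ) : EReal) := by
    exact_mod_cast one_div_pos.2 hγ
  have hk : ∀ x : ℝ≥0∞, (x : EReal) ≠ ⊥ := fun x => EReal.coe_ennreal_ne_bot x
  have hnn : (0 : EReal) ≤ ((1 / gam Φ : ℝ) : EReal) * ((kl r ρt : ℝ≥0∞) : EReal) :=
    mul_nonneg hpos.le (EReal.coe_ennreal_nonneg _)
  by_cases h1 : ∀ φ, post φ = 0 → r φ = 0
  · have h2 : ¬ ∀ φ, ρt φ = 0 → r φ = 0 := fun h2 => h ⟨h1, h2⟩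
    rw [topObjective, kl_eq_top h2, EReal.coe_ennreal_top, EReal.mul_top_of_pos hpos]
    refine EReal.add_top_of_ne_bot ?_
    rw [kl_eq_ofReal h1, EReal.coe_ennreal_ofReal, ← EReal.coe_add]
    exact EReal.coe_ne_bot _
  · rw [topObjective, kl_eq_top h1, EReal.coe_ennreal_top, EReal.coe_add_top]
    exact EReal.top_add_of_ne_bot (bot_lt_iff_ne_bot.1 (lt_of_lt_of_le EReal.bot_lt_zero hnn))

/-- The minimiser of `⟨r, g⟩ + KL(r, post) + β KL(r, ρ)`, unnormalised. -/
noncomputable def gibbsWeight (β : ℝ) (g post ρ : Φ → ℝ) (φ : Φ) : ℝ :=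
  if post φ = 0 ∨ ρ φ = 0 then 0
  else Real.exp ((Real.log (post φ) + β * Real.log (ρ φ) - g φ) / (1 + β))

/-- Completing the two entropies to a single one: up to a constant the objective is 1 + β times the
relative entropy to the normalised Gibbs weights, so the minimiser is unique and explicit. -/
theorem objective_eq_gibbs {β : ℝ} (hβ : 0 < β) {g post ρ r : Φ → ℝ}
    (hr : r ∈ stdSimplex ℝ Φ) (hZ : 0 < ∑ φ, gibbsWeight β g post ρ φ)
    (h1 : ∀ φ, post φ = 0 → r φ = 0) (h2 : ∀ φ, ρ φ = 0 → r φ = 0) :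
    ∑ φ, r φ * g φ + ∑ φ, r φ * Real.log (r φ / post φ) + β * ∑ φ, r φ * Real.log (r φ / ρ φ)
      = (1 + β) * ∑ φ, r φ * Real.log (r φ / (gibbsWeight β g post ρ φ /
          ∑ φ', gibbsWeight β g post ρ φ'))
        - (1 + β) * Real.log (∑ φ, gibbsWeight β g post ρ φ) := by
  set Z := ∑ φ, gibbsWeight β g post ρ φ with hZdef
  have key : ∀ φ, r φ * g φ + r φ * Real.log (r φ / post φ) + β * (r φ * Real.log (r φ / ρ φ))
      = (1 + β) * (r φ * Real.log (r φ / (gibbsWeight β g post ρ φ / Z)))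
        - r φ * ((1 + β) * Real.log Z) := by
    intro φ
    by_cases h0 : r φ = 0
    · simp [h0]
    · have hp : post φ ≠ 0 := fun h => h0 (h1 φ h)
      have hq : ρ φ ≠ 0 := fun h => h0 (h2 φ h)
      have hw : gibbsWeight β g post ρ φ
          = Real.exp ((Real.log (post φ) + β * Real.log (ρ φ) - g φ) / (1 + β)) := by
        simp [gibbsWeight, hp, hq]
      rw [Real.log_div h0 hp, Real.log_div h0 hq, Real.log_div h0 (by rw [hw]; positivity),
        Real.log_div (by rw [hw]; positivity) hZ.ne', hw, Real.log_exp]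
      field_simp
      ring
  calc _ = ∑ φ, (r φ * g φ + r φ * Real.log (r φ / post φ) + β * (r φ * Real.log (r φ / ρ φ))) := by
        rw [Finset.sum_add_distrib, Finset.sum_add_distrib, Finset.mul_sum]
    _ = _ := by
        rw [Finset.sum_congr rfl fun φ _ => key φ, Finset.sum_sub_distrib, ← Finset.mul_sum,
          ← Finset.sum_mul, hr.2, one_mul]

/-- The objective at any r is its minimum plus (1 + β) KL(r, r'). The final identity is this for r
the point mass at φs, whose entropy relative to r' is -log r'(φs). The positivity of r'(φs) is what
allows the analysis to be iterated over rounds. -/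
theorem topUpdate_spec {L b post ρt r' : Φ → ℝ} {φs : Φ} (hγ : 0 < gam Φ)
    (hr' : r' ∈ stdSimplex ℝ Φ) (hpost : post ∈ stdSimplex ℝ Φ) (hρ : ρt ∈ stdSimplex ℝ Φ)
    (hp : 0 < post φs) (hq : 0 < ρt φs)
    (hmin : ∀ r ∈ stdSimplex ℝ Φ, topObjective L b post ρt r' ≤ topObjective L b post ρt r) :
    0 < r' φs ∧ (∀ φ, post φ = 0 → r' φ = 0) ∧ (∀ φ, ρt φ = 0 → r' φ = 0) ∧
    ∑ φ, r' φ * (L φ + 4 * gam Φ * L φ ^ 2 + b φ) + ∑ φ, r' φ * Real.log (r' φ / post φ)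
        + 1 / gam Φ * ∑ φ, r' φ * Real.log (r' φ / ρt φ)
        - (1 + 1 / gam Φ) * Real.log (r' φs)
      = (L φs + 4 * gam Φ * L φs ^ 2 + b φs) - Real.log (post φs)
        - 1 / gam Φ * Real.log (ρt φs) := by
  classical
  set β := 1 / gam Φ with hβdef
  have hβ : 0 < β := one_div_pos.2 hγ
  set g : Φ → ℝ := fun φ => L φ + 4 * gam Φ * L φ ^ 2 + b φ with hg
  set u := gibbsWeight β g post ρt with hu
  have hu0 : ∀ φ, 0 ≤ u φ := fun φ => by
    simp only [hu, gibbsWeight]; split_ifs <;> positivity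
  have hus : 0 < u φs := by
    simp only [hu, gibbsWeight, hp.ne', hq.ne', or_self, if_false]; positivity
  have hZ : 0 < ∑ φ, u φ :=
    Finset.sum_pos' (fun φ _ => hu0 φ) ⟨φs, Finset.mem_univ _, hus⟩
  set rs : Φ → ℝ := fun φ => u φ / ∑ φ', u φ' with hrs
  have hrs_mem : rs ∈ stdSimplex ℝ Φ :=
    ⟨fun φ => div_nonneg (hu0 φ) hZ.le, by rw [hrs, ← Finset.sum_div, div_self hZ.ne']⟩
  have hrs1 : ∀ φ, post φ = 0 → rs φ = 0 := fun φ h => by simp [hrs, hu, gibbsWeight, h]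
  have hrs2 : ∀ φ, ρt φ = 0 → rs φ = 0 := fun φ h => by simp [hrs, hu, gibbsWeight, h]
  have hsupp : (∀ φ, post φ = 0 → r' φ = 0) ∧ ∀ φ, ρt φ = 0 → r' φ = 0 := by
    by_contra hcon
    have := hmin rs hrs_mem
    rw [topObjective_eq_top hγ hcon, topObjective_eq hrs_mem hpost hρ hrs1 hrs2] at this
    exact EReal.coe_ne_top _ (top_le_iff.1 this)
  obtain ⟨h1, h2⟩ := hsupp
  have hle := hmin rs hrs_mem
  rw [topObjective_eq hrs_mem hpost hρ hrs1 hrs2, topObjective_eq hr' hpost hρ h1 h2,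
    EReal.coe_le_coe_iff, objective_eq_gibbs hβ hr' hZ h1 h2,
    objective_eq_gibbs hβ hrs_mem hZ hrs1 hrs2] at hle
  have hself : ∑ φ, rs φ * Real.log (rs φ / (u φ / ∑ φ', u φ')) = 0 := by
    refine Finset.sum_eq_zero fun φ _ => ?_
    by_cases h0 : rs φ = 0
    · simp [h0]
    · rw [show u φ / ∑ φ', u φ' = rs φ from rfl, div_self h0, Real.log_one, mul_zero]
  have hsupp' : ∀ φ, rs φ = 0 → r' φ = 0 := by
    intro φ h
    have : u φ = 0 := by
      rcases div_eq_zero_iff.1 h with h | h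
      · exact h
      · exact absurd h hZ.ne'
    have h3 : post φ = 0 ∨ ρt φ = 0 := by
      by_contra h'
      rw [hu, gibbsWeight, if_neg h'] at this
      exact (Real.exp_pos _).ne' this
    exact h3.elim (h1 φ) (h2 φ)
  -- Comparison with the Gibbs distribution shows that r' has nonpositive relative entropy to it,
  -- which forces equality.
  have heq : r' = rs := by
    refine eq_of_sum_mul_log_div_le_zero hr' hrs_mem hsupp' ?_
    have h3 : (1 + β) * ∑ φ, r' φ * Real.log (r' φ / (u φ / ∑ φ', u φ')) ≤ 0 := by
      rw [hself] at hle; linarith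
    by_contra hcon
    push Not at hcon
    have : 0 < (1 + β) * ∑ φ, r' φ * Real.log (r' φ / (u φ / ∑ φ', u φ')) := by
      apply mul_pos (by linarith) hcon
    linarith
  refine ⟨by rw [heq]; exact div_pos hus hZ, h1, h2, ?_⟩
  have e1 : ∑ φ, r' φ * g φ + ∑ φ, r' φ * Real.log (r' φ / post φ)
        + β * ∑ φ, r' φ * Real.log (r' φ / ρt φ) = - (1 + β) * Real.log (∑ φ, u φ) := by
    rw [objective_eq_gibbs hβ hr' hZ h1 h2, heq, hself]; ring
  have e2 : Real.log (r' φs)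
      = (Real.log (post φs) + β * Real.log (ρt φs) - g φs) / (1 + β) - Real.log (∑ φ, u φ) := by
    rw [heq, hrs, Real.log_div hus.ne' hZ.ne']
    congr 1
    simp [hu, gibbsWeight, hp.ne', hq.ne']
  show ∑ φ, r' φ * g φ + _ + _ - _ = g φs - _ - _
  rw [e1, e2]
  field_simp
  ring

theorem exp_neg_le {x : ℝ} (hx : |x| ≤ 1) : Real.exp (-x) ≤ 1 - x + x ^ 2 := by
  have := (abs_le.1 (Real.abs_exp_sub_one_sub_id_le (x := -x) (by rwa [abs_neg]))).2
  nlinarith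

/-- Gibbs' inequality for r against the unnormalised vector ρ exp(-γ g), whose total mass is
controlled by exp(-x) ≤ 1 - x + x². -/
theorem mirror_stability {γ : ℝ} (hγ : 0 < γ) {r ρ g : Φ → ℝ} (hr : r ∈ stdSimplex ℝ Φ)
    (hρ : ρ ∈ stdSimplex ℝ Φ) (h : ∀ φ, ρ φ = 0 → r φ = 0) (hg : ∀ φ, |γ * g φ| ≤ 1) :
    ∑ φ, ρ φ * g φ - ∑ φ, r φ * g φ - 1 / γ * ∑ φ, r φ * Real.log (r φ / ρ φ)
      ≤ γ * ∑ φ, ρ φ * g φ ^ 2 := by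
  have h1 := sum_mul_log_div_ge (a := r) (b := fun φ => ρ φ * Real.exp (-(γ * g φ))) hr.1
    (fun φ => mul_nonneg (hρ.1 φ) (Real.exp_pos _).le)
    (fun φ h' => h φ ((mul_eq_zero.1 h').resolve_right (Real.exp_pos _).ne'))
  have h2 : ∑ φ, r φ * Real.log (r φ / (ρ φ * Real.exp (-(γ * g φ))))
      = ∑ φ, r φ * Real.log (r φ / ρ φ) + γ * ∑ φ, r φ * g φ := by
    rw [Finset.mul_sum, ← Finset.sum_add_distrib]
    refine Finset.sum_congr rfl fun φ _ => ?_
    by_cases h0 : r φ = 0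
    · simp [h0]
    · have hq : ρ φ ≠ 0 := fun h' => h0 (h φ h')
      rw [Real.log_div h0 hq, Real.log_div h0 (by positivity),
        Real.log_mul hq (Real.exp_pos _).ne', Real.log_exp]
      ring
  have h3 : ∑ φ, ρ φ * Real.exp (-(γ * g φ))
      ≤ 1 - γ * ∑ φ, ρ φ * g φ + γ ^ 2 * ∑ φ, ρ φ * g φ ^ 2 := by
    rw [← hρ.2, Finset.mul_sum, Finset.mul_sum, ← Finset.sum_sub_distrib, ← Finset.sum_add_distrib]
    refine Finset.sum_le_sum fun φ _ => ?_
    have := mul_le_mul_of_nonneg_left (exp_neg_le (hg φ)) (hρ.1 φ)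
    nlinarith
  rw [h2, hr.2] at h1
  set K := ∑ φ, r φ * Real.log (r φ / ρ φ)
  set A := ∑ φ, ρ φ * g φ
  set B := ∑ φ, r φ * g φ
  set D := ∑ φ, ρ φ * g φ ^ 2
  have h4 : γ * A - γ * B - K ≤ γ ^ 2 * D := by linarith
  have h5 : A - B - 1 / γ * K = (γ * A - γ * B - K) / γ := by field_simp
  rw [h5, div_le_iff₀ hγ]
  nlinarith

end Finite

end DigDEC

namespace DigDEC

/-! ### The bottom-level update -/

section Finite

variable {Φ : Type*} [Fintype Φ]

/-- Monotonicity of `a ↦ a⁻¹ log (mean of exp (a x))`. -/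
theorem log_mean_exp_le [Nonempty Φ] {a a' : ℝ} (ha' : 0 < a') (haa : a' ≤ a) (x : Φ → ℝ) :
    1 / a' * Real.log (1 / Fintype.card Φ * ∑ φ, Real.exp (-a' * x φ))
      ≤ 1 / a * Real.log (1 / Fintype.card Φ * ∑ φ, Real.exp (-a * x φ)) := by
  have ha : 0 < a := ha'.trans_le haa
  have hn : (0 : ℝ) < Fintype.card Φ := by exact_mod_cast Fintype.card_pos
  have hpos : ∀ c : ℝ, 0 < 1 / (Fintype.card Φ : ℝ) * ∑ φ, Real.exp (-c * x φ) := fun c =>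
    mul_pos (by positivity) (Finset.sum_pos (fun _ _ => Real.exp_pos _) Finset.univ_nonempty)
  have hp : 1 ≤ a / a' := (one_le_div ha').2 haa
  have := Real.rpow_arith_mean_le_arith_mean_rpow Finset.univ
    (fun _ : Φ => 1 / (Fintype.card Φ : ℝ)) (fun φ => Real.exp (-a' * x φ))
    (fun _ _ => by positivity) (by simp) (fun _ _ => (Real.exp_pos _).le) hp
  rw [← Finset.mul_sum, ← Finset.mul_sum] at this
  have h2 : ∀ φ, Real.exp (-a' * x φ) ^ (a / a') = Real.exp (-a * x φ) := fun φ => by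
    rw [← Real.exp_mul]; congr 1; field_simp
  simp only [h2] at this
  have h3 := Real.log_le_log (Real.rpow_pos_of_pos (hpos a') _) this
  rw [Real.log_rpow (hpos a')] at h3
  have h4 := mul_le_mul_of_nonneg_left h3 (one_div_pos.2 ha).le
  refine le_trans (le_of_eq ?_) h4
  field_simp

/-- One step of exponential weights. -/
theorem log_sum_exp_le {q D : Φ → ℝ} {c j : ℝ} (hc : 0 ≤ c) (hc1 : c ≤ 1)
    (hq : q ∈ stdSimplex ℝ Φ) (hX : ∀ φ, |D φ - j| ≤ 1) :
    Real.log (∑ φ, q φ * Real.exp (-c * D φ))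
      ≤ -c * ∑ φ, q φ * D φ + c ^ 2 * ∑ φ, q φ * (D φ - j) ^ 2 := by
  -- Factoring out exp(-c j) centres the expansion at the loss of the comparator, so that the
  -- second-order term is the squared excess over it. The Bernstein condition needs exactly this
  -- form.
  have h1 : ∑ φ, q φ * Real.exp (-c * D φ)
      ≤ Real.exp (-c * j) * (1 - c * (∑ φ, q φ * D φ - j) + c ^ 2 * ∑ φ, q φ * (D φ - j) ^ 2) := by
    have : (1 - c * (∑ φ, q φ * D φ - j) + c ^ 2 * ∑ φ, q φ * (D φ - j) ^ 2)
        = ∑ φ, q φ * (1 - c * (D φ - j) + (c * (D φ - j)) ^ 2) := by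
      have hj : ∑ φ, q φ * (1 + c * j) = 1 + c * j := by rw [← Finset.sum_mul, hq.2, one_mul]
      have : ∀ φ, q φ * (1 - c * (D φ - j) + (c * (D φ - j)) ^ 2)
          = q φ * (1 + c * j) - c * (q φ * D φ) + c ^ 2 * (q φ * (D φ - j) ^ 2) := fun φ => by ring
      simp only [this, Finset.sum_add_distrib, Finset.sum_sub_distrib, hj, ← Finset.mul_sum]
      ring
    rw [this, Finset.mul_sum]
    refine Finset.sum_le_sum fun φ _ => ?_
    have hx : |c * (D φ - j)| ≤ 1 := by
      rw [abs_mul, abs_of_nonneg hc]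
      exact mul_le_one₀ hc1 (abs_nonneg _) (hX φ)
    have h2 := exp_neg_le hx
    have h3 : Real.exp (-c * D φ) = Real.exp (-c * j) * Real.exp (-(c * (D φ - j))) := by
      rw [← Real.exp_add]; congr 1; ring
    rw [h3]
    have := mul_le_mul_of_nonneg_left h2 (mul_nonneg (hq.1 φ) (Real.exp_pos (-c * j)).le)
    nlinarith
  have hpos : 0 < ∑ φ, q φ * Real.exp (-c * D φ) := by
    obtain ⟨φ, hφ⟩ : ∃ φ, 0 < q φ := by
      by_contra hcon
      push Not at hcon
      have : ∑ φ, q φ ≤ 0 := Finset.sum_nonpos fun φ _ => hcon φ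
      rw [hq.2] at this; linarith
    exact Finset.sum_pos' (fun φ _ => mul_nonneg (hq.1 φ) (Real.exp_pos _).le)
      ⟨φ, Finset.mem_univ _, mul_pos hφ (Real.exp_pos _)⟩
  have h5 : 0 < 1 - c * (∑ φ, q φ * D φ - j) + c ^ 2 * ∑ φ, q φ * (D φ - j) ^ 2 :=
    pos_of_mul_pos_right (hpos.trans_le h1) (Real.exp_pos _).le
  have h4 := Real.log_le_log hpos h1
  rw [Real.log_mul (Real.exp_pos _).ne' h5.ne', Real.log_exp] at h4
  have := Real.log_le_sub_one_of_pos h5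
  linarith

/-- Regret of exponential weights for losses `w_t D_t` at the learning rates `1 / (16 m_t)`, where
`m_t` is the running maximum of `w`. -/
theorem expWeights_regret [Nonempty Φ] {T : ℕ} {w m : ℕ → ℝ} {D q : ℕ → Φ → ℝ} (j : Φ)
    (hw : ∀ t < T, 0 ≤ w t) (hw0 : 0 < T → 0 < w 0) (hm0 : m 0 = 0)
    (hm : ∀ t < T, m (t + 1) = max (m t) (w t)) (hD : ∀ t φ, D t φ ∈ Icc (0 : ℝ) 1)
    (hq : ∀ t < T, ∀ φ, q t φ
      = Real.exp (-(1 / (16 * m t)) * ∑ s ∈ Finset.range t, w s * D s φ)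
        / ∑ φ', Real.exp (-(1 / (16 * m t)) * ∑ s ∈ Finset.range t, w s * D s φ')) :
    ∑ t ∈ Finset.range T, w t * ∑ φ, q t φ * (D t φ - D t j)
      ≤ (16 * Real.log (Fintype.card Φ) + 1) * m T
        + ∑ t ∈ Finset.range T, w t / 16 * ∑ φ, q t φ * (D t φ - D t j) ^ 2 := by
  have hn : (0 : ℝ) < Fintype.card Φ := by exact_mod_cast Fintype.card_pos
  have hlogn : 0 ≤ Real.log (Fintype.card Φ) :=
    Real.log_nonneg (by exact_mod_cast Fintype.card_pos)
  have hX : ∀ t φ, |D t φ - D t j| ≤ 1 := fun t φ => by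
    have h1 := hD t φ; have h2 := hD t j
    rw [abs_le]; constructor <;> linarith [h1.1, h1.2, h2.1, h2.2]
  have hmpos : ∀ t, t + 1 ≤ T → 0 < m (t + 1) := by
    intro t
    induction t with
    | zero => intro h; rw [hm 0 h]; exact lt_max_of_lt_right (hw0 h)
    | succ t ih => intro h; rw [hm _ h]; exact lt_max_of_lt_left (ih (by omega))
  have hmnn : ∀ t ≤ T, 0 ≤ m t := by
    intro t ht
    rcases t with _ | t
    · rw [hm0]
    · exact (hmpos t ht).le
  set S : ℕ → Φ → ℝ := fun t φ => ∑ s ∈ Finset.range t, w s * D s φ with hS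
  set W : ℕ → ℝ := fun t => 1 / Fintype.card Φ * ∑ φ, Real.exp (-(1 / (16 * m t)) * S t φ) with hW
  have hWpos : ∀ t, 0 < W t := fun t =>
    mul_pos (by positivity) (Finset.sum_pos (fun _ _ => Real.exp_pos _) Finset.univ_nonempty)
  have hqs : ∀ t < T, q t ∈ stdSimplex ℝ Φ := by
    intro t ht
    have hpos : 0 < ∑ φ', Real.exp (-(1 / (16 * m t)) * ∑ s ∈ Finset.range t, w s * D s φ') :=
      Finset.sum_pos (fun _ _ => Real.exp_pos _) Finset.univ_nonempty
    refine ⟨fun φ => ?_, ?_⟩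
    · rw [hq t ht]; positivity
    · rw [Finset.sum_congr rfl fun φ _ => hq t ht φ, ← Finset.sum_div, div_self hpos.ne']
  have hSnn : ∀ t ≤ T, ∀ φ, 0 ≤ S t φ := fun t ht φ =>
    Finset.sum_nonneg fun s hs =>
      mul_nonneg (hw s (by have := Finset.mem_range.1 hs; omega)) (hD s φ).1
  -- The potential is -16 m_t log W_t. The extra m_{t+1} - m_t telescopes and pays for the learning
  -- rate of round t not yet knowing the weight w_t.
  have hstep : ∀ t < T, w t * ∑ φ, q t φ * D t φ
      ≤ (-(16 * m (t + 1) * Real.log (W (t + 1))) - -(16 * m t * Real.log (W t)))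
        + w t / 16 * ∑ φ, q t φ * (D t φ - D t j) ^ 2 + (m (t + 1) - m t) := by
    intro t ht
    have hqt := hqs t ht
    have hv : 0 ≤ ∑ φ, q t φ * (D t φ - D t j) ^ 2 :=
      Finset.sum_nonneg fun φ _ => mul_nonneg (hqt.1 φ) (sq_nonneg _)
    have hqD0 : 0 ≤ ∑ φ, q t φ * D t φ :=
      Finset.sum_nonneg fun φ _ => mul_nonneg (hqt.1 φ) (hD t φ).1
    have hqD1 : ∑ φ, q t φ * D t φ ≤ 1 := by
      rw [← hqt.2]
      exact Finset.sum_le_sum fun φ _ => mul_le_of_le_one_right (hqt.1 φ) (hD t φ).2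
    have hm1 := hmpos t ht
    rcases Nat.eq_zero_or_pos t with rfl | htpos
    -- Since m_0 = 0, the potential starts at zero; the new potential is nonnegative because losses
    -- are, and the first loss, at most w_0, is paid by m_1 - m_0.
    · have hW1 : Real.log (W 1) ≤ 0 := by
        refine Real.log_nonpos (hWpos 1).le ?_
        have : ∑ φ, Real.exp (-(1 / (16 * m 1)) * S 1 φ) ≤ ∑ _φ : Φ, (1 : ℝ) := by
          refine Finset.sum_le_sum fun φ _ => Real.exp_le_one_iff.2 ?_
          have := hSnn 1 ht φ
          have h2 : 0 ≤ 1 / (16 * m 1) := by positivity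
          nlinarith
        simp only [Finset.sum_const, Finset.card_univ, nsmul_eq_mul, mul_one] at this
        rw [hW]
        simp only
        rw [one_div, inv_mul_le_iff₀ hn]; linarith
      have hm1w : m 1 = w 0 := by rw [hm 0 ht, hm0]; exact max_eq_right (hw 0 ht)
      have hwt := hw 0 ht
      rw [hm0, zero_add] at *
      have h1 : m 1 * Real.log (W 1) ≤ 0 := mul_nonpos_of_nonneg_of_nonpos hm1.le hW1
      have h2 : 0 ≤ w 0 / 16 * ∑ φ, q 0 φ * (D 0 φ - D 0 j) ^ 2 := by positivity
      have h3 : w 0 * ∑ φ, q 0 φ * D 0 φ ≤ w 0 := mul_le_of_le_one_right hwt hqD1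
      rw [hm1w] at *
      linarith
    · obtain ⟨t, rfl⟩ : ∃ t', t = t' + 1 := ⟨t - 1, by omega⟩
      set s := t + 1 with hs
      have hms : 0 < m s := hmpos t ht.le
      have hmm : m s ≤ m (s + 1) := by rw [hm s ht]; exact le_max_left _ _
      set a := 1 / (16 * m s) with ha
      have hapos : 0 < a := by positivity
      -- The weight is clipped at the running maximum that defines the current rate, so that a v ≤
      -- 1/16. The clipped part w - v equals m_{s+1} - m_s and is charged to the increment.
      set v := min (w s) (m s) with hvdef
      have hv0 : 0 ≤ v := le_min (hw s ht) hms.le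
      have hav : a * v ≤ 1 / 16 := by
        rw [ha, div_mul_eq_mul_div, one_mul, div_le_div_iff₀ (by positivity) (by norm_num)]
        have := min_le_right (w s) (m s); linarith
      -- The rate may drop between rounds; the power mean inequality shows that this only helps.
      have hmono := log_mean_exp_le (Φ := Φ) (a := a) (a' := 1 / (16 * m (s + 1)))
        (by positivity) (one_div_le_one_div_of_le (by positivity) (by linarith)) (S (s + 1))
      have hW2 : 1 / Fintype.card Φ * ∑ φ, Real.exp (-a * S (s + 1) φ)
          ≤ W s * ∑ φ, q s φ * Real.exp (-(a * v) * D s φ) := by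
        have hZ : 0 < ∑ φ', Real.exp (-a * S s φ') :=
          Finset.sum_pos (fun _ _ => Real.exp_pos _) Finset.univ_nonempty
        have : W s * ∑ φ, q s φ * Real.exp (-(a * v) * D s φ)
            = 1 / Fintype.card Φ * ∑ φ, Real.exp (-a * S s φ) * Real.exp (-(a * v) * D s φ) := by
          have hWs : W s = 1 / Fintype.card Φ * ∑ φ, Real.exp (-a * S s φ) := rfl
          rw [hWs, mul_assoc]
          congr 1
          rw [Finset.mul_sum]
          refine Finset.sum_congr rfl fun φ _ => ?_
          have hqφ : q s φ = Real.exp (-a * S s φ) / ∑ φ', Real.exp (-a * S s φ') := hq s ht φ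
          rw [hqφ, ← mul_assoc, mul_div_cancel₀ _ hZ.ne']
        rw [this]
        refine mul_le_mul_of_nonneg_left (Finset.sum_le_sum fun φ _ => ?_) (by positivity)
        rw [← Real.exp_add, Real.exp_le_exp]
        have hSs : S (s + 1) φ = S s φ + w s * D s φ := Finset.sum_range_succ _ _
        rw [hSs]
        have h1 : v * D s φ ≤ w s * D s φ :=
          mul_le_mul_of_nonneg_right (min_le_left _ _) (hD s φ).1
        nlinarith
      have hpos1 : 0 < 1 / (Fintype.card Φ : ℝ) * ∑ φ, Real.exp (-a * S (s + 1) φ) :=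
        mul_pos (by positivity) (Finset.sum_pos (fun _ _ => Real.exp_pos _) Finset.univ_nonempty)
      have hsum_pos : 0 < ∑ φ, q s φ * Real.exp (-(a * v) * D s φ) :=
        pos_of_mul_pos_right (hpos1.trans_le hW2) (hWpos s).le
      have hlog := Real.log_le_log hpos1 hW2
      rw [Real.log_mul (hWpos s).ne' hsum_pos.ne'] at hlog
      have hexp := log_sum_exp_le (c := a * v) (j := D s j) (by positivity) (by linarith) hqt (hX s)
      have e1 : 1 / (1 / (16 * m (s + 1))) = 16 * m (s + 1) := by rw [one_div_one_div]
      have e2 : 1 / a = 16 * m s := by rw [ha, one_div_one_div]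
      rw [e1, e2] at hmono
      have h6 : 16 * m s * Real.log (1 / Fintype.card Φ * ∑ φ, Real.exp (-a * S (s + 1) φ))
          ≤ 16 * m s * (Real.log (W s) + (-(a * v) * ∑ φ, q s φ * D s φ
            + (a * v) ^ 2 * ∑ φ, q s φ * (D s φ - D s j) ^ 2)) :=
        mul_le_mul_of_nonneg_left (by linarith) (by positivity)
      have e3 : 16 * m s * a = 1 := by rw [ha]; field_simp
      set Q := ∑ φ, q s φ * D s φ
      set V := ∑ φ, q s φ * (D s φ - D s j) ^ 2
      have h7 : 16 * m s * (Real.log (W s) + (-(a * v) * Q + (a * v) ^ 2 * V))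
          = 16 * m s * Real.log (W s) - v * Q + v * (a * v) * V := by
        linear_combination (-v * Q + v * (a * v) * V) * e3
      have h8 : v * (a * v) * V ≤ w s / 16 * V := by
        refine mul_le_mul_of_nonneg_right ?_ hv
        have := mul_le_mul (min_le_left (w s) (m s)) hav (by positivity) (hw s ht)
        linarith
      have h9 : w s * Q ≤ v * Q + (m (s + 1) - m s) := by
        have : (w s - v) * Q ≤ (w s - v) * 1 :=
          mul_le_mul_of_nonneg_left hqD1 (sub_nonneg.2 (min_le_left _ _))
        have h10 : w s - v = m (s + 1) - m s := by
          rw [hm s ht, hvdef]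
          rcases le_total (w s) (m s) with h | h
          · rw [min_eq_left h, max_eq_left h]; ring
          · rw [min_eq_right h, max_eq_right h]
        linarith
      have h11 : 16 * m (s + 1) * Real.log (W (s + 1)) ≤ _ := hmono.trans h6
      rw [h7] at h11
      linarith
  have hsum := Finset.sum_le_sum fun t ht => hstep t (Finset.mem_range.1 ht)
  rw [Finset.sum_add_distrib, Finset.sum_add_distrib,
    Finset.sum_range_sub (fun t => -(16 * m t * Real.log (W t))), Finset.sum_range_sub, hm0] at hsum
  -- Only the term of the comparator j is kept in the mean that defines W_T.
  have hfinal : -(16 * m T * Real.log (W T)) ≤ S T j + 16 * m T * Real.log (Fintype.card Φ) := by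
    rcases Nat.eq_zero_or_pos T with rfl | hT
    · simp [hm0, hS]
    · obtain ⟨t, rfl⟩ : ∃ t', T = t' + 1 := ⟨T - 1, by omega⟩
      have hmT := hmpos t le_rfl
      have h1 : 1 / (Fintype.card Φ : ℝ) * Real.exp (-(1 / (16 * m (t + 1))) * S (t + 1) j)
          ≤ W (t + 1) :=
        mul_le_mul_of_nonneg_left (Finset.single_le_sum
          (f := fun φ => Real.exp (-(1 / (16 * m (t + 1))) * S (t + 1) φ))
          (fun _ _ => (Real.exp_pos _).le) (Finset.mem_univ j)) (by positivity)
      have h2 := Real.log_le_log (by positivity) h1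
      rw [Real.log_mul (by positivity) (Real.exp_pos _).ne', Real.log_exp, one_div,
        Real.log_inv] at h2
      have h3 := mul_le_mul_of_nonneg_left h2 (show 0 ≤ 16 * m (t + 1) by positivity)
      have h4 : 16 * m (t + 1) * (-Real.log (Fintype.card Φ)
          + -(1 / (16 * m (t + 1))) * S (t + 1) j)
          = -(16 * m (t + 1) * Real.log (Fintype.card Φ)) - S (t + 1) j := by
        field_simp
        ring
      linarith
  have hlhs : ∑ t ∈ Finset.range T, w t * ∑ φ, q t φ * (D t φ - D t j)
      = ∑ t ∈ Finset.range T, w t * ∑ φ, q t φ * D t φ - S T j := by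
    rw [hS]
    simp only
    rw [← Finset.sum_sub_distrib]
    refine Finset.sum_congr rfl fun t ht => ?_
    have := (hqs t (Finset.mem_range.1 ht)).2
    simp only [mul_sub, Finset.sum_sub_distrib, ← Finset.sum_mul, this, one_mul]
  rw [hlhs]
  simp only [mul_zero, zero_mul, neg_zero, sub_zero] at hsum
  linarith

end Finite

/-- The relative increments of the running maximum `m` of `w` sum to at most
`1 + log (m_T / m_1)`. -/
theorem sum_bias_le {T : ℕ} {w m : ℕ → ℝ} (hw0 : 0 < w 0) (hm0 : m 0 = 0)
    (hm : ∀ t < T + 1, m (t + 1) = max (m t) (w t)) :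
    ∑ t ∈ Finset.range (T + 1), max (w t - m t) 0 / w t
      ≤ 1 + Real.log (m (T + 1)) - Real.log (w 0) ∧ 0 < m (T + 1) := by
  induction T with
  | zero =>
    have : m 1 = w 0 := by rw [hm 0 (by omega), hm0]; exact max_eq_right hw0.le
    simp [hm0, this, max_eq_left hw0.le, hw0.ne', hw0]
  | succ T ih =>
    obtain ⟨h1, h2⟩ := ih fun t ht => hm t (by omega)
    rw [Finset.sum_range_succ, hm (T + 1) (by omega)]
    refine ⟨?_, lt_max_of_lt_left h2⟩
    rcases le_total (w (T + 1)) (m (T + 1)) with h | h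
    · rw [max_eq_right (by linarith), max_eq_left h]; simpa using h1
    · rw [max_eq_left (by linarith), max_eq_right h]
      have hw : 0 < w (T + 1) := h2.trans_le h
      -- A new maximum contributes 1 - m/w ≤ log (w/m), which is the increment of log m; the first
      -- round contributes 1.
      have := Real.one_sub_inv_le_log_of_pos (div_pos hw h2)
      rw [Real.log_div hw.ne' h2.ne', inv_div] at this
      rw [sub_div, div_self hw.ne']
      linarith

end DigDEC

namespace DigDEC

/-! ### Pathwise analysis of the bi-level update -/

/-- A real supremum over the empty type is 0, so the recursion holds at t = 0 only because f 0 ≥ 0.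
This is the convention that the maximum over no rounds vanishes. -/
theorem iSup_fin_succ {f : ℕ → ℝ} (hf : 0 ≤ f 0) (t : ℕ) :
    (⨆ s : Fin (t + 1), f s) = max (⨆ s : Fin t, f s) (f t) := by
  have hb : ∀ t : ℕ, BddAbove (range fun s : Fin t => f s) := fun t => (finite_range _).bddAbove
  apply le_antisymm
  · refine ciSup_le fun s => ?_
    rcases Nat.lt_succ_iff_lt_or_eq.1 s.2 with h | h
    · exact le_max_of_le_left (le_ciSup (hb t) ⟨s, h⟩)
    · rw [h]; exact le_max_right _ _
  · refine max_le ?_ (le_ciSup (hb (t + 1)) (Fin.last t))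
    rcases Nat.eq_zero_or_pos t with rfl | ht
    · rw [Real.iSup_of_isEmpty]
      exact hf.trans (le_ciSup (hb 1) (Fin.last 0))
    · have : Nonempty (Fin t) := ⟨⟨0, ht⟩⟩
      exact ciSup_le fun s => le_ciSup (hb (t + 1)) s.castSucc

theorem delta_mem {Φ Obs : Type*} {H : ℕ} {B : ℝ} {ξ : Fin H → Φ → Φ → Obs → ℝ} (hH : 0 < H)
    (hB : 0 < B) (hξ : ∀ h φ' φ o, ξ h φ' φ o ∈ Icc 0 (B ^ 2)) (o : Obs) (φ' φ : Φ) :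
    delta B ξ o φ' φ ∈ Icc (0 : ℝ) 1 := by
  have hH' : (0 : ℝ) < H := by exact_mod_cast hH
  refine ⟨mul_nonneg (by positivity) (Finset.sum_nonneg fun h _ => (hξ h φ' φ o).1), ?_⟩
  rw [delta, one_div, inv_mul_le_iff₀ (by positivity), mul_one]
  calc ∑ h, ξ h φ' φ o ≤ ∑ _h : Fin H, B ^ 2 := Finset.sum_le_sum fun h _ => (hξ h φ' φ o).2
    _ = B ^ 2 * H := by simp [mul_comm]

/-- The loss difference `Δ(φ', φ) - Δ(τ φ, φ)` to the comparator `τ φ`. -/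
noncomputable def excess {Φ Obs : Type*} {H : ℕ} (B : ℝ) (ξ : Fin H → Φ → Φ → Obs → ℝ)
    (τ : Φ → Φ) (o : Obs) (φ' φ : Φ) : ℝ :=
  delta B ξ o φ' φ - delta B ξ o (τ φ) φ

theorem abs_excess_le {Φ Obs : Type*} {H : ℕ} {B : ℝ} {ξ : Fin H → Φ → Φ → Obs → ℝ} (hH : 0 < H)
    (hB : 0 < B) (hξ : ∀ h φ' φ o, ξ h φ' φ o ∈ Icc 0 (B ^ 2)) (τ : Φ → Φ) (o : Obs) (φ' φ : Φ) :
    |excess B ξ τ o φ' φ| ≤ 1 := by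
  have h1 := delta_mem hH hB hξ o φ' φ
  have h2 := delta_mem hH hB hξ o (τ φ) φ
  rw [excess, abs_le]
  constructor <;> linarith [h1.1, h1.2, h2.1, h2.2]

section Finite

variable {Φ Obs : Type*} [Fintype Φ]

theorem half_lt_log_card (hn : 1 < Fintype.card Φ) : 1 / 2 < Real.log (Fintype.card Φ) := by
  have h1 : Real.log 2 ≤ Real.log (Fintype.card Φ) :=
    Real.log_le_log (by norm_num) (by exact_mod_cast hn)
  linarith [Real.log_two_gt_d9]

theorem iota_gt (hn : 1 < Fintype.card Φ) : 32 < iota Φ := by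
  have := half_lt_log_card hn
  unfold iota; linarith

theorem gam_pos (hn : 1 < Fintype.card Φ) : 0 < gam Φ := by
  have := iota_gt hn
  unfold gam; positivity

theorem gam_le (hn : 1 < Fintype.card Φ) : gam Φ ≤ 1 / 16 := by
  have := iota_gt hn
  exact one_div_le_one_div_of_le (by norm_num) (by linarith)

theorem gam_mul_iota (hn : 1 < Fintype.card Φ) : gam Φ * iota Φ = 1 / 4 := by
  have := iota_gt hn
  unfold gam; field_simp

theorem abs_topLoss_le {H : ℕ} {B : ℝ} {ξ : Fin H → Φ → Φ → Obs → ℝ} (hH : 0 < H)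
    (hB : 0 < B) (hξ : ∀ h φ' φ o, ξ h φ' φ o ∈ Icc 0 (B ^ 2)) {q : Φ → Φ → ℝ} {φ : Φ}
    (hq : q φ ∈ stdSimplex ℝ Φ) (o : Obs) : |topLoss B ξ q o φ| ≤ 1 := by
  have h1 := delta_mem hH hB hξ o φ φ
  have h2 : 0 ≤ ∑ φ', q φ φ' * delta B ξ o φ' φ :=
    Finset.sum_nonneg fun φ' _ => mul_nonneg (hq.1 φ') (delta_mem hH hB hξ o φ' φ).1
  have h3 : ∑ φ', q φ φ' * delta B ξ o φ' φ ≤ 1 := by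
    rw [← hq.2]
    exact Finset.sum_le_sum fun φ' _ =>
      mul_le_of_le_one_right (hq.1 φ') (delta_mem hH hB hξ o φ' φ).2
  rw [topLoss, abs_le]
  constructor <;> linarith [h1.1, h1.2]

theorem iSup_fin_nonneg {f : ℕ → ℝ} {t : ℕ} (hf : ∀ s < t, 0 ≤ f s) : 0 ≤ ⨆ s : Fin t, f s :=
  Real.iSup_nonneg fun s => hf s s.2

theorem bias_mem (hn : 1 < Fintype.card Φ) {ρ : ℕ → Φ → ℝ} {t : ℕ} {φ : Φ}
    (hρ : ∀ s ≤ t, 0 ≤ ρ s φ) : bias ρ t φ ∈ Icc 0 (iota Φ) := by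
  have hi := iota_gt hn
  have hm := iSup_fin_nonneg (f := fun s => ρ s φ) fun s (hs : s < t) => hρ s hs.le
  have h0 := hρ t le_rfl
  refine ⟨?_, ?_⟩
  · unfold bias; positivity
  · have : max (ρ t φ - ⨆ s : Fin t, ρ s φ) 0 / ρ t φ ≤ 1 :=
      div_le_one_of_le₀ (max_le (by linarith) h0) h0
    unfold bias; nlinarith

/-- Multiplying by ρ_t(φ) turns the bias into ι times the increment of the running maximum, a
telescoping quantity. When ρ_t(φ) = 0 the positive part vanishes as well, so division by zero does
no harm. -/
theorem mul_bias {ρ : ℕ → Φ → ℝ} {t : ℕ} {φ : Φ} (hρ : ∀ s ≤ t, 0 ≤ ρ s φ) :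
    ρ t φ * bias ρ t φ = iota Φ * max (ρ t φ - ⨆ s : Fin t, ρ s φ) 0 := by
  have hm := iSup_fin_nonneg (f := fun s => ρ s φ) fun s (hs : s < t) => hρ s hs.le
  unfold bias
  rcases (hρ t le_rfl).eq_or_lt with h | h
  · rw [← h, max_eq_right (by linarith)]; simp
  · field_simp

/-- The identity of `topUpdate_spec` is used after dropping KL(r', post) ≥ 0 and after replacing
⟨r', g⟩ + KL(r', ρ_t)/γ by ⟨ρ_t, g⟩ through stability. The stability error γ g² is absorbed by the
correction 4γL² and by half of the bias; the other half of the bias stays as a gain. -/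
theorem top_step (hn : 1 < Fintype.card Φ) {L b post ρt r' : Φ → ℝ} {φs : Φ}
    (hL : ∀ φ, |L φ| ≤ 1) (hb : ∀ φ, b φ ∈ Icc 0 (iota Φ))
    (hr' : r' ∈ stdSimplex ℝ Φ) (hpost : post ∈ stdSimplex ℝ Φ) (hρ : ρt ∈ stdSimplex ℝ Φ)
    (hp : 0 < post φs) (hq : 0 < ρt φs)
    (hmin : ∀ r ∈ stdSimplex ℝ Φ, topObjective L b post ρt r' ≤ topObjective L b post ρt r) :
    Real.log (post φs) - Real.log (ρt φs)
      ≤ L φs + 4 * gam Φ * L φs ^ 2 + b φs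
        + (1 + 1 / gam Φ) * (Real.log (r' φs) - Real.log (ρt φs))
        - ∑ φ, ρt φ * (L φ + b φ / 2) := by
  have hγ := gam_pos hn
  have hγ16 := gam_le hn
  have hγι := gam_mul_iota hn
  obtain ⟨-, h1, h2, heq⟩ := topUpdate_spec hγ hr' hpost hρ hp hq hmin
  have hKL := sum_mul_log_div_nonneg hr' hpost h1
  have hL' := fun φ => abs_le.1 (hL φ)
  have hγb : ∀ φ, gam Φ * b φ ≤ 1 / 4 := fun φ => by
    rw [← hγι]; exact mul_le_mul_of_nonneg_left (hb φ).2 hγ.le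
  have hL2 : ∀ φ, L φ ^ 2 ≤ 1 := fun φ => by
    have := hL' φ; nlinarith
  have hst := mirror_stability (g := fun φ => L φ + 4 * gam Φ * L φ ^ 2 + b φ) hγ hr' hρ h2
      fun φ => by
    have h3 := hL' φ
    have h4 := hL2 φ
    have h5 := hγb φ
    have h6 : 0 ≤ gam Φ * b φ := mul_nonneg hγ.le (hb φ).1
    have h7 : 0 ≤ gam Φ * (gam Φ * L φ ^ 2) := by positivity
    have h8 : gam Φ * (gam Φ * L φ ^ 2) ≤ 1 / 16 * (1 / 16 * 1) := by gcongr
    rw [abs_le]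
    constructor <;> nlinarith
  -- By (x + b)² ≤ 2x² + 2b² with x = L(1 + 4γL): the factor (1 + 4γL)² is at most 2, and γb ≤ γι =
  -- 1/4 turns 2γb² into at most b/2.
  have hsq : gam Φ * ∑ φ, ρt φ * (L φ + 4 * gam Φ * L φ ^ 2 + b φ) ^ 2
      ≤ ∑ φ, ρt φ * (4 * gam Φ * L φ ^ 2 + b φ / 2) := by
    rw [Finset.mul_sum]
    refine Finset.sum_le_sum fun φ _ => ?_
    rw [mul_left_comm]
    refine mul_le_mul_of_nonneg_left ?_ (hρ.1 φ)
    have h3 := hL' φ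
    have h6 : gam Φ * b φ * b φ ≤ 1 / 4 * b φ := mul_le_mul_of_nonneg_right (hγb φ) (hb φ).1
    have h7 : (1 + 4 * gam Φ * L φ) ^ 2 ≤ 2 := by
      have h8 : gam Φ * L φ ≤ 1 / 16 := by nlinarith
      have h9 : -(1 / 16) ≤ gam Φ * L φ := by nlinarith
      nlinarith
    have h10 : gam Φ * (L φ ^ 2 * (1 + 4 * gam Φ * L φ) ^ 2) ≤ gam Φ * (L φ ^ 2 * 2) := by gcongr
    have h11 : 0 ≤ gam Φ * (L φ + 4 * gam Φ * L φ ^ 2 - b φ) ^ 2 := by positivity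
    nlinarith
  have hsplit : ∑ φ, ρt φ * (L φ + 4 * gam Φ * L φ ^ 2 + b φ)
      = ∑ φ, ρt φ * (L φ + b φ / 2) + ∑ φ, ρt φ * (4 * gam Φ * L φ ^ 2 + b φ / 2) := by
    rw [← Finset.sum_add_distrib]
    exact Finset.sum_congr rfl fun φ _ => by ring
  rw [hsplit] at hst
  linarith

/-- The weight of the pair `(φ', φ)` in the remainder of the pathwise bound. -/
noncomputable def excessWeight (ρt : Φ → ℝ) (q : Φ → Φ → ℝ) (φs φ φ' : Φ) : ℝ :=
  open Classical in (ρt φ / 3 + if φ = φs then 1 else 0) * q φ φ'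

theorem sum_mul_sq_ge {q x : Φ → ℝ} (hq : q ∈ stdSimplex ℝ Φ) :
    (∑ φ, q φ * x φ) ^ 2 ≤ ∑ φ, q φ * x φ ^ 2 := by
  have e : ∀ a : ℝ, ∑ φ, q φ * (x φ - a) ^ 2 = ∑ φ, q φ * x φ ^ 2 - 2 * a * ∑ φ, q φ * x φ
      + a ^ 2 * ∑ φ, q φ := fun a => by
    rw [Finset.mul_sum, Finset.mul_sum, ← Finset.sum_sub_distrib, ← Finset.sum_add_distrib]
    exact Finset.sum_congr rfl fun φ _ => by ring
  have h : 0 ≤ ∑ φ, q φ * (x φ - ∑ φ', q φ' * x φ') ^ 2 :=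
    Finset.sum_nonneg fun φ _ => mul_nonneg (hq.1 φ) (sq_nonneg _)
  rw [e, hq.2] at h
  nlinarith

/-- Entirely deterministic accounting. The top-level step contributes the telescoped log-ratio and
the bias paid at φs; the bias gained under ρ_t pays for the bottom-level regret at every φ.
Everything quadratic is collected in the shape X²/4 - X with nonnegative weights, ready for the
Bernstein condition. -/
theorem pathwise_bound {H T : ℕ} {B : ℝ} {ξ : Fin H → Φ → Φ → Obs → ℝ} {ρ post : ℕ → Φ → ℝ}
    {q : ℕ → Φ → Φ → ℝ} {o : ℕ → Obs} {τ : Φ → Φ} {φs : Φ}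
    (hn : 1 < Fintype.card Φ) (hH : 0 < H) (hB : 0 < B)
    (hξ : ∀ h φ' φ o, ξ h φ' φ o ∈ Icc 0 (B ^ 2)) (hτ : τ φs = φs)
    (hρ0 : ∀ φ, ρ 0 φ = 1 / Fintype.card Φ) (hq0 : ∀ φ φ', q 0 φ φ' = 1 / Fintype.card Φ)
    (hρ : ∀ t ≤ T, ρ t ∈ stdSimplex ℝ Φ) (hρs : ∀ t ≤ T, 0 < ρ t φs)
    (hpost : ∀ t < T, post t ∈ stdSimplex ℝ Φ) (hposts : ∀ t < T, 0 < post t φs)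
    (hmin : ∀ t < T, ∀ r ∈ stdSimplex ℝ Φ,
      topObjective (topLoss B ξ (q t) (o t)) (bias ρ t) (post t) (ρ t) (ρ (t + 1))
        ≤ topObjective (topLoss B ξ (q t) (o t)) (bias ρ t) (post t) (ρ t) r)
    (hq : ∀ t < T, ∀ φ φ', q (t + 1) φ φ'
      = expWeight B ξ ρ o t φ φ' / ∑ φ'', expWeight B ξ ρ o t φ φ'') :
    ∑ t ∈ Finset.range T, (Real.log (post t φs) - Real.log (ρ t φs)
        + ∑ φ, ρ t φ * excess B ξ τ (o t) φ φ)
      ≤ (1 + 1 / gam Φ) * Real.log (Fintype.card Φ) + iota Φ * (1 + Real.log (Fintype.card Φ))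
        + ∑ t ∈ Finset.range T, ∑ φ, ∑ φ', excessWeight (ρ t) (q t) φs φ φ'
            * (excess B ξ τ (o t) φ' φ ^ 2 / 4 - excess B ξ τ (o t) φ' φ) := by
  classical
  have : Nonempty Φ := ⟨φs⟩
  have hι := iota_gt hn
  have hγ := gam_pos hn
  have hγ16 := gam_le hn
  have hcard : (0 : ℝ) < Fintype.card Φ := by exact_mod_cast Fintype.card_pos
  have hlog := half_lt_log_card hn
  have hρ0pos : ∀ φ, 0 < ρ 0 φ := fun φ => by rw [hρ0]; positivity
  have hρnn : ∀ t ≤ T, ∀ φ, 0 ≤ ρ t φ := fun t ht φ => (hρ t ht).1 φ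
  set m : Φ → ℕ → ℝ := fun φ t => ⨆ s : Fin t, ρ s φ with hm
  have hm0 : ∀ φ, m φ 0 = 0 := fun φ => Real.iSup_of_isEmpty _
  have hms : ∀ φ t, m φ (t + 1) = max (m φ t) (ρ t φ) := fun φ t =>
    iSup_fin_succ (f := fun s => ρ s φ) (hρ0pos φ).le t
  -- For t = 0 the rate 1/(16 · 0) is 0, and the formula gives the uniform distribution that the
  -- algorithm starts from.
  have hqform : ∀ t < T, ∀ φ φ', q t φ φ'
      = Real.exp (-(1 / (16 * m φ t)) * ∑ s ∈ Finset.range t, ρ s φ * delta B ξ (o s) φ' φ)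
        / ∑ φ'', Real.exp (-(1 / (16 * m φ t))
            * ∑ s ∈ Finset.range t, ρ s φ * delta B ξ (o s) φ'' φ) := by
    intro t ht φ φ'
    rcases t with _ | t
    · simp [hq0]
    · exact hq t (by omega) φ φ'
  have hqs : ∀ t < T, ∀ φ, q t φ ∈ stdSimplex ℝ Φ := by
    intro t ht φ
    have hpos : 0 < ∑ φ'', Real.exp (-(1 / (16 * m φ t))
            * ∑ s ∈ Finset.range t, ρ s φ * delta B ξ (o s) φ'' φ) :=
      Finset.sum_pos (fun _ _ => Real.exp_pos _) Finset.univ_nonempty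
    refine ⟨fun φ' => ?_, ?_⟩
    · rw [hqform t ht]; positivity
    · rw [Finset.sum_congr rfl fun φ' _ => hqform t ht φ φ', ← Finset.sum_div, div_self hpos.ne']
  set X : ℕ → Φ → Φ → ℝ := fun t φ' φ => excess B ξ τ (o t) φ' φ with hX
  have hinner : ∀ φ, ∑ t ∈ Finset.range T, ρ t φ * ∑ φ', q t φ φ' * X t φ' φ
      ≤ (16 * Real.log (Fintype.card Φ) + 1) * m φ T
        + ∑ t ∈ Finset.range T, ρ t φ / 16 * ∑ φ', q t φ φ' * X t φ' φ ^ 2 := fun φ =>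
    expWeights_regret (w := fun t => ρ t φ) (m := m φ) (D := fun t φ' => delta B ξ (o t) φ' φ)
      (q := fun t => q t φ) (τ φ) (fun t ht => hρnn t ht.le φ) (fun _ => hρ0pos φ) (hm0 φ)
      (fun t _ => hms φ t) (fun t φ' => delta_mem hH hB hξ _ _ _) (fun t ht => hqform t ht φ)
  have hstep : ∀ t < T, Real.log (post t φs) - Real.log (ρ t φs) + ∑ φ, ρ t φ * X t φ φ
      ≤ bias ρ t φs + (1 + 1 / gam Φ) * (Real.log (ρ (t + 1) φs) - Real.log (ρ t φs))
        + ∑ φ', q t φs φ' * (X t φ' φs ^ 2 / 4 - X t φ' φs)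
        + ∑ φ, (ρ t φ * ∑ φ', q t φ φ' * X t φ' φ)
        - ∑ φ, iota Φ / 2 * (m φ (t + 1) - m φ t) := by
    intro t ht
    have h1 := top_step hn (fun φ => abs_topLoss_le hH hB hξ (hqs t ht φ) (o t))
      (fun φ => bias_mem hn fun s hs => hρnn s (by omega) φ) (hρ (t + 1) ht) (hpost t ht)
      (hρ t ht.le) (hposts t ht) (hρs t ht.le) (hmin t ht)
    -- The comparator loss Δ(τ φ, φ) cancels because q_t(·|φ) has mass 1.
    have hLX : ∀ φ, topLoss B ξ (q t) (o t) φ = X t φ φ - ∑ φ', q t φ φ' * X t φ' φ := by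
      intro φ
      simp only [hX, excess, topLoss, mul_sub, Finset.sum_sub_distrib, ← Finset.sum_mul,
        (hqs t ht φ).2]
      ring
    have hXs : X t φs φs = 0 := by simp [hX, excess, hτ]
    -- At φs the own excess vanishes since τ fixes φs, so the loss is minus the q-average of X. Its
    -- square is at most the q-average of X², and 4γ ≤ 1/4.
    have h2 : topLoss B ξ (q t) (o t) φs + 4 * gam Φ * topLoss B ξ (q t) (o t) φs ^ 2
        ≤ ∑ φ', q t φs φ' * (X t φ' φs ^ 2 / 4 - X t φ' φs) := by
      have h3 := sum_mul_sq_ge (x := fun φ' => X t φ' φs) (hqs t ht φs)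
      have h4 : ∑ φ', q t φs φ' * (X t φ' φs ^ 2 / 4 - X t φ' φs)
          = (∑ φ', q t φs φ' * X t φ' φs ^ 2) / 4 - ∑ φ', q t φs φ' * X t φ' φs := by
        rw [Finset.sum_div, ← Finset.sum_sub_distrib]
        exact Finset.sum_congr rfl fun φ _ => by ring
      rw [hLX, hXs, h4]
      have h5 := sq_nonneg (∑ φ', q t φs φ' * X t φ' φs)
      have h6 : 4 * gam Φ * (0 - ∑ φ', q t φs φ' * X t φ' φs) ^ 2
          ≤ 1 / 4 * (∑ φ', q t φs φ' * X t φ' φs) ^ 2 := by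
        rw [zero_sub, neg_sq]
        exact mul_le_mul_of_nonneg_right (by linarith) h5
      linarith
    have h7 : ∑ φ, ρ t φ * (topLoss B ξ (q t) (o t) φ + bias ρ t φ / 2)
        = ∑ φ, ρ t φ * X t φ φ - ∑ φ, (ρ t φ * ∑ φ', q t φ φ' * X t φ' φ)
          + ∑ φ, iota Φ / 2 * (m φ (t + 1) - m φ t) := by
      rw [← Finset.sum_sub_distrib, ← Finset.sum_add_distrib]
      refine Finset.sum_congr rfl fun φ _ => ?_
      have h8 := mul_bias (ρ := ρ) (t := t) (φ := φ) fun s hs => hρnn s (by omega) φ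
      have h9 : m φ (t + 1) - m φ t = max (ρ t φ - ⨆ s : Fin t, ρ s φ) 0 := by
        rw [hms, max_comm, ← max_sub_sub_right, sub_self]
      rw [hLX, h9, mul_add, mul_div_assoc', h8]
      ring
    linarith
  have hsum := Finset.sum_le_sum fun t ht => hstep t (Finset.mem_range.1 ht)
  simp only [Finset.sum_sub_distrib, Finset.sum_add_distrib, ← Finset.mul_sum] at hsum
  have hbias : ∑ t ∈ Finset.range T, bias ρ t φs
      ≤ iota Φ * (1 + Real.log (Fintype.card Φ)) := by
    rcases T with _ | T
    · simp only [Finset.range_zero, Finset.sum_empty]; positivity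
    · obtain ⟨h1, h2⟩ := sum_bias_le (T := T) (w := fun t => ρ t φs) (m := m φs) (hρ0pos φs)
        (hm0 φs) (fun t _ => hms φs t)
      have h3 : m φs (T + 1) ≤ 1 := ciSup_le fun s => by
        have h4 := hρ s s.2.le
        rw [← h4.2]
        exact Finset.single_le_sum (fun φ _ => h4.1 φ) (Finset.mem_univ _)
      have h5 := Real.log_nonpos h2.le h3
      rw [hρ0, one_div, Real.log_inv] at h1
      calc ∑ t ∈ Finset.range (T + 1), bias ρ t φs
          = iota Φ * ∑ t ∈ Finset.range (T + 1), max (ρ t φs - m φs t) 0 / ρ t φs := by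
            rw [Finset.mul_sum]
            exact Finset.sum_congr rfl fun t _ => mul_comm _ _
        _ ≤ _ := mul_le_mul_of_nonneg_left (by linarith) (by linarith)
  have htel : (1 + 1 / gam Φ)
      * ((∑ t ∈ Finset.range T, Real.log (ρ (t + 1) φs)) - ∑ t ∈ Finset.range T, Real.log (ρ t φs))
      ≤ (1 + 1 / gam Φ) * Real.log (Fintype.card Φ) := by
    refine mul_le_mul_of_nonneg_left ?_ (by positivity)
    rw [← Finset.sum_sub_distrib, Finset.sum_range_sub fun t => Real.log (ρ t φs), hρ0 φs,
      one_div, Real.log_inv]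
    have h4 := hρ T le_rfl
    have : ρ T φs ≤ 1 := by
      rw [← h4.2]
      exact Finset.single_le_sum (fun φ _ => h4.1 φ) (Finset.mem_univ _)
    have := Real.log_nonpos (hρs T le_rfl).le this
    linarith
  -- The inner regret R is written as (4/3) R - R/3 and the regret bound is applied to the first
  -- part only. The second-order term with coefficient (4/3)/16 = 1/12 then combines with -R/3 into
  -- (ρ/3)(X²/4 - X).
  have hrem : ∑ t ∈ Finset.range T, ∑ φ, ∑ φ', excessWeight (ρ t) (q t) φs φ φ'
        * (X t φ' φ ^ 2 / 4 - X t φ' φ)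
      = ∑ t ∈ Finset.range T, ∑ φ', q t φs φ' * (X t φ' φs ^ 2 / 4 - X t φ' φs)
        + ∑ φ, ((∑ t ∈ Finset.range T, ρ t φ / 16 * ∑ φ', q t φ φ' * X t φ' φ ^ 2) * (4 / 3)
          - (∑ t ∈ Finset.range T, ρ t φ * ∑ φ', q t φ φ' * X t φ' φ) / 3) := by
    have e1 : ∀ φ, ((∑ t ∈ Finset.range T, ρ t φ / 16 * ∑ φ', q t φ φ' * X t φ' φ ^ 2) * (4 / 3)
          - (∑ t ∈ Finset.range T, ρ t φ * ∑ φ', q t φ φ' * X t φ' φ) / 3)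
        = ∑ t ∈ Finset.range T, ∑ φ', ρ t φ / 3 * q t φ φ' * (X t φ' φ ^ 2 / 4 - X t φ' φ) := by
      intro φ
      rw [Finset.sum_mul, Finset.sum_div, ← Finset.sum_sub_distrib]
      refine Finset.sum_congr rfl fun t _ => ?_
      rw [Finset.mul_sum, Finset.mul_sum, Finset.sum_mul, Finset.sum_div,
        ← Finset.sum_sub_distrib]
      exact Finset.sum_congr rfl fun φ' _ => by ring
    have e3 : ∑ φ, ∑ t ∈ Finset.range T, ∑ φ', ρ t φ / 3 * q t φ φ'
          * (X t φ' φ ^ 2 / 4 - X t φ' φ)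
        = ∑ t ∈ Finset.range T, ∑ φ, ∑ φ', ρ t φ / 3 * q t φ φ'
          * (X t φ' φ ^ 2 / 4 - X t φ' φ) := Finset.sum_comm
    rw [Finset.sum_congr rfl fun φ _ => e1 φ, e3, ← Finset.sum_add_distrib]
    refine Finset.sum_congr rfl fun t _ => ?_
    have e2 : ∑ φ', q t φs φ' * (X t φ' φs ^ 2 / 4 - X t φ' φs)
        = ∑ φ, ∑ φ', (if φ = φs then 1 else 0) * q t φ φ' * (X t φ' φ ^ 2 / 4 - X t φ' φ) := by
      symm
      exact (Finset.sum_eq_single φs (fun φ _ h => by simp [h]) (by simp)).trans (by simp)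
    rw [e2, ← Finset.sum_add_distrib]
    refine Finset.sum_congr rfl fun φ _ => ?_
    rw [← Finset.sum_add_distrib]
    refine Finset.sum_congr rfl fun φ' _ => ?_
    simp only [excessWeight]
    ring
  have hswap : ∑ t ∈ Finset.range T, ∑ φ, (ρ t φ * ∑ φ', q t φ φ' * X t φ' φ)
      = ∑ φ, ∑ t ∈ Finset.range T, ρ t φ * ∑ φ', q t φ φ' * X t φ' φ := Finset.sum_comm
  have htelm : iota Φ / 2 * ((∑ t ∈ Finset.range T, ∑ φ, m φ (t + 1))
      - ∑ t ∈ Finset.range T, ∑ φ, m φ t) = ∑ φ, iota Φ / 2 * m φ T := by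
    rw [← Finset.sum_sub_distrib, Finset.sum_range_sub fun t => ∑ φ, m φ t]
    simp [hm0, Finset.mul_sum]
  have hfin : ∑ φ, ((∑ t ∈ Finset.range T, ρ t φ * ∑ φ', q t φ φ' * X t φ' φ)
        - iota Φ / 2 * m φ T)
      ≤ ∑ φ, ((∑ t ∈ Finset.range T, ρ t φ / 16 * ∑ φ', q t φ φ' * X t φ' φ ^ 2) * (4 / 3)
          - (∑ t ∈ Finset.range T, ρ t φ * ∑ φ', q t φ φ' * X t φ' φ) / 3) := by
    refine Finset.sum_le_sum fun φ _ => ?_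
    have h1 := hinner φ
    have h2 : 0 ≤ m φ T := iSup_fin_nonneg fun s hs => hρnn s hs.le φ
    -- The size of ι serves here: half of 64 log |Φ| exceeds (4/3)(16 log |Φ| + 1) once log |Φ| ≥
    -- 1/8.
    have h3 : (16 * Real.log (Fintype.card Φ) + 1) * m φ T * (4 / 3) ≤ iota Φ / 2 * m φ T := by
      have : (16 * Real.log (Fintype.card Φ) + 1) * (4 / 3) ≤ iota Φ / 2 := by
        unfold iota; linarith
      nlinarith
    linarith
  rw [Finset.sum_sub_distrib] at hfin
  show ∑ t ∈ Finset.range T, (Real.log (post t φs) - Real.log (ρ t φs)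
        + ∑ φ, ρ t φ * X t φ φ) ≤ _ + ∑ t ∈ Finset.range T, ∑ φ, ∑ φ',
          excessWeight (ρ t) (q t) φs φ φ' * (X t φ' φ ^ 2 / 4 - X t φ' φ)
  rw [hrem]
  simp only [Finset.sum_sub_distrib, Finset.sum_add_distrib] at hsum hfin hswap htel htelm ⊢
  linarith

end Finite

end DigDEC

namespace DigDEC

/-! ### Likelihoods of mixtures -/

/-- Weights of a discrete probability distribution on `Ψ`. -/
structure IsWeight {Mod Pol Φ : Type*} (I : InfoSets Mod Pol Φ) (w : Mod × Pol → ℝ≥0∞) :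
    Prop where
  countable : w.support.Countable
  subset : w.support ⊆ I.union
  tsum_eq : ∑' x, w x = 1

section Weight

variable {Mod Pol Φ : Type*} {I : InfoSets Mod Pol Φ} {w : Mod × Pol → ℝ≥0∞}

theorem IsWeight.of_pmf {ν : PMF (Mod × Pol)} (h : ν.support ⊆ I.union) : IsWeight I ν :=
  ⟨ν.support_countable, h, ν.tsum_coe⟩

theorem support_mixSegment_subset {X : Type*} (x : X) (w : X → ℝ≥0∞) (ε : ℝ) :
    (mixSegment (PMF.pure x) w ε).support ⊆ insert x w.support := by
  classical
  intro y hy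
  by_cases hyx : y = x
  · exact Or.inl hyx
  · right
    intro h0
    simp [mixSegment, h0, PMF.pure_apply, hyx] at hy

theorem isWeight_mixSegment {x : Mod × Pol} {φs : Φ} (hx : x ∈ I.set φs) (hw : IsWeight I w)
    {ε : ℝ} (hε : ε ∈ Icc (0 : ℝ) 1) : IsWeight I (mixSegment (PMF.pure x) w ε) := by
  have hsub := support_mixSegment_subset x w ε
  refine ⟨(hw.countable.insert x).mono hsub, hsub.trans ?_, ?_⟩
  · exact insert_subset (mem_iUnion.2 ⟨φs, hx⟩) hw.subset
  · simp only [mixSegment]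
    rw [ENNReal.tsum_add, ENNReal.tsum_mul_left, ENNReal.tsum_mul_left, hw.tsum_eq, PMF.tsum_coe,
      mul_one, mul_one, ← ENNReal.ofReal_add (by linarith [hε.2]) hε.1]
    simp

end Weight

section Likelihood

variable {Mod Pol Obs Φ : Type*} [MeasurableSpace Mod] [MeasurableSpace Obs]
  {E : DMSO Mod Pol Obs} {I : InfoSets Mod Pol Φ} {w : Mod × Pol → ℝ≥0∞}

theorem isProbabilityMeasure_law (E : DMSO Mod Pol Obs) (M : Mod) (π : Pol) :
    IsProbabilityMeasure (E.law M π) :=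
  ⟨by rw [DMSO.law, withDensity_apply _ MeasurableSet.univ, Measure.restrict_univ,
    E.lintegral_lik]⟩

theorem measurable_infoLik (E : DMSO Mod Pol Obs) (hw : w.support.Countable) (π : Pol) (φ : Φ) :
    Measurable fun o => infoLik E I w π o φ := by
  have : Countable w.support := hw.to_subtype
  have h : ∀ o, infoLik E I w π o φ
      = ∑' x : w.support, (I.set φ).indicator (fun x => w x * E.lik x.1 π o) x.1 := fun o =>
    (tsum_subtype_eq_of_support_subset (f := fun x => (I.set φ).indicator
      (fun x => w x * E.lik x.1 π o) x) fun x hx => by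
        intro h0
        simp [indicator, h0] at hx).symm
  simp only [h]
  refine Measurable.tsum fun x => ?_
  by_cases hx : x.1 ∈ I.set φ
  · simpa [indicator, hx] using (E.measurable_lik x.1.1 π).const_mul (w x.1)
  · simp [indicator, hx]

/-- The sets are disjoint, so the point mass feeds the coordinate φs alone. Along the segment the
unnormalised posterior therefore moves on a line, and `mixVec` describes it. -/
theorem infoLik_mixSegment {x : Mod × Pol} {φs : Φ} (hx : x ∈ I.set φs) (π : Pol) (o : Obs)
    (φ : Φ) (ε : ℝ) [Decidable (φ = φs)] :
    infoLik E I (mixSegment (PMF.pure x) w ε) π o φ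
      = ENNReal.ofReal (1 - ε) * infoLik E I w π o φ
        + ENNReal.ofReal ε * if φ = φs then E.lik x.1 π o else 0 := by
  classical
  have h : ∀ y, (I.set φ).indicator (fun y => mixSegment (PMF.pure x) w ε y * E.lik y.1 π o) y
      = ENNReal.ofReal (1 - ε) * (I.set φ).indicator (fun y => w y * E.lik y.1 π o) y
        + ENNReal.ofReal ε *
          (I.set φ).indicator (fun y => PMF.pure x y * E.lik y.1 π o) y := fun y => by
    by_cases hy : y ∈ I.set φ
    · simp only [indicator_of_mem hy, mixSegment]; ring
    · simp [indicator_of_notMem hy]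
  unfold infoLik
  simp only [h]
  rw [ENNReal.tsum_add, ENNReal.tsum_mul_left, ENNReal.tsum_mul_left]
  congr 2
  rw [tsum_eq_single x fun y hy => by simp [indicator, PMF.pure_apply, hy]]
  by_cases hφ : φ = φs
  · subst hφ; simp [hx]
  · rw [if_neg hφ]
    exact indicator_of_notMem (fun h => (I.disjoint φ φs hφ).le_bot ⟨h, hx⟩) _

variable [Fintype Φ]

theorem measurable_mixLik (E : DMSO Mod Pol Obs) (hw : w.support.Countable) (π : Pol) :
    Measurable fun o => mixLik E I w π o :=
  Finset.measurable_sum _ fun φ _ => measurable_infoLik E hw π φ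

theorem measurable_infoPosterior (E : DMSO Mod Pol Obs) (hw : w.support.Countable) (π : Pol)
    (φ : Φ) : Measurable fun o => infoPosterior E I w π o φ :=
  ((measurable_infoLik E hw π φ).div (measurable_mixLik E hw π)).ennreal_toReal

theorem measurable_kl {α : Type*} [MeasurableSpace α] {a : α → Φ → ℝ} {ρ : Φ → ℝ}
    (ha : ∀ φ, Measurable fun o => a o φ) : Measurable fun o => kl (a o) ρ := by
  unfold kl
  refine Measurable.ite ?_ ?_ measurable_const
  · simp only [ofPred_forall]
    refine MeasurableSet.iInter fun φ => MeasurableSet.iInter fun _ => ?_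
    exact ha φ (measurableSet_singleton 0)
  · refine ENNReal.measurable_ofReal.comp (Finset.measurable_sum _ fun φ _ => ?_)
    exact (ha φ).mul (Real.measurable_log.comp ((ha φ).div_const _))

theorem mixLik_eq (hw : w.support ⊆ I.union) (π : Pol) (o : Obs) :
    mixLik E I w π o = ∑' x, w x * E.lik x.1 π o := by
  unfold mixLik infoLik
  rw [← Summable.tsum_finsetSum fun _ _ => ENNReal.summable]
  refine tsum_congr fun x => ?_
  by_cases hx : w x = 0
  · simp [indicator, hx]
  · obtain ⟨φ, hφ⟩ := mem_iUnion.1 (hw hx)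
    rw [Finset.sum_eq_single φ]
    · exact indicator_of_mem hφ _
    · intro φ' _ hne
      exact indicator_of_notMem (fun h => (I.disjoint φ' φ hne).le_bot ⟨h, hφ⟩) _
    · simp

/-- Averaging the laws of the models over w has density `mixLik` with respect to the base measure.
This reduces inequalities between divergences to pointwise inequalities in o. -/
theorem tsum_mul_lintegral_law (hw : IsWeight I w) (π : Pol) {g : Obs → ℝ≥0∞}
    (hg : Measurable g) :
    ∑' x : Mod × Pol, w x * ∫⁻ o, g o ∂(E.law x.1 π) = ∫⁻ o, g o * mixLik E I w π o ∂E.base := by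
  have : Countable w.support := hw.countable.to_subtype
  have h1 : ∀ x : Mod × Pol, w x * ∫⁻ o, g o ∂(E.law x.1 π)
      = ∫⁻ o, g o * (w x * E.lik x.1 π o) ∂E.base := fun x => by
    rw [DMSO.law, lintegral_withDensity_eq_lintegral_mul _ (E.measurable_lik _ _) hg,
      ← lintegral_const_mul _ ((E.measurable_lik _ _).mul hg)]
    refine lintegral_congr fun o => ?_
    simp only [Pi.mul_apply]
    ring
  have h2 : ∀ o, g o * mixLik E I w π o = ∑' x : w.support, g o * (w x * E.lik x.1.1 π o) := by
    intro o
    rw [mixLik_eq hw.subset, ← ENNReal.tsum_mul_left]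
    refine (tsum_subtype_eq_of_support_subset
      (f := fun x : Mod × Pol => g o * (w x * E.lik x.1 π o)) fun x hx => ?_).symm
    intro h0
    simp [h0] at hx
  simp only [h1, h2]
  rw [lintegral_tsum (f := fun (x : w.support) o => g o * (w x * E.lik x.1.1 π o)) fun x =>
    (hg.mul ((E.measurable_lik _ _).const_mul _)).aemeasurable]
  refine (tsum_subtype_eq_of_support_subset
      (f := fun x : Mod × Pol => ∫⁻ o, g o * (w x * E.lik x.1 π o) ∂E.base) fun x hx => ?_).symm
  intro h0
  simp [h0] at hx

theorem lintegral_mixLik (hw : IsWeight I w) (π : Pol) :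
    ∫⁻ o, mixLik E I w π o ∂E.base = 1 := by
  have := tsum_mul_lintegral_law (E := E) hw π (g := fun _ => 1) measurable_const
  have h := fun (x : Mod × Pol) => isProbabilityMeasure_law E x.1 π
  simp only [lintegral_const, measure_univ, mul_one, one_mul] at this
  rw [← this, hw.tsum_eq]

theorem infoLik_le_mixLik (π : Pol) (o : Obs) (φ : Φ) :
    infoLik E I w π o φ ≤ mixLik E I w π o :=
  Finset.single_le_sum (f := fun φ => infoLik E I w π o φ) (fun _ _ => zero_le)
    (Finset.mem_univ φ)

end Likelihood

/-! ### First-order bounds for the relative entropy of posteriors -/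

/-- `-log p` as an extended nonnegative real. -/
noncomputable def negLog (p : ℝ) : ℝ≥0∞ := (-(ENNReal.log (ENNReal.ofReal p))).toENNReal

/-- The value ⊤ at nonpositive arguments, in place of the real convention log 0 = 0, is what makes
the function continuous; the passage to the limit ε → 0 relies on it. -/
theorem continuous_negLog : Continuous negLog :=
  (continuous_neg.comp (ENNReal.continuous_log.comp ENNReal.continuous_ofReal)).ereal_toENNReal

theorem negLog_of_pos {p : ℝ} (hp : 0 < p) : negLog p = ENNReal.ofReal (-Real.log p) := by
  rw [negLog, ENNReal.log_ofReal_of_pos hp, ← EReal.coe_neg, EReal.real_coe_toENNReal]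

theorem negLog_of_nonpos {p : ℝ} (hp : p ≤ 0) : negLog p = ⊤ := by
  simp [negLog, ENNReal.log_ofReal, hp]

/-- The unnormalised posterior `(1 - ε) n + ε m e_s`. -/
noncomputable def mixVec {Φ : Type*} [DecidableEq Φ] (n : Φ → ℝ) (m : ℝ) (s : Φ)
    (ε : ℝ) (φ : Φ) : ℝ :=
  (1 - ε) * n φ + ε * if φ = s then m else 0

theorem mixVec_nonneg {Φ : Type*} [DecidableEq Φ] {n : Φ → ℝ} {m ε : ℝ} {s : Φ}
    (hn : ∀ φ, 0 ≤ n φ) (hm : 0 ≤ m)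
    (hε : ε ∈ Icc (0 : ℝ) 1) (φ : Φ) : 0 ≤ mixVec n m s ε φ := by
  have : 0 ≤ (if φ = s then m else 0) := by split_ifs <;> simp [hm]
  exact add_nonneg (mul_nonneg (by linarith [hε.2]) (hn φ)) (mul_nonneg hε.1 this)

section Pointwise

variable {Φ : Type*} [Fintype Φ]

/-- `∑ a log (a / (A ρ))` with `A = ∑ a`. -/
noncomputable def scaledKL (a ρ : Φ → ℝ) : ℝ :=
  ∑ φ, a φ * Real.log (a φ / (∑ φ', a φ') / ρ φ)

theorem scaledKL_eq (a ρ : Φ → ℝ) (ha : ∀ φ, 0 ≤ a φ) :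
    scaledKL a ρ = (∑ φ, a φ) *
      ∑ φ, (a φ / ∑ φ', a φ') * Real.log (a φ / (∑ φ', a φ') / ρ φ) := by
  rcases (Finset.sum_nonneg fun φ (_ : φ ∈ Finset.univ) => ha φ).eq_or_lt with h | h
  · have h0 : ∀ φ, a φ = 0 := fun φ =>
      (Finset.sum_eq_zero_iff_of_nonneg fun φ _ => ha φ).1 h.symm φ (Finset.mem_univ _)
    simp [scaledKL, h0]
  · rw [scaledKL, Finset.mul_sum]
    refine Finset.sum_congr rfl fun φ _ => ?_
    rw [← mul_assoc, mul_div_cancel₀ _ h.ne']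

theorem normalized_mem {a : Φ → ℝ} (ha : ∀ φ, 0 ≤ a φ) (hA : 0 < ∑ φ, a φ) :
    (fun φ => a φ / ∑ φ', a φ') ∈ stdSimplex ℝ Φ :=
  ⟨fun φ => div_nonneg (ha φ) hA.le, by rw [← Finset.sum_div, div_self hA.ne']⟩

theorem scaledKL_nonneg {a ρ : Φ → ℝ} (ha : ∀ φ, 0 ≤ a φ) (hρ : ρ ∈ stdSimplex ℝ Φ)
    (h : ∀ φ, ρ φ = 0 → a φ = 0) : 0 ≤ scaledKL a ρ := by
  rcases (Finset.sum_nonneg fun φ (_ : φ ∈ Finset.univ) => ha φ).eq_or_lt with h' | h'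
  · rw [scaledKL_eq a ρ ha, ← h', zero_mul]
  · rw [scaledKL_eq a ρ ha]
    refine mul_nonneg h'.le (sum_mul_log_div_nonneg (normalized_mem ha h') hρ fun φ h0 => ?_)
    rw [h φ h0, zero_div]

theorem kl_mul_eq {a ρ : Φ → ℝ} (ha : ∀ φ, 0 ≤ a φ) (h : ∀ φ, ρ φ = 0 → a φ = 0) :
    kl (fun φ => a φ / ∑ φ', a φ') ρ * ENNReal.ofReal (∑ φ, a φ)
      = ENNReal.ofReal (scaledKL a ρ) := by
  rw [kl_eq_ofReal fun φ h0 => by rw [h φ h0, zero_div], mul_comm, scaledKL_eq a ρ ha,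
    ENNReal.ofReal_mul (Finset.sum_nonneg fun φ _ => ha φ)]

/-- Gibbs' inequality for unnormalised vectors. -/
theorem sum_mul_log_normalized_le {a b : Φ → ℝ} (ha : ∀ φ, 0 ≤ a φ) (hb : ∀ φ, 0 ≤ b φ)
    (hA : 0 < ∑ φ, a φ) (hB : 0 < ∑ φ, b φ) {ρ : Φ → ℝ} (hab : ∀ φ, b φ = 0 → a φ = 0)
    (haρ : ∀ φ, ρ φ = 0 → a φ = 0) :
    ∑ φ, a φ * Real.log (b φ / (∑ φ', b φ') / ρ φ) ≤ scaledKL a ρ := by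
  have h1 := sum_mul_log_div_nonneg (normalized_mem ha hA) (normalized_mem hb hB) fun φ h => by
    rcases div_eq_zero_iff.1 h with h | h
    · rw [hab φ h, zero_div]
    · exact absurd h hB.ne'
  have h2 : scaledKL a ρ - ∑ φ, a φ * Real.log (b φ / (∑ φ', b φ') / ρ φ)
      = (∑ φ, a φ)
        * ∑ φ, a φ / (∑ φ', a φ') * Real.log (a φ / (∑ φ', a φ') / (b φ / ∑ φ', b φ')) := by
    rw [scaledKL, ← Finset.sum_sub_distrib, Finset.mul_sum]
    refine Finset.sum_congr rfl fun φ _ => ?_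
    rw [← mul_assoc, mul_div_cancel₀ _ hA.ne']
    by_cases h0 : a φ = 0
    · simp [h0]
    · have h3 : b φ ≠ 0 := fun h => h0 (hab φ h)
      have h4 : ρ φ ≠ 0 := fun h => h0 (haρ φ h)
      rw [Real.log_div (div_ne_zero h0 hA.ne') h4, Real.log_div (div_ne_zero h3 hB.ne') h4,
        Real.log_div (div_ne_zero h0 hA.ne') (div_ne_zero h3 hB.ne')]
      ring
  have := mul_nonneg hA.le h1
  linarith

variable [DecidableEq Φ]

theorem sum_mixVec (n : Φ → ℝ) (m : ℝ) (s : Φ) (ε : ℝ) :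
    ∑ φ, mixVec n m s ε φ = (1 - ε) * ∑ φ, n φ + ε * m := by
  simp [mixVec, Finset.sum_add_distrib, Finset.mul_sum]

theorem sum_mixVec_mul (n : Φ → ℝ) (m : ℝ) (s : Φ) (ε : ℝ) (f : Φ → ℝ) :
    ∑ φ, mixVec n m s ε φ * f φ = (1 - ε) * ∑ φ, n φ * f φ + ε * (m * f s) := by
  have : ∀ φ, mixVec n m s ε φ * f φ
      = (1 - ε) * (n φ * f φ) + ε * (if φ = s then m * f s else 0) := fun φ => by
    unfold mixVec
    split_ifs with h
    · subst h; ring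
    · ring
  simp [this, Finset.sum_add_distrib, Finset.mul_sum]

/-- With the logarithms of the mixed posterior held fixed the expression is linear in the vector. In
the n-part, Gibbs' inequality replaces the mixed posterior by the posterior of n itself. -/
theorem scaledKL_mixVec_le {n ρ : Φ → ℝ} {m ε : ℝ} {s : Φ} (hn : ∀ φ, 0 ≤ n φ) (hm : 0 ≤ m)
    (hε : ε ∈ Ico (0 : ℝ) 1) (hnρ : ∀ φ, ρ φ = 0 → n φ = 0) :
    scaledKL (mixVec n m s ε) ρ ≤ (1 - ε) * scaledKL n ρ
      + ε * (m * Real.log (mixVec n m s ε s / (∑ φ, mixVec n m s ε φ) / ρ s)) := by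
  have hε1 : 0 < 1 - ε := by linarith [hε.2]
  rw [scaledKL, sum_mixVec_mul]
  gcongr
  rcases (Finset.sum_nonneg fun φ (_ : φ ∈ Finset.univ) => hn φ).eq_or_lt with h | h
  · have h0 : ∀ φ, n φ = 0 := fun φ =>
      (Finset.sum_eq_zero_iff_of_nonneg fun φ _ => hn φ).1 h.symm φ (Finset.mem_univ _)
    simp [scaledKL, h0]
  · have hite : ∀ φ, 0 ≤ ε * (if φ = s then m else 0) := fun φ =>
      mul_nonneg hε.1 (by split_ifs <;> simp [hm])
    refine sum_mul_log_normalized_le hn (fun φ => ?_) h ?_ (fun φ h0 => ?_) hnρ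
    · exact add_nonneg (mul_nonneg hε1.le (hn φ)) (hite φ)
    · rw [sum_mixVec]; exact add_pos_of_pos_of_nonneg (mul_pos hε1 h) (mul_nonneg hε.1 hm)
    · have := (add_eq_zero_iff_of_nonneg (mul_nonneg hε1.le (hn φ)) (hite φ)).1 h0
      exact (mul_eq_zero.1 this.1).resolve_left hε1.ne'

/-- Gibbs' inequality with the roles exchanged: the mixture is tested against the posterior at ε =
0. This is the tangent line of a convex, homogeneous function. -/
theorem le_scaledKL_mixVec {n ρ : Φ → ℝ} {m ε : ℝ} {s : Φ} (hn : ∀ φ, 0 ≤ n φ) (hm : 0 ≤ m)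
    (hns : m ≠ 0 → 0 < n s) (hε : ε ∈ Ico (0 : ℝ) 1) (hnρ : ∀ φ, ρ φ = 0 → n φ = 0) :
    (1 - ε) * scaledKL n ρ + ε * (m * Real.log (n s / (∑ φ, n φ) / ρ s))
      ≤ scaledKL (mixVec n m s ε) ρ := by
  have hε1 : 0 < 1 - ε := by linarith [hε.2]
  have hms : n s = 0 → m = 0 := fun h => by
    by_contra h'; exact (hns h').ne' h
  rcases (Finset.sum_nonneg fun φ (_ : φ ∈ Finset.univ) => hn φ).eq_or_lt with h | h
  · have h0 : ∀ φ, n φ = 0 := fun φ =>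
      (Finset.sum_eq_zero_iff_of_nonneg fun φ _ => hn φ).1 h.symm φ (Finset.mem_univ _)
    simp [scaledKL, h0, mixVec, hms (h0 s)]
  · have hite : ∀ φ, 0 ≤ ε * (if φ = s then m else 0) := fun φ =>
      mul_nonneg hε.1 (by split_ifs <;> simp [hm])
    have hzero : ∀ φ, n φ = 0 → mixVec n m s ε φ = 0 := fun φ h0 => by
      by_cases hφ : φ = s
      · subst hφ; simp [mixVec, h0, hms h0]
      · simp [mixVec, h0, hφ]
    have := sum_mul_log_normalized_le (a := mixVec n m s ε) (b := n) (ρ := ρ)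
      (fun φ => add_nonneg (mul_nonneg hε1.le (hn φ)) (hite φ)) hn
      (by rw [sum_mixVec]; exact add_pos_of_pos_of_nonneg (mul_pos hε1 h) (mul_nonneg hε.1 hm))
      h hzero fun φ h0 => hzero φ (hnρ φ h0)
    rwa [sum_mixVec_mul (f := fun φ => Real.log (n φ / (∑ φ', n φ') / ρ φ))] at this

/-- Placing each logarithm on the side where it is nonnegative gives an inequality in ℝ≥0∞, which
may be integrated before anything is known about integrability. -/
theorem ofReal_scaledKL_mixVec_add_le {n ρ : Φ → ℝ} {m ε : ℝ} {s : Φ} (hn : ∀ φ, 0 ≤ n φ)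
    (hm : 0 ≤ m) (hmn : m ≠ 0 → 0 < ∑ φ, n φ) (hε : ε ∈ Ioo (0 : ℝ) 1)
    (hρ : ρ ∈ stdSimplex ℝ Φ) (hρs : 0 < ρ s) (hnρ : ∀ φ, ρ φ = 0 → n φ = 0) :
    ENNReal.ofReal (scaledKL (mixVec n m s ε) ρ)
      + ENNReal.ofReal ε * (ENNReal.ofReal m
          * negLog (mixVec n m s ε s / ∑ φ, mixVec n m s ε φ))
      ≤ ENNReal.ofReal (1 - ε) * ENNReal.ofReal (scaledKL n ρ)
        + ENNReal.ofReal ε * (ENNReal.ofReal m * ENNReal.ofReal (-Real.log (ρ s))) := by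
  have hε1 : 0 < 1 - ε := by linarith [hε.2]
  have hle := scaledKL_mixVec_le (s := s) hn hm ⟨hε.1.le, hε.2⟩ hnρ
  have hK := scaledKL_nonneg hn hρ hnρ
  have hs1 : ρ s ≤ 1 := by
    rw [← hρ.2]; exact Finset.single_le_sum (fun φ _ => hρ.1 φ) (Finset.mem_univ s)
  have hls := Real.log_nonpos hρs.le hs1
  rcases hm.eq_or_lt with rfl | hm0
  · simp only [zero_mul, mul_zero, add_zero, ENNReal.ofReal_zero] at hle ⊢
    rw [← ENNReal.ofReal_mul hε1.le]
    exact ENNReal.ofReal_le_ofReal hle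
  · have hmix := mixVec_nonneg (s := s) hn hm ⟨hε.1.le, hε.2.le⟩
    have ha : 0 < mixVec n m s ε s := by
      simp only [mixVec, if_true]
      exact add_pos_of_nonneg_of_pos (mul_nonneg hε1.le (hn s)) (mul_pos hε.1 hm0)
    have hA : mixVec n m s ε s ≤ ∑ φ, mixVec n m s ε φ :=
      Finset.single_le_sum (fun φ _ => hmix φ) (Finset.mem_univ s)
    have hA0 : 0 < ∑ φ, mixVec n m s ε φ := ha.trans_le hA
    have hp : 0 < mixVec n m s ε s / ∑ φ, mixVec n m s ε φ := div_pos ha hA0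
    have hlp := Real.log_nonpos hp.le (div_le_one_of_le₀ hA hA0.le)
    rw [Real.log_div hp.ne' hρs.ne'] at hle
    have hmixρ : ∀ φ, ρ φ = 0 → mixVec n m s ε φ = 0 := fun φ h0 => by
      have hφ : φ ≠ s := fun h => hρs.ne' (h ▸ h0)
      simp [mixVec, hφ, hnρ φ h0]
    have hK' := scaledKL_nonneg hmix hρ hmixρ
    rw [negLog_of_pos hp, ← ENNReal.ofReal_mul hm, ← ENNReal.ofReal_mul hε.1.le,
      ← ENNReal.ofReal_mul hm, ← ENNReal.ofReal_mul hε.1.le, ← ENNReal.ofReal_mul hε1.le,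
      ← ENNReal.ofReal_add hK', ← ENNReal.ofReal_add (by positivity)]
    · refine ENNReal.ofReal_le_ofReal ?_
      nlinarith
    · exact mul_nonneg hε.1.le (mul_nonneg hm (by linarith))
    · exact mul_nonneg hε.1.le (mul_nonneg hm (by linarith))

theorem le_ofReal_scaledKL_mixVec_add {n ρ : Φ → ℝ} {m ε : ℝ} {s : Φ} (hn : ∀ φ, 0 ≤ n φ)
    (hm : 0 ≤ m) (hmn : m ≠ 0 → 0 < ∑ φ, n φ) (hε : ε ∈ Ioo (0 : ℝ) 1)
    (hρ : ρ ∈ stdSimplex ℝ Φ) (hρs : 0 < ρ s) (hnρ : ∀ φ, ρ φ = 0 → n φ = 0) :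
    ENNReal.ofReal (1 - ε) * ENNReal.ofReal (scaledKL n ρ)
        + ENNReal.ofReal ε * (ENNReal.ofReal m * ENNReal.ofReal (-Real.log (ρ s)))
      ≤ ENNReal.ofReal (scaledKL (mixVec n m s ε) ρ)
      + ENNReal.ofReal ε * (ENNReal.ofReal m * negLog (n s / ∑ φ, n φ)) := by
  have hε1 : 0 < 1 - ε := by linarith [hε.2]
  have hK := scaledKL_nonneg hn hρ hnρ
  have hs1 : ρ s ≤ 1 := by
    rw [← hρ.2]; exact Finset.single_le_sum (fun φ _ => hρ.1 φ) (Finset.mem_univ s)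
  have hls := Real.log_nonpos hρs.le hs1
  have hmix := mixVec_nonneg (s := s) hn hm ⟨hε.1.le, hε.2.le⟩
  rcases hm.eq_or_lt with rfl | hm0
  · have hle := le_scaledKL_mixVec (s := s) hn le_rfl (fun h => absurd rfl h) ⟨hε.1.le, hε.2⟩ hnρ
    simp only [zero_mul, mul_zero, add_zero, ENNReal.ofReal_zero] at hle ⊢
    rw [← ENNReal.ofReal_mul hε1.le]
    exact ENNReal.ofReal_le_ofReal hle
  · have hN := hmn hm0.ne'
    rcases (hn s).eq_or_lt with h0 | hns
    -- If the posterior misses s while the model has positive likelihood, the right-hand side is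
    -- infinite.
    · rw [negLog_of_nonpos (by rw [← h0, zero_div]), ENNReal.mul_top (by simpa using hm0),
        ENNReal.mul_top (by simpa using hε.1), add_top]
      exact le_top
    have hle := le_scaledKL_mixVec (s := s) hn hm (fun _ => hns) ⟨hε.1.le, hε.2⟩ hnρ
    have hp : 0 < n s / ∑ φ, n φ := div_pos hns hN
    have hlp := Real.log_nonpos hp.le (div_le_one_of_le₀
      (Finset.single_le_sum (fun φ _ => hn φ) (Finset.mem_univ s)) hN.le)
    rw [Real.log_div hp.ne' hρs.ne'] at hle
    have hmixρ : ∀ φ, ρ φ = 0 → mixVec n m s ε φ = 0 := fun φ h0 => by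
      have hφ : φ ≠ s := fun h => hρs.ne' (h ▸ h0)
      simp [mixVec, hφ, hnρ φ h0]
    have hK' := scaledKL_nonneg hmix hρ hmixρ
    rw [negLog_of_pos hp, ← ENNReal.ofReal_mul hm, ← ENNReal.ofReal_mul hε.1.le,
      ← ENNReal.ofReal_mul hm, ← ENNReal.ofReal_mul hε.1.le, ← ENNReal.ofReal_mul hε1.le,
      ← ENNReal.ofReal_add hK', ← ENNReal.ofReal_add (by positivity)]
    · refine ENNReal.ofReal_le_ofReal ?_
      nlinarith
    · exact mul_nonneg hε.1.le (mul_nonneg hm (by linarith))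
    · exact mul_nonneg hε.1.le (mul_nonneg hm (by linarith))

end Pointwise

end DigDEC

namespace DigDEC

/-! ### The entropy part of the divergence along a segment -/

section Segment

variable {Mod Pol Obs Φ : Type*} [MeasurableSpace Mod] [MeasurableSpace Obs] [Fintype Φ]

/-- The entropy part `E_{M∼ν} E_{o∼M(·|π)} KL(ν(· | π, o), ρ)` of the divergence. -/
noncomputable def klTerm (E : DMSO Mod Pol Obs) (I : InfoSets Mod Pol Φ) (π : Pol)
    (w : Mod × Pol → ℝ≥0∞) (ρ : Φ → ℝ) : ℝ≥0∞ :=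
  ∑' x : Mod × Pol, w x * ∫⁻ o, kl (infoPosterior E I w π o) ρ ∂(E.law x.1 π)

/-- The expected value of `-log ν(φ | π, o)` under `o ∼ M(· | π)`. -/
noncomputable def logLoss (E : DMSO Mod Pol Obs) (I : InfoSets Mod Pol Φ) (π : Pol)
    (w : Mod × Pol → ℝ≥0∞) (M : Mod) (φ : Φ) : ℝ≥0∞ :=
  ∫⁻ o, negLog (infoPosterior E I w π o φ) ∂(E.law M π)

variable {E : DMSO Mod Pol Obs} {I : InfoSets Mod Pol Φ} {w : Mod × Pol → ℝ≥0∞} {π : Pol}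
  {ρ : Φ → ℝ} {M : Mod} {φs : Φ}

theorem klTerm_eq (hw : IsWeight I w) :
    klTerm E I π w ρ = ∫⁻ o, kl (infoPosterior E I w π o) ρ * mixLik E I w π o ∂E.base :=
  tsum_mul_lintegral_law hw π (measurable_kl fun φ => measurable_infoPosterior E hw.countable π φ)

theorem lintegral_law_eq {g : Obs → ℝ≥0∞} (hg : Measurable g) :
    ∫⁻ o, g o ∂(E.law M π) = ∫⁻ o, E.lik M π o * g o ∂E.base := by
  rw [DMSO.law, lintegral_withDensity_eq_lintegral_mul _ (E.measurable_lik _ _) hg]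
  rfl

theorem infoPosterior_eq_div {n : Φ → ℝ} {o : Obs} (hn : ∀ φ, 0 ≤ n φ)
    (h : ∀ φ, infoLik E I w π o φ = ENNReal.ofReal (n φ)) :
    mixLik E I w π o = ENNReal.ofReal (∑ φ, n φ) ∧
      infoPosterior E I w π o = fun φ => n φ / ∑ φ', n φ' := by
  have h1 : mixLik E I w π o = ENNReal.ofReal (∑ φ, n φ) := by
    rw [mixLik, Finset.sum_congr rfl fun φ _ => h φ, ENNReal.ofReal_sum_of_nonneg fun φ _ => hn φ]
  refine ⟨h1, funext fun φ => ?_⟩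
  rw [infoPosterior, h, h1, ENNReal.toReal_div, ENNReal.toReal_ofReal (hn φ),
    ENNReal.toReal_ofReal (Finset.sum_nonneg fun φ _ => hn φ)]

/-- The regular points of the segment from `w` to the Dirac mass at `(M, π_φ)`. -/
structure RegularAt (E : DMSO Mod Pol Obs) (I : InfoSets Mod Pol Φ) (π : Pol)
    (w : Mod × Pol → ℝ≥0∞) (ρ : Φ → ℝ) (M : Mod) (o : Obs) : Prop where
  mix_ne_top : mixLik E I w π o ≠ ⊤
  lik_ne_top : E.lik M π o ≠ ⊤
  mix_ne_zero : E.lik M π o ≠ 0 → mixLik E I w π o ≠ 0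
  info_eq_zero : ∀ φ, ρ φ = 0 → infoLik E I w π o φ = 0

/-- Likelihoods are finite almost everywhere because they integrate to 1, and a finite entropy term
forces the posterior to vanish wherever ρ does. The condition on `mixLik` holds under the law of M,
hence wherever the likelihood of M is nonzero. -/
theorem ae_regularAt (hw : IsWeight I w) (hfin : klTerm E I π w ρ ≠ ⊤)
    (hN : ∀ᵐ o ∂(E.law M π), mixLik E I w π o ≠ 0) :
    ∀ᵐ o ∂E.base, RegularAt E I π w ρ M o := by
  have h1 : ∀ᵐ o ∂E.base, mixLik E I w π o < ⊤ :=
    ae_lt_top (measurable_mixLik E hw.countable π) (by rw [lintegral_mixLik hw]; simp)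
  have h2 : ∀ᵐ o ∂E.base, E.lik M π o < ⊤ :=
    ae_lt_top (E.measurable_lik M π) (by rw [E.lintegral_lik]; simp)
  have h3 := (ae_withDensity_iff (E.measurable_lik M π)).1 hN
  rw [klTerm_eq hw] at hfin
  have h4 := ae_lt_top ((measurable_kl fun φ => measurable_infoPosterior E hw.countable π φ).mul
    (measurable_mixLik E hw.countable π)) hfin
  filter_upwards [h1, h2, h3, h4] with o h1 h2 h3 h4
  refine ⟨h1.ne, h2.ne, h3, fun φ hφ => ?_⟩
  by_cases h0 : mixLik E I w π o = 0
  · exact le_zero_iff.1 ((infoLik_le_mixLik π o φ).trans h0.le)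
  · have h5 : kl (infoPosterior E I w π o) ρ ≠ ⊤ := fun h => by
      simp only [Pi.mul_apply] at h4
      rw [h, ENNReal.top_mul h0] at h4
      exact h4.ne rfl
    have h6 := kl_ne_top_iff.1 h5 φ hφ
    rw [infoPosterior, ENNReal.toReal_eq_zero_iff, ENNReal.div_eq_zero_iff] at h6
    rcases h6 with (h6 | h6) | h6
    · exact h6
    · exact absurd h6 h1.ne
    · exact absurd h6 (ENNReal.div_ne_top ((infoLik_le_mixLik π o φ).trans_lt h1).ne h0)

theorem RegularAt.info_eq {o : Obs} (h : RegularAt E I π w ρ M o) (φ : Φ) :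
    infoLik E I w π o φ = ENNReal.ofReal (infoLik E I w π o φ).toReal :=
  (ENNReal.ofReal_toReal ((infoLik_le_mixLik π o φ).trans_lt h.mix_ne_top.lt_top).ne).symm

theorem RegularAt.info_mix_eq [DecidableEq Φ] {o : Obs} (h : RegularAt E I π w ρ M o)
    (hM : (M, I.policy φs) ∈ I.set φs) {ε : ℝ} (hε : ε ∈ Icc (0 : ℝ) 1) (φ : Φ) :
    infoLik E I (mixSegment (PMF.pure (M, I.policy φs)) w ε) π o φ
      = ENNReal.ofReal (mixVec (fun φ => (infoLik E I w π o φ).toReal) (E.lik M π o).toReal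
          φs ε φ) := by
  rw [infoLik_mixSegment hM, mixVec, ENNReal.ofReal_add, ENNReal.ofReal_mul,
    ENNReal.ofReal_mul hε.1,
    ← h.info_eq]
  · congr 2
    split_ifs
    · rw [ENNReal.ofReal_toReal h.lik_ne_top]
    · simp
  · linarith [hε.2]
  · exact mul_nonneg (by linarith [hε.2]) ENNReal.toReal_nonneg
  · exact mul_nonneg hε.1 (by split_ifs <;> simp)

theorem RegularAt.sum_pos {o : Obs} (h : RegularAt E I π w ρ M o)
    (hm : (E.lik M π o).toReal ≠ 0) : 0 < ∑ φ, (infoLik E I w π o φ).toReal := by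
  have h0 : E.lik M π o ≠ 0 := fun h0 => hm (by rw [h0]; rfl)
  have h1 := (infoPosterior_eq_div (n := fun φ => (infoLik E I w π o φ).toReal)
    (fun φ => ENNReal.toReal_nonneg) h.info_eq).1
  by_contra hcon
  exact h.mix_ne_zero h0 (h1.trans (ENNReal.ofReal_of_nonpos (not_lt.1 hcon)))

theorem mul_klTerm_add (hw : IsWeight I w) (a b : ℝ≥0∞) {g : Obs → ℝ≥0∞} (hg : Measurable g) :
    a * klTerm E I π w ρ + b * ∫⁻ o, g o ∂(E.law M π)
      = ∫⁻ o, (a * (kl (infoPosterior E I w π o) ρ * mixLik E I w π o)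
          + b * (E.lik M π o * g o)) ∂E.base := by
  have h : Measurable fun o => E.lik M π o * g o := (E.measurable_lik M π).mul hg
  have h' : Measurable fun o => kl (infoPosterior E I w π o) ρ * mixLik E I w π o :=
    (measurable_kl fun φ => measurable_infoPosterior E hw.countable π φ).mul
      (measurable_mixLik E hw.countable π)
  rw [lintegral_law_eq hg, klTerm_eq hw, ← lintegral_const_mul _ h, ← lintegral_const_mul _ h',
    ← lintegral_add_right _ (h.const_mul _)]

theorem measurable_negLog_infoPosterior (hw : w.support.Countable) :
    Measurable fun o => negLog (infoPosterior E I w π o φs) :=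
  continuous_negLog.measurable.comp (measurable_infoPosterior E hw π φs)

theorem RegularAt.kl_mul_mixLik {o : Obs} (h : RegularAt E I π w ρ M o) :
    kl (infoPosterior E I w π o) ρ * mixLik E I w π o
      = ENNReal.ofReal (scaledKL (fun φ => (infoLik E I w π o φ).toReal) ρ) := by
  obtain ⟨e1, e2⟩ := infoPosterior_eq_div (fun φ => ENNReal.toReal_nonneg) h.info_eq
  rw [e1, e2, kl_mul_eq (fun φ => ENNReal.toReal_nonneg) fun φ hφ => by
    rw [h.info_eq_zero φ hφ]; rfl]

theorem RegularAt.kl_mul_mixLik_mix [DecidableEq Φ] {o : Obs} (h : RegularAt E I π w ρ M o)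
    (hM : (M, I.policy φs) ∈ I.set φs) (hρs : 0 < ρ φs) {ε : ℝ} (hε : ε ∈ Icc (0 : ℝ) 1) :
    kl (infoPosterior E I (mixSegment (PMF.pure (M, I.policy φs)) w ε) π o) ρ
        * mixLik E I (mixSegment (PMF.pure (M, I.policy φs)) w ε) π o
      = ENNReal.ofReal (scaledKL (mixVec (fun φ => (infoLik E I w π o φ).toReal)
          (E.lik M π o).toReal φs ε) ρ) := by
  have hmix := mixVec_nonneg (n := fun φ => (infoLik E I w π o φ).toReal)
    (m := (E.lik M π o).toReal) (s := φs) (fun φ => ENNReal.toReal_nonneg)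
    ENNReal.toReal_nonneg hε
  obtain ⟨e1, e2⟩ := infoPosterior_eq_div hmix (h.info_mix_eq hM hε)
  rw [e1, e2, kl_mul_eq hmix fun φ h0 => ?_]
  have hφ : φ ≠ φs := fun h => hρs.ne' (h ▸ h0)
  simp [mixVec, hφ, h.info_eq_zero φ h0]

theorem klTerm_mixSegment_add_le (hw : IsWeight I w) (hfin : klTerm E I π w ρ ≠ ⊤)
    (hN : ∀ᵐ o ∂(E.law M π), mixLik E I w π o ≠ 0) (hM : (M, I.policy φs) ∈ I.set φs)
    (hρ : ρ ∈ stdSimplex ℝ Φ) (hρs : 0 < ρ φs) {ε : ℝ} (hε : ε ∈ Ioo (0 : ℝ) 1) :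
    klTerm E I π (mixSegment (PMF.pure (M, I.policy φs)) w ε) ρ
        + ENNReal.ofReal ε * logLoss E I π (mixSegment (PMF.pure (M, I.policy φs)) w ε) M φs
      ≤ ENNReal.ofReal (1 - ε) * klTerm E I π w ρ
        + ENNReal.ofReal ε * ENNReal.ofReal (-Real.log (ρ φs)) := by
  classical
  have hεI : ε ∈ Icc (0 : ℝ) 1 := ⟨hε.1.le, hε.2.le⟩
  have hwε := isWeight_mixSegment hM hw hεI
  have := isProbabilityMeasure_law E M π
  have h1 := mul_klTerm_add (E := E) (M := M) (π := π) (ρ := ρ) hwε 1 (ENNReal.ofReal ε)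
    (measurable_negLog_infoPosterior (E := E) (I := I) (π := π) (φs := φs) hwε.countable)
  have h2 := mul_klTerm_add (E := E) (M := M) (π := π) (ρ := ρ) hw (ENNReal.ofReal (1 - ε))
    (ENNReal.ofReal ε) (measurable_const (a := ENNReal.ofReal (-Real.log (ρ φs))))
  simp only [lintegral_const, measure_univ, mul_one, one_mul] at h1 h2
  rw [logLoss, h1, h2]
  refine lintegral_mono_ae ?_
  filter_upwards [ae_regularAt hw hfin hN] with o ho
  have e := infoPosterior_eq_div (mixVec_nonneg (s := φs) (fun φ => ENNReal.toReal_nonneg)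
    ENNReal.toReal_nonneg hεI) (ho.info_mix_eq hM hεI)
  have := ofReal_scaledKL_mixVec_add_le (n := fun φ => (infoLik E I w π o φ).toReal)
    (fun φ => ENNReal.toReal_nonneg) ENNReal.toReal_nonneg ho.sum_pos hε hρ hρs
    fun φ h => by rw [ho.info_eq_zero φ h]; rfl
  rwa [ho.kl_mul_mixLik, ho.kl_mul_mixLik_mix hM hρs hεI, e.2,
    ← ENNReal.ofReal_toReal ho.lik_ne_top, ENNReal.toReal_ofReal ENNReal.toReal_nonneg]

theorem le_klTerm_mixSegment_add (hw : IsWeight I w) (hfin : klTerm E I π w ρ ≠ ⊤)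
    (hN : ∀ᵐ o ∂(E.law M π), mixLik E I w π o ≠ 0) (hM : (M, I.policy φs) ∈ I.set φs)
    (hρ : ρ ∈ stdSimplex ℝ Φ) (hρs : 0 < ρ φs) {ε : ℝ} (hε : ε ∈ Ioo (0 : ℝ) 1) :
    ENNReal.ofReal (1 - ε) * klTerm E I π w ρ
        + ENNReal.ofReal ε * ENNReal.ofReal (-Real.log (ρ φs))
      ≤ klTerm E I π (mixSegment (PMF.pure (M, I.policy φs)) w ε) ρ
        + ENNReal.ofReal ε * logLoss E I π w M φs := by
  classical
  have hεI : ε ∈ Icc (0 : ℝ) 1 := ⟨hε.1.le, hε.2.le⟩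
  have hwε := isWeight_mixSegment hM hw hεI
  have := isProbabilityMeasure_law E M π
  have h1 := mul_klTerm_add (E := E) (M := M) (π := π) (ρ := ρ) hwε 1 (ENNReal.ofReal ε)
    (measurable_negLog_infoPosterior (E := E) (I := I) (π := π) (φs := φs) hw.countable)
  have h2 := mul_klTerm_add (E := E) (M := M) (π := π) (ρ := ρ) hw (ENNReal.ofReal (1 - ε))
    (ENNReal.ofReal ε) (measurable_const (a := ENNReal.ofReal (-Real.log (ρ φs))))
  simp only [lintegral_const, measure_univ, mul_one, one_mul] at h1 h2
  rw [logLoss, h1, h2]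
  refine lintegral_mono_ae ?_
  filter_upwards [ae_regularAt hw hfin hN] with o ho
  have e := infoPosterior_eq_div (fun φ => ENNReal.toReal_nonneg) ho.info_eq
  have := le_ofReal_scaledKL_mixVec_add (n := fun φ => (infoLik E I w π o φ).toReal)
    (fun φ => ENNReal.toReal_nonneg) ENNReal.toReal_nonneg ho.sum_pos hε hρ hρs
    fun φ h => by rw [ho.info_eq_zero φ h]; rfl
  rwa [ho.kl_mul_mixLik, ho.kl_mul_mixLik_mix hM hρs hεI, e.2,
    ← ENNReal.ofReal_toReal ho.lik_ne_top, ENNReal.toReal_ofReal ENNReal.toReal_nonneg]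

open Filter Topology

/-- Fatou's lemma: for almost every observation under M the mixed posterior of φs converges to that
of w, its denominator staying positive in the limit. -/
theorem logLoss_le_liminf (hw : IsWeight I w) (hfin : klTerm E I π w ρ ≠ ⊤)
    (hN : ∀ᵐ o ∂(E.law M π), mixLik E I w π o ≠ 0) (hM : (M, I.policy φs) ∈ I.set φs) :
    logLoss E I π w M φs ≤ liminf (fun ε : ℝ =>
      logLoss E I π (mixSegment (PMF.pure (M, I.policy φs)) w ε) M φs) (𝓝[>] 0) := by
  classical
  have hIoo : Ioo (0 : ℝ) 1 ∈ 𝓝[>] (0 : ℝ) := Ioo_mem_nhdsGT one_pos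
  have hreg : ∀ᵐ o ∂(E.law M π), RegularAt E I π w ρ M o :=
    (withDensity_absolutelyContinuous _ _).ae_le (ae_regularAt hw hfin hN)
  have hlik : ∀ᵐ o ∂(E.law M π), E.lik M π o ≠ 0 :=
    (ae_withDensity_iff (E.measurable_lik M π)).2 (ae_of_all _ fun _ h => h)
  have hpt : ∀ᵐ o ∂(E.law M π), negLog (infoPosterior E I w π o φs)
      = liminf (fun ε : ℝ => negLog (infoPosterior E I
          (mixSegment (PMF.pure (M, I.policy φs)) w ε) π o φs)) (𝓝[>] 0) := by
    filter_upwards [hreg, hlik] with o ho hlo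
    refine (Tendsto.liminf_eq ?_).symm
    refine (continuous_negLog.tendsto _).comp ?_
    set n : Φ → ℝ := fun φ => (infoLik E I w π o φ).toReal with hn
    set m := (E.lik M π o).toReal with hm
    have hn0 : ∀ φ, 0 ≤ n φ := fun φ => ENNReal.toReal_nonneg
    have hm0 : 0 ≤ m := ENNReal.toReal_nonneg
    have hpos : 0 < ∑ φ, n φ := ho.sum_pos (ENNReal.toReal_ne_zero.2 ⟨hlo, ho.lik_ne_top⟩)
    have hlim : Tendsto (fun ε : ℝ => mixVec n m φs ε φs / ((1 - ε) * ∑ φ, n φ + ε * m)) (𝓝[>] 0)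
        (𝓝 (n φs / ∑ φ, n φ)) := by
      have hc : ContinuousAt (fun ε : ℝ => ((1 - ε) * n φs + ε * m)
          / ((1 - ε) * ∑ φ, n φ + ε * m)) 0 :=
        ContinuousAt.div (by fun_prop) (by fun_prop) (by simpa using hpos.ne')
      have := hc.tendsto.mono_left (nhdsWithin_le_nhds (s := Ioi (0 : ℝ)))
      simpa [mixVec] using this
    rw [(infoPosterior_eq_div hn0 ho.info_eq).2]
    refine hlim.congr' ?_
    filter_upwards [hIoo] with ε hε
    have hεI : ε ∈ Icc (0 : ℝ) 1 := ⟨hε.1.le, hε.2.le⟩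
    rw [(infoPosterior_eq_div (mixVec_nonneg (s := φs) hn0 hm0 hεI) (ho.info_mix_eq hM hεI)).2,
      sum_mixVec]
  rw [logLoss, lintegral_congr_ae hpt]
  refine lintegral_liminf_le fun ε => measurable_negLog_infoPosterior ?_
  exact (hw.countable.insert _).mono (support_mixSegment_subset _ _ _)

end Segment

end DigDEC

namespace DigDEC

open Filter Topology

theorem mean_Dbar_mem {Mod Pol Φ : Type*} [Fintype Φ] {ρ : Φ → ℝ} {π : Pol}
    {Dbar : Pol → Φ → Mod → ℝ} (hD : ∀ π φ M, Dbar π φ M ∈ Icc (0 : ℝ) 1) (hρ : ρ ∈ stdSimplex ℝ Φ)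
    (M : Mod) : ∑ φ, ρ φ * Dbar π φ M ∈ Icc (0 : ℝ) 1 := by
  refine ⟨Finset.sum_nonneg fun φ _ => mul_nonneg (hρ.1 φ) (hD π φ M).1, ?_⟩
  rw [← hρ.2]
  exact Finset.sum_le_sum fun φ _ => mul_le_of_le_one_right (hρ.1 φ) (hD π φ M).2

theorem abs_mean_Dbar_le {Mod Pol Φ : Type*} [Fintype Φ] {ρ : Φ → ℝ} {π : Pol}
    {Dbar : Pol → Φ → Mod → ℝ} (hD : ∀ π φ M, Dbar π φ M ∈ Icc (0 : ℝ) 1) (hρ : ρ ∈ stdSimplex ℝ Φ)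
    (M : Mod) : |∑ φ, ρ φ * Dbar π φ M| ≤ 1 := by
  have h := mean_Dbar_mem (π := π) hD hρ M
  rw [abs_of_nonneg h.1]; exact h.2

/-! ### The derivative of the divergence along the segment -/

section Segment

variable {Mod Pol Obs Φ : Type*} [MeasurableSpace Mod] [MeasurableSpace Obs] [Fintype Φ]
  {E : DMSO Mod Pol Obs} {I : InfoSets Mod Pol Φ} {w : Mod × Pol → ℝ≥0∞} {π : Pol}
  {ρ : Φ → ℝ} {M : Mod} {φs : Φ}

/-- For ε > 0 the log loss of the mixture is automatically finite, since the upper first-order bound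
contains it with the factor ε. Only the endpoint ε = 0 is in doubt. -/
theorem klTerm_mixSegment_ne_top (hw : IsWeight I w) (hfin : klTerm E I π w ρ ≠ ⊤)
    (hN : ∀ᵐ o ∂(E.law M π), mixLik E I w π o ≠ 0) (hM : (M, I.policy φs) ∈ I.set φs)
    (hρ : ρ ∈ stdSimplex ℝ Φ) (hρs : 0 < ρ φs) {ε : ℝ} (hε : ε ∈ Ioo (0 : ℝ) 1) :
    klTerm E I π (mixSegment (PMF.pure (M, I.policy φs)) w ε) ρ ≠ ⊤ ∧
      logLoss E I π (mixSegment (PMF.pure (M, I.policy φs)) w ε) M φs ≠ ⊤ := by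
  have h := klTerm_mixSegment_add_le hw hfin hN hM hρ hρs hε
  have htop : ENNReal.ofReal (1 - ε) * klTerm E I π w ρ
        + ENNReal.ofReal ε * ENNReal.ofReal (-Real.log (ρ φs)) ≠ ⊤ :=
    ENNReal.add_ne_top.2 ⟨ENNReal.mul_ne_top ENNReal.ofReal_ne_top hfin,
      ENNReal.mul_ne_top ENNReal.ofReal_ne_top ENNReal.ofReal_ne_top⟩
  obtain ⟨h1, h2⟩ := ENNReal.add_ne_top.1 (ne_top_of_le_ne_top htop h)
  refine ⟨h1, fun h3 => h2 ?_⟩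
  rw [h3, ENNReal.mul_top]
  simpa using hε.1

theorem neg_log_nonneg (hρ : ρ ∈ stdSimplex ℝ Φ) (hρs : 0 < ρ φs) : 0 ≤ -Real.log (ρ φs) := by
  have : ρ φs ≤ 1 := by
    rw [← hρ.2]; exact Finset.single_le_sum (fun φ _ => hρ.1 φ) (Finset.mem_univ φs)
  linarith [Real.log_nonpos hρs.le this]

theorem toReal_klTerm_mixSegment_le (hw : IsWeight I w) (hfin : klTerm E I π w ρ ≠ ⊤)
    (hN : ∀ᵐ o ∂(E.law M π), mixLik E I w π o ≠ 0) (hM : (M, I.policy φs) ∈ I.set φs)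
    (hρ : ρ ∈ stdSimplex ℝ Φ) (hρs : 0 < ρ φs) {ε : ℝ} (hε : ε ∈ Ioo (0 : ℝ) 1) :
    (klTerm E I π (mixSegment (PMF.pure (M, I.policy φs)) w ε) ρ).toReal
        + ε * (logLoss E I π (mixSegment (PMF.pure (M, I.policy φs)) w ε) M φs).toReal
      ≤ (1 - ε) * (klTerm E I π w ρ).toReal + ε * (-Real.log (ρ φs)) := by
  have h := klTerm_mixSegment_add_le hw hfin hN hM hρ hρs hε
  obtain ⟨h1, h2⟩ := klTerm_mixSegment_ne_top hw hfin hN hM hρ hρs hε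
  have hls := neg_log_nonneg hρ hρs
  have hε1 : 0 ≤ 1 - ε := by linarith [hε.2]
  rw [← ENNReal.ofReal_toReal h1, ← ENNReal.ofReal_toReal h2, ← ENNReal.ofReal_toReal hfin,
    ← ENNReal.ofReal_mul hε.1.le, ← ENNReal.ofReal_mul hε.1.le, ← ENNReal.ofReal_mul hε1,
    ← ENNReal.ofReal_add ENNReal.toReal_nonneg (mul_nonneg hε.1.le ENNReal.toReal_nonneg),
    ← ENNReal.ofReal_add (mul_nonneg hε1 ENNReal.toReal_nonneg) (mul_nonneg hε.1.le hls)] at h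
  exact (ENNReal.ofReal_le_ofReal_iff (add_nonneg (mul_nonneg hε1 ENNReal.toReal_nonneg)
    (mul_nonneg hε.1.le hls))).1 h

theorem le_toReal_klTerm_mixSegment (hw : IsWeight I w) (hfin : klTerm E I π w ρ ≠ ⊤)
    (hN : ∀ᵐ o ∂(E.law M π), mixLik E I w π o ≠ 0) (hM : (M, I.policy φs) ∈ I.set φs)
    (hρ : ρ ∈ stdSimplex ℝ Φ) (hρs : 0 < ρ φs) (hJ : logLoss E I π w M φs ≠ ⊤)
    {ε : ℝ} (hε : ε ∈ Ioo (0 : ℝ) 1) :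
    (1 - ε) * (klTerm E I π w ρ).toReal + ε * (-Real.log (ρ φs))
      ≤ (klTerm E I π (mixSegment (PMF.pure (M, I.policy φs)) w ε) ρ).toReal
        + ε * (logLoss E I π w M φs).toReal := by
  have h := le_klTerm_mixSegment_add hw hfin hN hM hρ hρs hε
  obtain ⟨h1, -⟩ := klTerm_mixSegment_ne_top hw hfin hN hM hρ hρs hε
  have hls := neg_log_nonneg hρ hρs
  have hε1 : 0 ≤ 1 - ε := by linarith [hε.2]
  have hnn := mul_nonneg hε.1.le (ENNReal.toReal_nonneg (a := logLoss E I π w M φs))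
  rw [← ENNReal.ofReal_toReal h1, ← ENNReal.ofReal_toReal hJ, ← ENNReal.ofReal_toReal hfin,
    ← ENNReal.ofReal_mul hε.1.le, ← ENNReal.ofReal_mul hε.1.le, ← ENNReal.ofReal_mul hε1,
    ← ENNReal.ofReal_add ENNReal.toReal_nonneg hnn,
    ← ENNReal.ofReal_add (mul_nonneg hε1 ENNReal.toReal_nonneg) (mul_nonneg hε.1.le hls)] at h
  exact (ENNReal.ofReal_le_ofReal_iff (add_nonneg ENNReal.toReal_nonneg hnn)).1 h

/-- Subtracting the two first-order bounds leaves ε times the difference of the log losses. Together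
with Fatou's lemma this gives convergence, also when the limit is infinite. -/
theorem logLoss_mixSegment_le (hw : IsWeight I w) (hfin : klTerm E I π w ρ ≠ ⊤)
    (hN : ∀ᵐ o ∂(E.law M π), mixLik E I w π o ≠ 0) (hM : (M, I.policy φs) ∈ I.set φs)
    (hρ : ρ ∈ stdSimplex ℝ Φ) (hρs : 0 < ρ φs) {ε : ℝ} (hε : ε ∈ Ioo (0 : ℝ) 1) :
    logLoss E I π (mixSegment (PMF.pure (M, I.policy φs)) w ε) M φs ≤ logLoss E I π w M φs := by
  by_cases hJ : logLoss E I π w M φs = ⊤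
  · rw [hJ]; exact le_top
  · have h1 := toReal_klTerm_mixSegment_le hw hfin hN hM hρ hρs hε
    have h2 := le_toReal_klTerm_mixSegment hw hfin hN hM hρ hρs hJ hε
    rw [← ENNReal.toReal_le_toReal (klTerm_mixSegment_ne_top hw hfin hN hM hρ hρs hε).2 hJ]
    exact le_of_mul_le_mul_left (by linarith) hε.1

theorem tendsto_logLoss_mixSegment (hw : IsWeight I w) (hfin : klTerm E I π w ρ ≠ ⊤)
    (hN : ∀ᵐ o ∂(E.law M π), mixLik E I w π o ≠ 0) (hM : (M, I.policy φs) ∈ I.set φs)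
    (hρ : ρ ∈ stdSimplex ℝ Φ) (hρs : 0 < ρ φs) :
    Tendsto (fun ε : ℝ => logLoss E I π (mixSegment (PMF.pure (M, I.policy φs)) w ε) M φs)
      (𝓝[>] 0) (𝓝 (logLoss E I π w M φs)) := by
  refine tendsto_of_le_liminf_of_limsup_le (logLoss_le_liminf hw hfin hN hM) ?_
  refine limsup_le_of_le (by isBoundedDefault) ?_
  filter_upwards [Ioo_mem_nhdsGT (one_pos (α := ℝ))] with ε hε
  exact logLoss_mixSegment_le hw hfin hN hM hρ hρs hε

/-- The posterior of a point mass sits on φs, so its entropy relative to ρ is at most -log ρ(φs). -/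
theorem klTerm_pure_ne_top (hM : (M, I.policy φs) ∈ I.set φs) (hρ : ρ ∈ stdSimplex ℝ Φ)
    (hρs : 0 < ρ φs) : klTerm E I π (PMF.pure (M, I.policy φs)) ρ ≠ ⊤ := by
  classical
  have hprob := isProbabilityMeasure_law E M π
  have hzero : ∀ o, ∀ φ, φ ≠ φs → infoPosterior E I (PMF.pure (M, I.policy φs)) π o φ = 0 := by
    intro o φ hφ
    have : infoLik E I (PMF.pure (M, I.policy φs)) π o φ = 0 := by
      refine ENNReal.tsum_eq_zero.2 fun y => ?_
      by_cases hy : y = (M, I.policy φs)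
      · subst hy
        exact indicator_of_notMem (fun h => (I.disjoint φ φs hφ).le_bot ⟨h, hM⟩) _
      · simp [indicator, PMF.pure_apply, hy]
    simp [infoPosterior, this]
  have hbound : ∀ o, kl (infoPosterior E I (PMF.pure (M, I.policy φs)) π o) ρ
      ≤ ENNReal.ofReal (-Real.log (ρ φs)) := by
    intro o
    rw [kl_eq_ofReal fun φ hφ => hzero o φ fun h => hρs.ne' (h ▸ hφ)]
    refine ENNReal.ofReal_le_ofReal ?_
    rw [Finset.sum_eq_single φs (fun φ _ hφ => by simp [hzero o φ hφ]) (by simp)]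
    set c := infoPosterior E I (PMF.pure (M, I.policy φs)) π o φs with hc
    have hc0 : 0 ≤ c := ENNReal.toReal_nonneg
    have hc1 : c ≤ 1 := ENNReal.toReal_le_of_le_ofReal zero_le_one
      (by simpa using ENNReal.div_le_of_le_mul (by simpa using infoLik_le_mixLik π o φs))
    have hls := neg_log_nonneg hρ hρs
    -- The coordinate is 0 where the likelihood is 0 or infinite, since the quotient defining the
    -- posterior then degenerates to 0.
    rcases hc0.eq_or_lt with h | h
    · rw [← h]; simpa using hls
    · rw [Real.log_div h.ne' hρs.ne']
      have := Real.log_nonpos h.le hc1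
      nlinarith
  rw [klTerm, tsum_eq_single (M, I.policy φs) fun y hy => by simp [PMF.pure_apply, hy]]
  refine ENNReal.mul_ne_top (by simp) ?_
  refine ne_top_of_le_ne_top ?_ (lintegral_mono hbound)
  simp

/-! ### The linear part -/

theorem summable_weight_mul {X : Type*} {w : X → ℝ≥0∞} (hw : ∑' x, w x = 1) {f : X → ℝ}
    (hf : ∀ x, |f x| ≤ 1) : Summable fun x => (w x).toReal * f x := by
  refine Summable.of_norm_bounded (ENNReal.summable_toReal (by rw [hw]; simp : ∑' x, w x ≠ ⊤))
    fun x => ?_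
  rw [Real.norm_eq_abs, abs_mul, abs_of_nonneg ENNReal.toReal_nonneg]
  exact mul_le_of_le_one_right ENNReal.toReal_nonneg (hf x)

theorem tsum_weight_mul_le_one {X : Type*} {w : X → ℝ≥0∞} (hw : ∑' x, w x = 1) {f : X → ℝ}
    (hf : ∀ x, |f x| ≤ 1) : ∑' x, (w x).toReal * f x ≤ 1 := by
  have hs : Summable fun x => (w x).toReal := ENNReal.summable_toReal (by rw [hw]; simp)
  have h1 : ∑' x, (w x).toReal = 1 := by
    rw [← ENNReal.tsum_toReal_eq fun x h => by
      have := ENNReal.le_tsum (f := w) x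
      rw [h, hw] at this; simp at this, hw]
    rfl
  rw [← h1]
  exact Summable.tsum_le_tsum (fun x => mul_le_of_le_one_right ENNReal.toReal_nonneg
    ((le_abs_self _).trans (hf x))) (summable_weight_mul hw hf) hs

theorem tsum_pure_mul {X : Type*} (x : X) (f : X → ℝ) :
    ∑' y, (PMF.pure x y).toReal * f y = f x := by
  classical
  rw [tsum_eq_single x fun y hy => by simp [PMF.pure_apply, hy]]
  simp

theorem tsum_mixSegment_mul {X : Type*} {w : X → ℝ≥0∞} (hw : ∑' x, w x = 1) (x : X) {f : X → ℝ}
    (hf : ∀ x, |f x| ≤ 1) {ε : ℝ} (hε : ε ∈ Icc (0 : ℝ) 1) :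
    ∑' y, (mixSegment (PMF.pure x) w ε y).toReal * f y
      = (1 - ε) * ∑' y, (w y).toReal * f y + ε * f x := by
  have hwt : ∀ y, w y ≠ ⊤ := fun y h => by
    have := ENNReal.le_tsum (f := w) y
    rw [h, hw] at this; simp at this
  have h : ∀ y, (mixSegment (PMF.pure x) w ε y).toReal * f y
      = (1 - ε) * ((w y).toReal * f y) + ε * ((PMF.pure x y).toReal * f y) := fun y => by
    rw [mixSegment, ENNReal.toReal_add (ENNReal.mul_ne_top ENNReal.ofReal_ne_top (hwt y))
      (ENNReal.mul_ne_top ENNReal.ofReal_ne_top (PMF.apply_ne_top _ _)), ENNReal.toReal_mul,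
      ENNReal.toReal_mul, ENNReal.toReal_ofReal (by linarith [hε.2]), ENNReal.toReal_ofReal hε.1]
    ring
  simp only [h]
  rw [Summable.tsum_add ((summable_weight_mul hw hf).mul_left _)
    ((summable_weight_mul (PMF.tsum_coe _) hf).mul_left _), tsum_mul_left, tsum_mul_left,
    tsum_pure_mul]

/-- The linear part of the divergence. -/
noncomputable def linTerm (Dbar : Pol → Φ → Mod → ℝ) (π : Pol) (w : Mod × Pol → ℝ≥0∞)
    (ρ : Φ → ℝ) : ℝ :=
  ∑' x : Mod × Pol, (w x).toReal * ∑ φ, ρ φ * Dbar π φ x.1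

variable {Dbar : Pol → Φ → Mod → ℝ}

theorem linTerm_nonneg {Mod Pol Φ : Type*} [Fintype Φ] {ρ : Φ → ℝ} {π : Pol}
    {Dbar : Pol → Φ → Mod → ℝ} (hD : ∀ π φ M, Dbar π φ M ∈ Icc (0 : ℝ) 1) (hρ : ρ ∈ stdSimplex ℝ Φ)
    (w : Mod × Pol → ℝ≥0∞) : 0 ≤ linTerm Dbar π w ρ :=
  tsum_nonneg fun x => mul_nonneg ENNReal.toReal_nonneg (mean_Dbar_mem hD hρ x.1).1

theorem divergence_eq (w : Mod × Pol → ℝ≥0∞) :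
    divergence E I Dbar π w ρ
      = ((klTerm E I π w ρ : ℝ≥0∞) : EReal) + ((linTerm Dbar π w ρ : ℝ) : EReal) := rfl

theorem divergence_eq_coe (h : klTerm E I π w ρ ≠ ⊤) :
    divergence E I Dbar π w ρ
      = (((klTerm E I π w ρ).toReal + linTerm Dbar π w ρ : ℝ) : EReal) := by
  rw [divergence_eq, EReal.coe_add, EReal.coe_ennreal_toReal h]

theorem toReal_divergence (h : klTerm E I π w ρ ≠ ⊤) :
    (divergence E I Dbar π w ρ).toReal = (klTerm E I π w ρ).toReal + linTerm Dbar π w ρ := by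
  rw [divergence_eq_coe h, EReal.toReal_coe]

theorem divergence_eq_top (h : klTerm E I π w ρ = ⊤) : divergence E I Dbar π w ρ = ⊤ := by
  rw [divergence_eq, h, EReal.coe_ennreal_top, EReal.top_add_coe]

theorem divergence_nonneg (hD : ∀ π φ M, Dbar π φ M ∈ Icc (0 : ℝ) 1) (hρ : ρ ∈ stdSimplex ℝ Φ) :
    0 ≤ divergence E I Dbar π w ρ :=
  add_nonneg (EReal.coe_ennreal_nonneg _) (EReal.coe_nonneg.2 (linTerm_nonneg hD hρ w))

theorem mixSegment_zero {X : Type*} (x y : X → ℝ≥0∞) : mixSegment x y 0 = y := by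
  funext z; simp [mixSegment]

/-- The derivative of the divergence at `w` in the direction of `(M, π_φ)`. -/
theorem hasDerivWithinAt_divergence (hD : ∀ π φ M, Dbar π φ M ∈ Icc (0 : ℝ) 1)
    (hw : IsWeight I w) (hfin : klTerm E I π w ρ ≠ ⊤)
    (hN : ∀ᵐ o ∂(E.law M π), mixLik E I w π o ≠ 0) (hM : (M, I.policy φs) ∈ I.set φs)
    (hρ : ρ ∈ stdSimplex ℝ Φ) (hρs : 0 < ρ φs) (hJ : logLoss E I π w M φs ≠ ⊤) :
    HasDerivWithinAt (fun ε => (divergence E I Dbar π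
        (mixSegment (PMF.pure (M, I.policy φs)) w ε) ρ).toReal)
      (-(klTerm E I π w ρ).toReal - Real.log (ρ φs) - (logLoss E I π w M φs).toReal
        + (∑ φ, ρ φ * Dbar π φ M - linTerm Dbar π w ρ)) (Icc 0 1) 0 := by
  rw [hasDerivWithinAt_iff_tendsto_slope]
  have hset : Icc (0 : ℝ) 1 \ {0} = Ioc 0 1 := Icc_sdiff_left
  rw [hset, nhdsWithin_Ioc_eq_nhdsGT one_pos]
  have hlin : ∀ ε ∈ Ioo (0 : ℝ) 1, linTerm Dbar π (mixSegment (PMF.pure (M, I.policy φs)) w ε) ρ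
      = (1 - ε) * linTerm Dbar π w ρ + ε * ∑ φ, ρ φ * Dbar π φ M := fun ε hε =>
    tsum_mixSegment_mul hw.tsum_eq _ (fun x => abs_mean_Dbar_le hD hρ x.1) ⟨hε.1.le, hε.2.le⟩
  have hslope : ∀ ε ∈ Ioo (0 : ℝ) 1, slope (fun ε => (divergence E I Dbar π
        (mixSegment (PMF.pure (M, I.policy φs)) w ε) ρ).toReal) 0 ε
      = ((klTerm E I π (mixSegment (PMF.pure (M, I.policy φs)) w ε) ρ).toReal
          - (klTerm E I π w ρ).toReal) / ε
        + (∑ φ, ρ φ * Dbar π φ M - linTerm Dbar π w ρ) := fun ε hε => by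
    rw [slope_def_field, mixSegment_zero, toReal_divergence hfin,
      toReal_divergence (klTerm_mixSegment_ne_top hw hfin hN hM hρ hρs hε).1, hlin ε hε]
    have := hε.1.ne'
    field_simp
    ring
  have hJlim := (ENNReal.tendsto_toReal hJ).comp
    (tendsto_logLoss_mixSegment hw hfin hN hM hρ hρs)
  have hIoo := Ioo_mem_nhdsGT (one_pos (α := ℝ))
  -- The difference quotient is squeezed between the tangent at w, where the log loss is that of w,
  -- and the bound with the log loss of the mixture, which converges to it.
  refine tendsto_of_tendsto_of_tendsto_of_le_of_le' tendsto_const_nhds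
    (((tendsto_const_nhds (x := -(klTerm E I π w ρ).toReal - Real.log (ρ φs))).sub hJlim).add_const
      (∑ φ, ρ φ * Dbar π φ M - linTerm Dbar π w ρ)) ?_ ?_
  · filter_upwards [hIoo] with ε hε
    rw [hslope ε hε]
    gcongr
    rw [le_div_iff₀ hε.1]
    have := le_toReal_klTerm_mixSegment hw hfin hN hM hρ hρs hJ hε
    linarith
  · filter_upwards [hIoo] with ε hε
    rw [hslope ε hε]
    gcongr
    rw [div_le_iff₀ hε.1]
    have := toReal_klTerm_mixSegment_le hw hfin hN hM hρ hρs hε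
    simp only [Function.comp_apply]
    linarith

/-- By definition F(x) - Breg_F(x, y) is F(y) plus the derivative at y towards x. The derivative
contains -F(y), so only the log-likelihood ratio of φs and the mean of Dbar at M remain. -/
theorem bregFinite_and_eq {ν : PMF (Mod × Pol)} (hD : ∀ π φ M, Dbar π φ M ∈ Icc (0 : ℝ) 1)
    (hν : ν.support ⊆ I.union) (hfin : klTerm E I π ν ρ ≠ ⊤)
    (hN : ∀ᵐ o ∂(E.law M π), mixLik E I ν π o ≠ 0) (hM : (M, I.policy φs) ∈ I.set φs)
    (hρ : ρ ∈ stdSimplex ℝ Φ) (hρs : 0 < ρ φs) (hJ : logLoss E I π ν M φs ≠ ⊤) :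
    BregFinite E I Dbar π ρ (M, I.policy φs) ν ∧
      (divergence E I Dbar π (PMF.pure (M, I.policy φs)) ρ).toReal
        - breg (fun w => (divergence E I Dbar π w ρ).toReal) (PMF.pure (M, I.policy φs)) ν
      = -Real.log (ρ φs) - (logLoss E I π ν M φs).toReal + ∑ φ, ρ φ * Dbar π φ M := by
  have hderiv := hasDerivWithinAt_divergence hD (IsWeight.of_pmf hν) hfin hN hM hρ hρs hJ
  refine ⟨⟨?_, ?_, hderiv.differentiableWithinAt⟩, ?_⟩
  · rw [divergence_eq_coe (klTerm_pure_ne_top hM hρ hρs)]; exact EReal.coe_ne_top _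
  · rw [divergence_eq_coe hfin]; exact EReal.coe_ne_top _
  · rw [breg, hderiv.derivWithin ((uniqueDiffOn_Icc one_pos) 0 (by simp)), toReal_divergence hfin]
    ring

end Segment

end DigDEC

namespace DigDEC

open Filter Topology

/-! ### The minimax solution -/

theorem abs_gap_le {Mod Pol Obs : Type*} [MeasurableSpace Mod] [MeasurableSpace Obs]
    (E : DMSO Mod Pol Obs) (M : Mod) (π π' : Pol) :
    |E.value M π - E.value M π'| ≤ 1 := by
  have h1 := E.value_mem M π
  have h2 := E.value_mem M π'
  rw [abs_le]
  constructor <;> linarith [h1.1, h1.2, h2.1, h2.2]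

/-- The mixture `(1 - ε) ν + ε δ_x`. -/
noncomputable def mixPMF {X : Type*} (x : X) (ν : PMF X) (ε : Icc (0 : ℝ) 1) :
    PMF X :=
  ⟨mixSegment (PMF.pure x) ν ε, by
    refine ENNReal.summable.hasSum_iff.2 ?_
    simp only [mixSegment]
    rw [ENNReal.tsum_add, ENNReal.tsum_mul_left, ENNReal.tsum_mul_left, PMF.tsum_coe, PMF.tsum_coe,
      mul_one, mul_one, ← ENNReal.ofReal_add (by linarith [ε.2.2]) ε.2.1]
    simp⟩

theorem coe_mixPMF {X : Type*} (x : X) (ν : PMF X) (ε : Icc (0 : ℝ) 1) :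
    (mixPMF x ν ε : X → ℝ≥0∞) = mixSegment (PMF.pure x) ν ε := rfl

section Minimax

variable {Mod Pol Obs Φ : Type*} [MeasurableSpace Mod] [MeasurableSpace Obs] [Fintype Pol]
  [Fintype Φ] {E : DMSO Mod Pol Obs} {I : InfoSets Mod Pol Φ} {Dbar : Pol → Φ → Mod → ℝ}
  {η : ℝ} {p : Pol → ℝ} {ν : PMF (Mod × Pol)} {ρ : Φ → ℝ} {M : Mod} {φs : Φ}

/-- `E_{π∼p} E_{(M,π⋆)∼w} [V_M(π⋆) - V_M(π)]`. -/
noncomputable def gapTerm (E : DMSO Mod Pol Obs) (p : Pol → ℝ) (w : Mod × Pol → ℝ≥0∞) : ℝ :=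
  ∑ π, p π * ∑' x : Mod × Pol, (w x).toReal * (E.value x.1 x.2 - E.value x.1 π)

theorem gapTerm_le_one (hp : p ∈ stdSimplex ℝ Pol) (ν : PMF (Mod × Pol)) :
    gapTerm E p ν ≤ 1 := by
  rw [← hp.2]
  refine Finset.sum_le_sum fun π _ => mul_le_of_le_one_right (hp.1 π) ?_
  exact tsum_weight_mul_le_one ν.tsum_coe fun x => abs_gap_le E x.1 x.2 π

theorem gapTerm_pure (x : Mod × Pol) :
    gapTerm E p (PMF.pure x) = ∑ π, p π * (E.value x.1 x.2 - E.value x.1 π) :=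
  Finset.sum_congr rfl fun _ _ => by rw [tsum_pure_mul]

theorem gapTerm_mixSegment (ν : PMF (Mod × Pol)) (x : Mod × Pol) {ε : ℝ}
    (hε : ε ∈ Icc (0 : ℝ) 1) : gapTerm E p (mixSegment (PMF.pure x) ν ε)
      = (1 - ε) * gapTerm E p ν + ε * gapTerm E p (PMF.pure x) := by
  simp only [gapTerm]
  rw [Finset.mul_sum, Finset.mul_sum, ← Finset.sum_add_distrib]
  refine Finset.sum_congr rfl fun π _ => ?_
  rw [tsum_mixSegment_mul ν.tsum_coe x (fun y => abs_gap_le E y.1 y.2 π) hε, tsum_pure_mul]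
  ring

/-- Policies of probability zero may have infinite divergence, since 0 · ⊤ = 0 in the extended
reals. Finiteness is thus required only on the support of p, here and in all later statements. -/
theorem air_eq_coe (hp : p ∈ stdSimplex ℝ Pol)
    (hfin : ∀ π, 0 < p π → klTerm E I π ν ρ ≠ ⊤) :
    air E I Dbar η p ν ρ = ((gapTerm E p ν
      - 1 / η * ∑ π, p π * ((klTerm E I π ν ρ).toReal + linTerm Dbar π ν ρ) : ℝ) : EReal) := by
  have h : ∀ π, (p π : EReal) * divergence E I Dbar π ν ρ
      = ((p π * ((klTerm E I π ν ρ).toReal + linTerm Dbar π ν ρ) : ℝ) : EReal) := fun π => by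
    rcases (hp.1 π).eq_or_lt with h0 | h0
    · rw [← h0]; simp
    · rw [divergence_eq_coe (hfin π h0), ← EReal.coe_mul]
  have hs : ∑ π, (p π : EReal) * divergence E I Dbar π ν ρ
      = ((∑ π, p π * ((klTerm E I π ν ρ).toReal + linTerm Dbar π ν ρ) : ℝ) : EReal) := by
    rw [Finset.sum_congr rfl fun π _ => h π]
    exact (map_sum (⟨⟨fun x : ℝ => (x : EReal), EReal.coe_zero⟩, EReal.coe_add⟩ : ℝ →+ EReal)
      _ _).symm
  rw [air, hs, ← EReal.coe_mul, ← EReal.coe_sub]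
  rfl

theorem air_eq_bot (hD : ∀ π φ M, Dbar π φ M ∈ Icc (0 : ℝ) 1) (hη : 0 < η)
    (hρ : ρ ∈ stdSimplex ℝ Φ) (hp : p ∈ stdSimplex ℝ Pol) {π : Pol} (hπ : 0 < p π)
    (h : klTerm E I π ν ρ = ⊤) : air E I Dbar η p ν ρ = ⊥ := by
  classical
  have hnn : ∀ π', 0 ≤ (p π' : EReal) * divergence E I Dbar π' ν ρ := fun π' =>
    mul_nonneg (EReal.coe_nonneg.2 (hp.1 π')) (divergence_nonneg hD hρ)
  have hs : ∑ π, (p π : EReal) * divergence E I Dbar π ν ρ = ⊤ := by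
    rw [eq_top_iff]
    refine le_trans ?_ (Finset.single_le_sum (fun π' _ => hnn π') (Finset.mem_univ π))
    rw [divergence_eq_top h, EReal.mul_top_of_pos (EReal.coe_pos.2 hπ)]
  rw [air, hs, EReal.mul_top_of_pos (EReal.coe_pos.2 (one_div_pos.2 hη)), EReal.sub_top]

/-- An infinite entropy would make the value ⊥, while the point mass at (M, π_φs) is a competitor
with a finite value. -/
theorem IsMinimax.klTerm_ne_top (h : IsMinimax E I Dbar η p ν ρ)
    (hD : ∀ π φ M, Dbar π φ M ∈ Icc (0 : ℝ) 1) (hη : 0 < η) (hρ : ρ ∈ stdSimplex ℝ Φ)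
    (hρs : 0 < ρ φs) (hM : (M, I.policy φs) ∈ I.set φs) {π : Pol} (hπ : 0 < p π) :
    klTerm E I π ν ρ ≠ ⊤ := by
  intro htop
  have h1 := h.ν_max (PMF.pure (M, I.policy φs)) (by
    rw [PMF.support_pure, singleton_subset_iff]; exact mem_iUnion.2 ⟨φs, hM⟩)
  rw [air_eq_bot hD hη hρ h.p_mem hπ htop,
    air_eq_coe h.p_mem fun π _ => klTerm_pure_ne_top hM hρ hρs] at h1
  exact EReal.coe_ne_bot _ (le_bot_iff.1 h1)

/-- Optimality of ν against the mixture with the point mass, divided by ε. The upper first-order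
bound is used because it involves the log loss of the mixture, which is already known to be finite.
-/
theorem IsMinimax.gap_segment_le (h : IsMinimax E I Dbar η p ν ρ)
    (hD : ∀ π φ M, Dbar π φ M ∈ Icc (0 : ℝ) 1) (hη : 0 < η) (hρ : ρ ∈ stdSimplex ℝ Φ)
    (hρs : 0 < ρ φs) (hM : (M, I.policy φs) ∈ I.set φs)
    (hN : ∀ π, 0 < p π → ∀ᵐ o ∂(E.law M π), mixLik E I ν π o ≠ 0) {ε : ℝ}
    (hε : ε ∈ Ioo (0 : ℝ) 1) :
    gapTerm E p (PMF.pure (M, I.policy φs)) - gapTerm E p ν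
      ≤ 1 / η * ∑ π, p π * (-(klTerm E I π ν ρ).toReal - Real.log (ρ φs)
        - (logLoss E I π (mixSegment (PMF.pure (M, I.policy φs)) ν ε) M φs).toReal
        + (∑ φ, ρ φ * Dbar π φ M - linTerm Dbar π ν ρ)) := by
  have hw := IsWeight.of_pmf h.ν_mem
  have hεI : ε ∈ Icc (0 : ℝ) 1 := ⟨hε.1.le, hε.2.le⟩
  have hfin := fun π hπ => h.klTerm_ne_top (π := π) hD hη hρ hρs hM hπ
  have h1 := h.ν_max (mixPMF (M, I.policy φs) ν ⟨ε, hεI⟩) (isWeight_mixSegment hM hw hεI).subset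
  rw [air_eq_coe h.p_mem hfin, air_eq_coe h.p_mem fun π hπ =>
    (klTerm_mixSegment_ne_top hw (hfin π hπ) (hN π hπ) hM hρ hρs hε).1, EReal.coe_le_coe_iff,
    coe_mixPMF, gapTerm_mixSegment _ _ hεI] at h1
  have h2 : ∑ π, p π * ((klTerm E I π (mixSegment (PMF.pure (M, I.policy φs)) ν ε) ρ).toReal
        + linTerm Dbar π (mixSegment (PMF.pure (M, I.policy φs)) ν ε) ρ)
      - ∑ π, p π * ((klTerm E I π ν ρ).toReal + linTerm Dbar π ν ρ)
      ≤ ε * ∑ π, p π * (-(klTerm E I π ν ρ).toReal - Real.log (ρ φs)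
        - (logLoss E I π (mixSegment (PMF.pure (M, I.policy φs)) ν ε) M φs).toReal
        + (∑ φ, ρ φ * Dbar π φ M - linTerm Dbar π ν ρ)) := by
    rw [← Finset.sum_sub_distrib, Finset.mul_sum]
    refine Finset.sum_le_sum fun π _ => ?_
    rcases (h.p_mem.1 π).eq_or_lt with h0 | h0
    · rw [← h0]; simp
    · have h3 := toReal_klTerm_mixSegment_le hw (hfin π h0) (hN π h0) hM hρ hρs hε
      have h4 : linTerm Dbar π (mixSegment (PMF.pure (M, I.policy φs)) ν ε) ρ
          = (1 - ε) * linTerm Dbar π ν ρ + ε * ∑ φ, ρ φ * Dbar π φ M :=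
        tsum_mixSegment_mul hw.tsum_eq _ (fun x => abs_mean_Dbar_le hD hρ x.1) hεI
      rw [h4, ← mul_sub, mul_left_comm]
      refine mul_le_mul_of_nonneg_left ?_ h0.le
      linarith
  have h5 := mul_le_mul_of_nonneg_left h2 (one_div_pos.2 hη).le
  refine le_of_mul_le_mul_left ?_ hε.1
  rw [mul_left_comm]
  refine le_trans ?_ h5
  rw [mul_sub (1 / η)]
  linarith

/-- `gap_segment_le` bounds the p-average of the log losses of the mixtures by a constant K
independent of ε. Each term is nonnegative, so each log loss is at most K / p(π), and the bound
passes to the limit ε → 0. -/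
theorem IsMinimax.logLoss_ne_top (h : IsMinimax E I Dbar η p ν ρ)
    (hD : ∀ π φ M, Dbar π φ M ∈ Icc (0 : ℝ) 1) (hη : 0 < η) (hρ : ρ ∈ stdSimplex ℝ Φ)
    (hρs : 0 < ρ φs) (hM : (M, I.policy φs) ∈ I.set φs)
    (hN : ∀ π, 0 < p π → ∀ᵐ o ∂(E.law M π), mixLik E I ν π o ≠ 0) {π : Pol} (hπ : 0 < p π) :
    logLoss E I π ν M φs ≠ ⊤ := by
  have hw := IsWeight.of_pmf h.ν_mem
  set K := ∑ π, p π * (-(klTerm E I π ν ρ).toReal - Real.log (ρ φs)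
        + (∑ φ, ρ φ * Dbar π φ M - linTerm Dbar π ν ρ))
      - η * (gapTerm E p (PMF.pure (M, I.policy φs)) - gapTerm E p ν) with hK
  have hbound : ∀ ε ∈ Ioo (0 : ℝ) 1,
      logLoss E I π (mixSegment (PMF.pure (M, I.policy φs)) ν ε) M φs
        ≤ ENNReal.ofReal (K / p π) := by
    intro ε hε
    have h1 := h.gap_segment_le hD hη hρ hρs hM hN hε
    have h2 : ∑ π, p π * (logLoss E I π (mixSegment (PMF.pure (M, I.policy φs)) ν ε) M φs).toReal
        ≤ K := by
      have h3 := mul_le_mul_of_nonneg_left h1 hη.le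
      rw [← mul_assoc, mul_one_div_cancel hη.ne', one_mul] at h3
      have h4 : ∑ π, p π * (-(klTerm E I π ν ρ).toReal - Real.log (ρ φs)
          - (logLoss E I π (mixSegment (PMF.pure (M, I.policy φs)) ν ε) M φs).toReal
          + (∑ φ, ρ φ * Dbar π φ M - linTerm Dbar π ν ρ))
          = ∑ π, p π * (-(klTerm E I π ν ρ).toReal - Real.log (ρ φs)
            + (∑ φ, ρ φ * Dbar π φ M - linTerm Dbar π ν ρ))
            - ∑ π, p π
              * (logLoss E I π (mixSegment (PMF.pure (M, I.policy φs)) ν ε) M φs).toReal := by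
        rw [← Finset.sum_sub_distrib]
        exact Finset.sum_congr rfl fun π _ => by ring
      rw [h4] at h3
      linarith
    have h5 := (Finset.single_le_sum (f := fun π => p π
      * (logLoss E I π (mixSegment (PMF.pure (M, I.policy φs)) ν ε) M φs).toReal)
      (fun π _ => mul_nonneg (h.p_mem.1 π) ENNReal.toReal_nonneg) (Finset.mem_univ π)).trans h2
    refine ENNReal.le_ofReal_iff_toReal_le ?_ ?_ |>.2 ?_
    · exact (klTerm_mixSegment_ne_top hw (h.klTerm_ne_top hD hη hρ hρs hM hπ) (hN π hπ) hM hρ hρs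
        hε).2
    · exact div_nonneg ((mul_nonneg hπ.le ENNReal.toReal_nonneg).trans h5) hπ.le
    · rw [le_div_iff₀ hπ, mul_comm]; exact h5
  refine ne_top_of_le_ne_top (ENNReal.ofReal_ne_top (r := K / p π)) ?_
  refine le_of_tendsto (tendsto_logLoss_mixSegment hw (h.klTerm_ne_top hD hη hρ hρs hM hπ)
    (hN π hπ) hM hρ hρs) ?_
  filter_upwards [Ioo_mem_nhdsGT (one_pos (α := ℝ))] with ε hε using hbound ε hε

/-- The first-order condition for `ν`: the gap of `(M, π_φ)` is at most the value of the game plus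
`1/η` times the expected estimation error. -/
theorem IsMinimax.gap_le (h : IsMinimax E I Dbar η p ν ρ)
    (hD : ∀ π φ M, Dbar π φ M ∈ Icc (0 : ℝ) 1) (hη : 0 < η) (hρ : ρ ∈ stdSimplex ℝ Φ)
    (hρs : 0 < ρ φs) (hM : (M, I.policy φs) ∈ I.set φs)
    (hN : ∀ π, 0 < p π → ∀ᵐ o ∂(E.law M π), mixLik E I ν π o ≠ 0) :
    ∃ a : ℝ, air E I Dbar η p ν ρ = (a : EReal) ∧ a ≤ 1 ∧
      ∑ π, p π * (E.value M (I.policy φs) - E.value M π)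
        ≤ a + 1 / η * ∑ π, p π * (-Real.log (ρ φs) - (logLoss E I π ν M φs).toReal
          + ∑ φ, ρ φ * Dbar π φ M) := by
  have hw := IsWeight.of_pmf h.ν_mem
  have hfin := fun π hπ => h.klTerm_ne_top (π := π) hD hη hρ hρs hM hπ
  refine ⟨_, air_eq_coe h.p_mem hfin, ?_, ?_⟩
  · have h1 := gapTerm_le_one (E := E) h.p_mem ν
    have h2 : 0 ≤ 1 / η * ∑ π, p π * ((klTerm E I π ν ρ).toReal + linTerm Dbar π ν ρ) :=
      mul_nonneg (one_div_pos.2 hη).le (Finset.sum_nonneg fun π _ => mul_nonneg (h.p_mem.1 π)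
        (add_nonneg ENNReal.toReal_nonneg (linTerm_nonneg hD hρ _)))
    linarith
  · have hlim : gapTerm E p (PMF.pure (M, I.policy φs)) - gapTerm E p ν
        ≤ 1 / η * ∑ π, p π * (-(klTerm E I π ν ρ).toReal - Real.log (ρ φs)
          - (logLoss E I π ν M φs).toReal + (∑ φ, ρ φ * Dbar π φ M - linTerm Dbar π ν ρ)) := by
      have hev : ∀ᶠ ε in 𝓝[>] (0 : ℝ), gapTerm E p (PMF.pure (M, I.policy φs)) - gapTerm E p ν
          ≤ 1 / η * ∑ π, p π * (-(klTerm E I π ν ρ).toReal - Real.log (ρ φs)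
            - (logLoss E I π (mixSegment (PMF.pure (M, I.policy φs)) ν ε) M φs).toReal
            + (∑ φ, ρ φ * Dbar π φ M - linTerm Dbar π ν ρ)) := by
        filter_upwards [Ioo_mem_nhdsGT (one_pos (α := ℝ))] with ε hε
        exact h.gap_segment_le hD hη hρ hρs hM hN hε
      refine ge_of_tendsto ?_ hev
      refine (tendsto_finsetSum _ fun π _ => ?_).const_mul _
      rcases (h.p_mem.1 π).eq_or_lt with h0 | h0
      · rw [← h0]; simp
      · exact ((tendsto_const_nhds.sub ((ENNReal.tendsto_toReal
            (h.logLoss_ne_top hD hη hρ hρs hM hN h0)).comp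
            (tendsto_logLoss_mixSegment hw (hfin π h0) (hN π h0) hM hρ hρs))).add_const _).const_mul _
    rw [gapTerm_pure] at hlim
    have h4 : ∑ π, p π * (-(klTerm E I π ν ρ).toReal - Real.log (ρ φs)
          - (logLoss E I π ν M φs).toReal + (∑ φ, ρ φ * Dbar π φ M - linTerm Dbar π ν ρ))
        = ∑ π, p π * (-Real.log (ρ φs) - (logLoss E I π ν M φs).toReal + ∑ φ, ρ φ * Dbar π φ M)
          - ∑ π, p π * ((klTerm E I π ν ρ).toReal + linTerm Dbar π ν ρ) := by
      rw [← Finset.sum_sub_distrib]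
      exact Finset.sum_congr rfl fun π _ => by ring
    rw [h4, mul_sub] at hlim
    linarith

/-- Minimality of p makes its worst-case value the infimum for this ρ, and the coefficient is the
supremum over ρ. -/
theorem IsMinimax.air_le_digDEC (h : IsMinimax E I Dbar η p ν ρ) (hρ : ρ ∈ stdSimplex ℝ Φ) :
    air E I Dbar η p ν ρ ≤ digDEC E I Dbar η := by
  have h1 : air E I Dbar η p ν ρ ≤ airMax E I Dbar η p ρ := le_iSup₂_of_le ν h.ν_mem le_rfl
  have h2 : airMax E I Dbar η p ρ ≤ ⨅ p ∈ stdSimplex ℝ Pol, airMax E I Dbar η p ρ :=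
    le_iInf₂ h.p_min
  exact h1.trans (h2.trans (le_iSup₂_of_le ρ hρ le_rfl))

end Minimax

end DigDEC

namespace DigDEC

open ProbabilityTheory

/-! ### Conditional expectations given the history -/

section Tower

variable {Mod Pol Obs Ω Ω' : Type*} [MeasurableSpace Mod] [MeasurableSpace Obs]
  {mΩ : MeasurableSpace Ω} {mΩ' : MeasurableSpace Ω'}

/-- The kernel `x ↦ c(x) M_x(· | π)`. -/
noncomputable def obsKernel (E : DMSO Mod Pol Obs) (π : Pol) {c : Ω' → ℝ≥0∞} (hc : Measurable c)
    {Mo : Ω' → Mod} (hMo : Measurable Mo) : Kernel Ω' Obs where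
  toFun x := c x • E.law (Mo x) π
  measurable' := by
    refine Measure.measurable_of_measurable_coe _ fun s hs => ?_
    simp only [Measure.smul_apply, smul_eq_mul]
    exact hc.mul ((Measure.measurable_coe hs).comp ((E.measurable_law π).comp hMo))

variable {E : DMSO Mod Pol Obs} {π : Pol} {c : Ω' → ℝ≥0∞} {Mo : Ω' → Mod}

theorem obsKernel_apply (hc : Measurable c) (hMo : Measurable Mo) (x : Ω') :
    obsKernel E π hc hMo x = c x • E.law (Mo x) π := rfl

theorem isFiniteKernel_obsKernel (hc : Measurable c) (hMo : Measurable Mo) (hc1 : ∀ x, c x ≤ 1) :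
    IsFiniteKernel (obsKernel E π hc hMo) :=
  ⟨⟨1, ENNReal.one_lt_top, fun x => by
    have := isProbabilityMeasure_law E (Mo x) π
    rw [obsKernel_apply, Measure.smul_apply, measure_univ, smul_eq_mul, mul_one]
    exact hc1 x⟩⟩

theorem measurable_lintegral_law (hMo : Measurable Mo) {f : Ω' × Obs → ℝ≥0∞}
    (hf : Measurable f) : Measurable fun x => ∫⁻ o, f (x, o) ∂(E.law (Mo x) π) := by
  have h := isFiniteKernel_obsKernel (E := E) (π := π) (measurable_const (a := (1 : ℝ≥0∞))) hMo
    fun _ => le_rfl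
  have := Measurable.lintegral_kernel_prod_right'
    (κ := obsKernel E π (measurable_const (a := (1 : ℝ≥0∞))) hMo) hf
  simpa only [obsKernel_apply, one_smul] using this

variable {P : Measure Ω} [IsFiniteMeasure P] {X : Ω → Ω'} {Y : Ω → Obs} {ev : Set Ω}

/-- Hypothesis `h` is the equality of the two finite measures on rectangles, which determine them.
-/
theorem map_restrict_eq_compProd (hX : Measurable X) (hY : Measurable Y) (hc : Measurable c)
    (hMo : Measurable Mo) (hc1 : ∀ x, c x ≤ 1)
    (h : ∀ A, MeasurableSet A → ∀ S, MeasurableSet S →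
      P (X ⁻¹' A ∩ (ev ∩ Y ⁻¹' S)) = ∫⁻ ω in X ⁻¹' A, c (X ω) * E.law (Mo (X ω)) π S ∂P) :
    (P.restrict ev).map (fun ω => (X ω, Y ω)) = (P.map X) ⊗ₘ (obsKernel E π hc hMo) := by
  have := isFiniteKernel_obsKernel (E := E) (π := π) hc hMo hc1
  refine Measure.ext_prod fun {s t} hs ht => ?_
  rw [Measure.map_apply (hX.prodMk hY) (hs.prod ht), Measure.restrict_apply
    ((hX.prodMk hY) (hs.prod ht)), Measure.compProd_apply_prod hs ht,
    setLIntegral_map hs (Kernel.measurable_coe _ ht) hX]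
  have e : (fun ω => (X ω, Y ω)) ⁻¹' s ×ˢ t ∩ ev = X ⁻¹' s ∩ (ev ∩ Y ⁻¹' t) := by
    ext ω; simp only [mem_inter_iff, mem_preimage, mem_prod]; tauto
  rw [e, h s hs t ht]
  rfl

theorem setLIntegral_tower (hX : Measurable X) (hY : Measurable Y) (hc : Measurable c)
    (hMo : Measurable Mo) (hc1 : ∀ x, c x ≤ 1)
    (h : ∀ A, MeasurableSet A → ∀ S, MeasurableSet S →
      P (X ⁻¹' A ∩ (ev ∩ Y ⁻¹' S)) = ∫⁻ ω in X ⁻¹' A, c (X ω) * E.law (Mo (X ω)) π S ∂P)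
    {f : Ω' × Obs → ℝ≥0∞} (hf : Measurable f) :
    ∫⁻ ω in ev, f (X ω, Y ω) ∂P = ∫⁻ ω, c (X ω) * ∫⁻ o, f (X ω, o) ∂(E.law (Mo (X ω)) π) ∂P := by
  have := isFiniteKernel_obsKernel (E := E) (π := π) hc hMo hc1
  have h1 := lintegral_map hf (hX.prodMk hY) (μ := P.restrict ev)
  rw [map_restrict_eq_compProd hX hY hc hMo hc1 h, Measure.lintegral_compProd hf,
    lintegral_map (Measurable.lintegral_kernel_prod_right' hf) hX] at h1
  rw [← h1]
  exact lintegral_congr fun ω => by rw [obsKernel_apply, lintegral_smul_measure, smul_eq_mul]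

theorem setIntegral_tower (hX : Measurable X) (hY : Measurable Y) (hc : Measurable c)
    (hMo : Measurable Mo) (hc1 : ∀ x, c x ≤ 1)
    (h : ∀ A, MeasurableSet A → ∀ S, MeasurableSet S →
      P (X ⁻¹' A ∩ (ev ∩ Y ⁻¹' S)) = ∫⁻ ω in X ⁻¹' A, c (X ω) * E.law (Mo (X ω)) π S ∂P)
    {f : Ω' × Obs → ℝ} (hf : Measurable f) (hint : IntegrableOn (fun ω => f (X ω, Y ω)) ev P) :
    Integrable (fun ω => (c (X ω)).toReal * ∫ o, f (X ω, o) ∂(E.law (Mo (X ω)) π)) P ∧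
    ∫ ω in ev, f (X ω, Y ω) ∂P
      = ∫ ω, (c (X ω)).toReal * ∫ o, f (X ω, o) ∂(E.law (Mo (X ω)) π) ∂P := by
  have := isFiniteKernel_obsKernel (E := E) (π := π) hc hMo hc1
  have h0 := map_restrict_eq_compProd hX hY hc hMo hc1 h
  have h1 : Integrable f ((P.map X) ⊗ₘ (obsKernel E π hc hMo)) := by
    rw [← h0]
    exact (integrable_map_measure hf.aestronglyMeasurable (hX.prodMk hY).aemeasurable).2 hint
  have e : ∀ x, ∫ o, f (x, o) ∂(obsKernel E π hc hMo x)
      = (c x).toReal * ∫ o, f (x, o) ∂(E.law (Mo x) π) := fun x => by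
    rw [obsKernel_apply, integral_smul_measure, smul_eq_mul]
  have h3 : Integrable (fun x => ∫ o, f (x, o) ∂(obsKernel E π hc hMo x)) (P.map X) := by
    have h2 : Integrable f ((Kernel.const Unit (P.map X)
      ⊗ₖ Kernel.prodMkLeft Unit (obsKernel E π hc hMo)) ()) := h1
    simpa using h2.integral_compProd
  have h4 := integral_map (hX.prodMk hY).aemeasurable (μ := P.restrict ev)
    (f := f) hf.aestronglyMeasurable
  rw [h0, Measure.integral_compProd h1, integral_map hX.aemeasurable h3.aestronglyMeasurable] at h4
  simp only [e] at h3 h4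
  exact ⟨h3.comp_measurable hX, h4.symm⟩

end Tower

section Interaction

variable {Mod Pol Obs Φ Ω : Type*} [MeasurableSpace Mod] [MeasurableSpace Obs]
  [Fintype Φ] {mΩ : MeasurableSpace Ω} {P : Measure Ω}
  {ℱ : Filtration ℕ mΩ} {E : DMSO Mod Pol Obs} {I : InfoSets Mod Pol Φ} {T : ℕ} {φs : Φ}
  {G : Play Mod Pol Obs Φ Ω} {t : ℕ}

theorem IsInteraction.measurableSet_act (hG : IsInteraction P ℱ E I T φs G) (ht : t < T) (π : Pol) :
    MeasurableSet {ω | G.act t ω = π} :=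
  ℱ.le (t + 1) _ (hG.measurable_act t ht π)

/-- The probabilities p_t(π) are at most 1 only almost surely; truncation at 1 gives a kernel that
is finite at every point. -/
theorem IsInteraction.tower_aux [Fintype Pol]
    (hG : IsInteraction P ℱ E I T φs G) (ht : t < T)
    (hp : ∀ᵐ ω ∂P, G.p t ω ∈ stdSimplex ℝ Pol) (π : Pol) :
    (∀ᵐ ω ∂P, ENNReal.ofReal (min (G.p t ω π) 1) = ENNReal.ofReal (G.p t ω π)) ∧
    ∀ A, MeasurableSet[ℱ t] A → ∀ S, MeasurableSet S →
      P (id ⁻¹' A ∩ ({ω | G.act t ω = π} ∩ G.obs t ⁻¹' S))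
        = ∫⁻ ω in id ⁻¹' A, ENNReal.ofReal (min (G.p t (id ω) π) 1)
            * E.law (G.model t (id ω)) π S ∂P := by
  have h1 : ∀ᵐ ω ∂P, ENNReal.ofReal (min (G.p t ω π) 1) = ENNReal.ofReal (G.p t ω π) := by
    filter_upwards [hp] with ω hω
    rw [min_eq_left]
    rw [← hω.2]
    exact Finset.single_le_sum (fun π _ => hω.1 π) (Finset.mem_univ π)
  refine ⟨h1, fun A hA S hS => ?_⟩
  refine (hG.conditional_law t ht A hA π S hS).trans ?_
  refine lintegral_congr_ae (ae_restrict_of_ae ?_)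
  filter_upwards [h1] with ω hω
  simp only [id_eq]
  rw [hω]

theorem sum_indicator_fiber {α β M : Type*} [Fintype β] [AddCommMonoid M] (g : α → β)
    (F : β → α → M) (x : α) : ∑ y, {x | g x = y}.indicator (F y) x = F (g x) x := by
  rw [Finset.sum_eq_single (g x)]
  · simp [indicator]
  · intro y _ hy
    exact indicator_of_notMem (fun h => hy h.symm) _
  · simp

theorem IsInteraction.measurable_of_act [Finite Pol] {β : Type*} [MeasurableSpace β]
    (hG : IsInteraction P ℱ E I T φs G) (ht : t < T) {F : Pol → Ω → β}
    (hF : ∀ π, Measurable (F π)) : Measurable fun ω => F (G.act t ω) ω := by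
  intro s hs
  have : (fun ω => F (G.act t ω) ω) ⁻¹' s
      = ⋃ π, ({ω | G.act t ω = π} ∩ F π ⁻¹' s) := by
    ext ω; simp
  rw [this]
  exact MeasurableSet.iUnion fun π => (hG.measurableSet_act ht π).inter (hF π hs)

theorem IsInteraction.measurable_pair (hG : IsInteraction P ℱ E I T φs G) (ht : t < T)
    {β : Type*} [MeasurableSpace β] {f : Ω × Obs → β}
    (hf : @Measurable _ _ ((ℱ t).prod inferInstance) _ f) :
    Measurable fun ω => f (ω, G.obs t ω) := by
  refine @Measurable.comp _ _ _ _ ((ℱ t).prod inferInstance) _ _ _ hf ?_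
  exact @Measurable.prodMk _ _ _ _ (ℱ t) _ _ _ (measurable_id'' (ℱ.le t))
    ((hG.measurable_obs t ht).mono (ℱ.le _) le_rfl)

/-- The law of total expectation for nonnegative functions of the history and the observation. -/
theorem IsInteraction.lintegral_tower [Fintype Pol] [IsProbabilityMeasure P]
    (hG : IsInteraction P ℱ E I T φs G) (ht : t < T)
    (hp : ∀ᵐ ω ∂P, G.p t ω ∈ stdSimplex ℝ Pol) {F : Pol → Ω × Obs → ℝ≥0∞}
    (hF : ∀ π, @Measurable _ _ ((ℱ t).prod inferInstance) _ (F π)) :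
    (∀ π, Measurable fun ω => ∫⁻ o, F π (ω, o) ∂(E.law (G.model t ω) π)) ∧
    ∫⁻ ω, F (G.act t ω) (ω, G.obs t ω) ∂P
      = ∫⁻ ω, ∑ π, ENNReal.ofReal (G.p t ω π) * ∫⁻ o, F π (ω, o) ∂(E.law (G.model t ω) π) ∂P := by
  have hobs := (hG.measurable_obs t ht).mono (ℱ.le _) le_rfl
  have hmeas : ∀ π, Measurable fun ω => ∫⁻ o, F π (ω, o) ∂(E.law (G.model t ω) π) := fun π =>
    Measurable.mono (measurable_lintegral_law (mΩ' := ℱ t) (hG.measurable_model t ht) (hF π))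
      (ℱ.le t) le_rfl
  have hpm : ∀ π, Measurable[ℱ t] fun ω => ENNReal.ofReal (min (G.p t ω π) 1) := fun π =>
    ENNReal.measurable_ofReal.comp ((hG.measurable_p t ht π).min measurable_const)
  have hpm' : ∀ π, Measurable fun ω => ENNReal.ofReal (G.p t ω π) := fun π =>
    ENNReal.measurable_ofReal.comp ((hG.measurable_p t ht π).mono (ℱ.le t) le_rfl)
  refine ⟨hmeas, ?_⟩
  have h1 : ∀ ω, F (G.act t ω) (ω, G.obs t ω)
      = ∑ π, {ω | G.act t ω = π}.indicator (fun ω => F π (ω, G.obs t ω)) ω := fun ω =>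
    (sum_indicator_fiber (G.act t) (fun π ω => F π (ω, G.obs t ω)) ω).symm
  simp only [h1]
  have hprod : ∀ π, Measurable fun ω =>
      ENNReal.ofReal (G.p t ω π) * ∫⁻ o, F π (ω, o) ∂(E.law (G.model t ω) π) :=
    fun π => (hpm' π).mul (hmeas π)
  rw [lintegral_finsetSum _ fun π _ => (hG.measurable_pair ht (hF π)).indicator
    (hG.measurableSet_act ht π), lintegral_finsetSum _ fun π _ => hprod π]
  refine Finset.sum_congr rfl fun π _ => ?_
  obtain ⟨h2, h3⟩ := hG.tower_aux ht hp π
  rw [lintegral_indicator (hG.measurableSet_act ht π)]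
  -- The history is represented by the identity map into Ω equipped with the σ-algebra of round t,
  -- so functions of the history need no factorisation.
  refine (setLIntegral_tower (mΩ' := ℱ t) (X := id) (measurable_id'' (ℱ.le t)) hobs
    (hpm π) (hG.measurable_model t ht)
    (fun ω => by simp) h3 (hF π)).trans ?_
  refine lintegral_congr_ae ?_
  filter_upwards [h2] with ω hω
  simp only [id_eq]
  rw [hω]

/-- The law of total expectation for integrable functions of the history and the observation. -/
theorem IsInteraction.integral_tower [Fintype Pol] [IsProbabilityMeasure P]
    (hG : IsInteraction P ℱ E I T φs G) (ht : t < T)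
    (hp : ∀ᵐ ω ∂P, G.p t ω ∈ stdSimplex ℝ Pol) {F : Pol → Ω × Obs → ℝ}
    (hF : ∀ π, @Measurable _ _ ((ℱ t).prod inferInstance) _ (F π))
    (hint : Integrable (fun ω => F (G.act t ω) (ω, G.obs t ω)) P) :
    Integrable (fun ω => ∑ π, G.p t ω π * ∫ o, F π (ω, o) ∂(E.law (G.model t ω) π)) P ∧
    ∫ ω, F (G.act t ω) (ω, G.obs t ω) ∂P
      = ∫ ω, ∑ π, G.p t ω π * ∫ o, F π (ω, o) ∂(E.law (G.model t ω) π) ∂P := by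
  have hobs := (hG.measurable_obs t ht).mono (ℱ.le _) le_rfl
  have hpm : ∀ π, Measurable[ℱ t] fun ω => ENNReal.ofReal (min (G.p t ω π) 1) := fun π =>
    ENNReal.measurable_ofReal.comp ((hG.measurable_p t ht π).min measurable_const)
  have hon : ∀ π, IntegrableOn (fun ω => F π (ω, G.obs t ω)) {ω | G.act t ω = π} P := fun π =>
    (hint.integrableOn (s := {ω | G.act t ω = π})).congr_fun
      (fun ω (hω : G.act t ω = π) => by simp only [hω]) (hG.measurableSet_act ht π)
  have hkey : ∀ π, Integrable (fun ω => G.p t ω π * ∫ o, F π (ω, o) ∂(E.law (G.model t ω) π)) P ∧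
      ∫ ω in {ω | G.act t ω = π}, F π (ω, G.obs t ω) ∂P
        = ∫ ω, G.p t ω π * ∫ o, F π (ω, o) ∂(E.law (G.model t ω) π) ∂P := fun π => by
    obtain ⟨h2, h3⟩ := hG.tower_aux ht hp π
    obtain ⟨h4, h5⟩ := setIntegral_tower (mΩ' := ℱ t) (X := id) (measurable_id'' (ℱ.le t)) hobs
      (hpm π) (hG.measurable_model t ht)
      (fun ω => by simp) h3 (hF π) (hon π)
    have hae : (fun ω => (ENNReal.ofReal (min (G.p t (id ω) π) 1)).toReal
        * ∫ o, F π (id ω, o) ∂(E.law (G.model t (id ω)) π))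
        =ᵐ[P] fun ω => G.p t ω π * ∫ o, F π (ω, o) ∂(E.law (G.model t ω) π) := by
      filter_upwards [h2, hp] with ω hω hpω
      simp only [id_eq]
      rw [hω, ENNReal.toReal_ofReal (hpω.1 π)]
    exact ⟨h4.congr hae, h5.trans (integral_congr_ae hae)⟩
  refine ⟨integrable_finsetSum _ fun π _ => (hkey π).1, ?_⟩
  rw [integral_finsetSum _ fun π _ => (hkey π).1]
  have h1 : ∀ ω, F (G.act t ω) (ω, G.obs t ω)
      = ∑ π, {ω | G.act t ω = π}.indicator (fun ω => F π (ω, G.obs t ω)) ω := fun ω =>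
    (sum_indicator_fiber (G.act t) (fun π ω => F π (ω, G.obs t ω)) ω).symm
  simp only [h1]
  rw [integral_finsetSum _ fun π _ => (hon π).integrable_indicator (hG.measurableSet_act ht π)]
  refine Finset.sum_congr rfl fun π _ => ?_
  rw [integral_indicator (hG.measurableSet_act ht π), (hkey π).2]

/-- An event has probability zero iff it has conditional probability zero almost surely. -/
theorem IsInteraction.ae_iff [Fintype Pol] [IsProbabilityMeasure P]
    (hG : IsInteraction P ℱ E I T φs G) (ht : t < T)
    (hp : ∀ᵐ ω ∂P, G.p t ω ∈ stdSimplex ℝ Pol) {N : Pol → Set (Ω × Obs)}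
    (hN : ∀ π, @MeasurableSet _ ((ℱ t).prod inferInstance) (N π)) :
    (∀ᵐ ω ∂P, (ω, G.obs t ω) ∉ N (G.act t ω)) ↔
      ∀ᵐ ω ∂P, ∀ π, 0 < G.p t ω π → ∀ᵐ o ∂(E.law (G.model t ω) π), (ω, o) ∉ N π := by
  have hF : ∀ π, @Measurable _ _ ((ℱ t).prod inferInstance) _
      ((N π).indicator (fun _ => (1 : ℝ≥0∞))) := fun π =>
    Measurable.indicator measurable_const (hN π)
  obtain ⟨h1, h2⟩ := hG.lintegral_tower ht hp hF
  have hpm : ∀ π, Measurable fun ω => ENNReal.ofReal (G.p t ω π) := fun π =>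
    ENNReal.measurable_ofReal.comp ((hG.measurable_p t ht π).mono (ℱ.le t) le_rfl)
  have hmeas1 : Measurable fun ω => (N (G.act t ω)).indicator (fun _ => (1 : ℝ≥0∞))
      (ω, G.obs t ω) :=
    hG.measurable_of_act ht fun π => hG.measurable_pair ht (hF π)
  have hsec : ∀ ω π, MeasurableSet {o | (ω, o) ∈ N π} := fun ω π =>
    (@measurable_prodMk_left _ _ (ℱ t) _ ω) (hN π)
  have e1 : (∫⁻ ω, (N (G.act t ω)).indicator (fun _ => (1 : ℝ≥0∞)) (ω, G.obs t ω) ∂P = 0) ↔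
      ∀ᵐ ω ∂P, (ω, G.obs t ω) ∉ N (G.act t ω) := by
    rw [lintegral_eq_zero_iff hmeas1]
    refine Filter.eventually_congr (ae_of_all _ fun ω => ?_)
    simp
  have e2 : (∫⁻ ω, ∑ π, ENNReal.ofReal (G.p t ω π) * ∫⁻ o, (N π).indicator (fun _ => (1 : ℝ≥0∞))
      (ω, o) ∂(E.law (G.model t ω) π) ∂P = 0) ↔
      ∀ᵐ ω ∂P, ∀ π, 0 < G.p t ω π → ∀ᵐ o ∂(E.law (G.model t ω) π), (ω, o) ∉ N π := by
    have hprod : Measurable fun ω => ∑ π, ENNReal.ofReal (G.p t ω π)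
        * ∫⁻ o, (N π).indicator (fun _ => (1 : ℝ≥0∞)) (ω, o) ∂(E.law (G.model t ω) π) :=
      Finset.measurable_sum _ fun π _ => (hpm π).mul (h1 π)
    rw [lintegral_eq_zero_iff hprod]
    refine Filter.eventually_congr (ae_of_all _ fun ω => ?_)
    simp only [Pi.zero_apply, Finset.sum_eq_zero_iff, Finset.mem_univ, true_imp_iff, mul_eq_zero,
      ENNReal.ofReal_eq_zero]
    refine forall_congr' fun π => ?_
    have e3 : ∫⁻ o, (N π).indicator (fun _ => (1 : ℝ≥0∞)) (ω, o) ∂(E.law (G.model t ω) π) = 0 ↔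
        ∀ᵐ o ∂(E.law (G.model t ω) π), (ω, o) ∉ N π := by
      have : ∀ o, (N π).indicator (fun _ => (1 : ℝ≥0∞)) (ω, o)
          = {o | (ω, o) ∈ N π}.indicator (fun _ => (1 : ℝ≥0∞)) o := fun o => rfl
      simp only [this]
      rw [lintegral_indicator_const (hsec ω π), one_mul, MeasureTheory.ae_iff]
      simp
    rw [e3, ← not_lt]
    tauto
  rw [← e1, ← e2, h2]

end Interaction

end DigDEC

namespace DigDEC

/-! ### Squared estimation errors and the Bernstein condition -/

section Estimation

variable {Mod Pol Obs Φ : Type*} [MeasurableSpace Mod] [MeasurableSpace Obs]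
  {H : ℕ} {E : DMSO Mod Pol Obs} {I : InfoSets Mod Pol Φ} {B : ℝ}
  {ξ : Fin H → Φ → Φ → Obs → ℝ} {bell : Mod → Φ → Φ}

theorem measurable_delta {Obs Φ : Type*} [MeasurableSpace Obs] {H : ℕ} {B : ℝ}
    {ξ : Fin H → Φ → Φ → Obs → ℝ} (hξ : ∀ h φ' φ, Measurable (ξ h φ' φ)) (φ' φ : Φ) :
    Measurable fun o => delta B ξ o φ' φ :=
  (Finset.measurable_sum _ fun h _ => hξ h φ' φ).const_mul _

theorem measurable_excess {Obs Φ : Type*} [MeasurableSpace Obs] {H : ℕ} {B : ℝ}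
    {ξ : Fin H → Φ → Φ → Obs → ℝ} (hξ : ∀ h φ' φ, Measurable (ξ h φ' φ)) (τ : Φ → Φ) (φ' φ : Φ) :
    Measurable fun o => excess B ξ τ o φ' φ :=
  (measurable_delta hξ φ' φ).sub (measurable_delta hξ (τ φ) φ)

theorem excess_eq_sum {Obs Φ : Type*} {H : ℕ} {B : ℝ} {ξ : Fin H → Φ → Φ → Obs → ℝ} (τ : Φ → Φ)
    (o : Obs) (φ' φ : Φ) :
    excess B ξ τ o φ' φ = 1 / (B ^ 2 * H) * ∑ h, (ξ h φ' φ o - ξ h (τ φ) φ o) := by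
  rw [excess, delta, delta, Finset.sum_sub_distrib, mul_sub]

theorem SquaredEstimation.integrable_excess (hS : SquaredEstimation E I B ξ bell) (hH : 0 < H)
    (hB : 0 < B) (τ : Φ → Φ) (φ' φ : Φ) (M : Mod) (π : Pol) :
    Integrable (fun o => excess B ξ τ o φ' φ) (E.law M π) := by
  have := isProbabilityMeasure_law E M π
  exact Integrable.of_bound (measurable_excess hS.measurable_ξ τ φ' φ).aestronglyMeasurable 1
    (ae_of_all _ fun o => abs_excess_le hH hB hS.ξ_mem τ o φ' φ)

theorem SquaredEstimation.integrable_excess_sq (hS : SquaredEstimation E I B ξ bell) (hH : 0 < H)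
    (hB : 0 < B) (τ : Φ → Φ) (φ' φ : Φ) (M : Mod) (π : Pol) :
    Integrable (fun o => excess B ξ τ o φ' φ ^ 2) (E.law M π) := by
  have := isProbabilityMeasure_law E M π
  refine Integrable.of_bound
    ((measurable_excess hS.measurable_ξ τ φ' φ).pow_const 2).aestronglyMeasurable 1
    (ae_of_all _ fun o => ?_)
  rw [norm_pow]
  exact pow_le_one₀ (norm_nonneg _) (abs_excess_le hH hB hS.ξ_mem τ o φ' φ)

theorem SquaredEstimation.integrable_sub (hS : SquaredEstimation E I B ξ bell) (τ : Φ → Φ)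
    (h : Fin H) (φ' φ : Φ) (M : Mod) (π : Pol) :
    Integrable (fun o => ξ h φ' φ o - ξ h (τ φ) φ o) (E.law M π) := by
  have := isProbabilityMeasure_law E M π
  refine Integrable.of_bound
    ((hS.measurable_ξ h φ' φ).sub (hS.measurable_ξ h (τ φ) φ)).aestronglyMeasurable (B ^ 2)
    (ae_of_all _ fun o => ?_)
  have h1 := hS.ξ_mem h φ' φ o
  have h2 := hS.ξ_mem h (τ φ) φ o
  rw [Real.norm_eq_abs, abs_le]
  constructor <;> linarith [h1.1, h1.2, h2.1, h2.2]

theorem SquaredEstimation.integrable_sub_sq (hS : SquaredEstimation E I B ξ bell) (τ : Φ → Φ)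
    (h : Fin H) (φ' φ : Φ) (M : Mod) (π : Pol) :
    Integrable (fun o => (ξ h φ' φ o - ξ h (τ φ) φ o) ^ 2) (E.law M π) := by
  have := isProbabilityMeasure_law E M π
  refine Integrable.of_bound (((hS.measurable_ξ h φ' φ).sub
    (hS.measurable_ξ h (τ φ) φ)).pow_const 2).aestronglyMeasurable ((B ^ 2) ^ 2)
    (ae_of_all _ fun o => ?_)
  have h1 := hS.ξ_mem h φ' φ o
  have h2 := hS.ξ_mem h (τ φ) φ o
  rw [norm_pow]
  refine pow_le_pow_left₀ (norm_nonneg _) ?_ 2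
  rw [Real.norm_eq_abs, abs_le]
  constructor <;> linarith [h1.1, h1.2, h2.1, h2.2]

theorem SquaredEstimation.integral_excess (hS : SquaredEstimation E I B ξ bell) (τ : Φ → Φ)
    (φ' φ : Φ) (M : Mod) (π : Pol) :
    ∫ o, excess B ξ τ o φ' φ ∂(E.law M π)
      = 1 / (B ^ 2 * H) * ∑ h, ∫ o, (ξ h φ' φ o - ξ h (τ φ) φ o) ∂(E.law M π) := by
  simp only [excess_eq_sum]
  rw [integral_const_mul, integral_finsetSum _ fun h _ => hS.integrable_sub τ h φ' φ M π]

theorem SquaredEstimation.sqDiv_eq (hS : SquaredEstimation E I B ξ bell) (π : Pol) (φ : Φ)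
    (M : Mod) : sqDiv E B ξ bell π φ M = ∫ o, excess B ξ (bell M) o φ φ ∂(E.law M π) :=
  (hS.integral_excess (bell M) φ φ M π).symm

/-- The Bernstein condition for the averaged estimation error. -/
theorem SquaredEstimation.excess_bernstein (hS : SquaredEstimation E I B ξ bell) (hH : 0 < H)
    (hB : 0 < B) (φ' φ : Φ) (M : Mod) (π : Pol) :
    ∫ o, excess B ξ (bell M) o φ' φ ^ 2 ∂(E.law M π)
      ≤ 4 * ∫ o, excess B ξ (bell M) o φ' φ ∂(E.law M π) := by
  have hH' : (0 : ℝ) < H := by exact_mod_cast hH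
  have h1 : ∀ o, excess B ξ (bell M) o φ' φ ^ 2
      ≤ 1 / (B ^ 4 * H) * ∑ h, (ξ h φ' φ o - ξ h (bell M φ) φ o) ^ 2 := fun o => by
    -- The average over h inherits the condition of the single layers by Cauchy–Schwarz, with the
    -- constant 4 preserved by the normalisation 1/(B² H).
    have h2 := sq_sum_le_card_mul_sum_sq (s := (Finset.univ : Finset (Fin H)))
      (f := fun h => ξ h φ' φ o - ξ h (bell M φ) φ o)
    rw [Finset.card_univ, Fintype.card_fin] at h2
    rw [excess_eq_sum, mul_pow]
    calc (1 / (B ^ 2 * H)) ^ 2 * (∑ h, (ξ h φ' φ o - ξ h (bell M φ) φ o)) ^ 2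
        ≤ (1 / (B ^ 2 * H)) ^ 2 * (H * ∑ h, (ξ h φ' φ o - ξ h (bell M φ) φ o) ^ 2) :=
          mul_le_mul_of_nonneg_left h2 (sq_nonneg _)
      _ = _ := by field_simp
  calc ∫ o, excess B ξ (bell M) o φ' φ ^ 2 ∂(E.law M π)
      ≤ ∫ o, 1 / (B ^ 4 * H) * ∑ h, (ξ h φ' φ o - ξ h (bell M φ) φ o) ^ 2 ∂(E.law M π) :=
        integral_mono (hS.integrable_excess_sq hH hB _ φ' φ M π)
          ((integrable_finsetSum _ fun h _ => hS.integrable_sub_sq _ h φ' φ M π).const_mul _) h1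
    _ = 1 / (B ^ 4 * H) * ∑ h, ∫ o, (ξ h φ' φ o - ξ h (bell M φ) φ o) ^ 2 ∂(E.law M π) := by
        rw [integral_const_mul, integral_finsetSum _ fun h _ => hS.integrable_sub_sq _ h φ' φ M π]
    _ ≤ 1 / (B ^ 4 * H)
          * ∑ h, 4 * B ^ 2 * ∫ o, (ξ h φ' φ o - ξ h (bell M φ) φ o) ∂(E.law M π) :=
        mul_le_mul_of_nonneg_left (Finset.sum_le_sum fun h _ => hS.bernstein h φ' φ M π)
          (by positivity)
    _ = _ := by
        rw [hS.integral_excess, ← Finset.mul_sum]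
        field_simp

theorem SquaredEstimation.integral_excess_nonneg (hS : SquaredEstimation E I B ξ bell)
    (hH : 0 < H) (hB : 0 < B) (φ' φ : Φ) (M : Mod) (π : Pol) :
    0 ≤ ∫ o, excess B ξ (bell M) o φ' φ ∂(E.law M π) := by
  have h1 := hS.excess_bernstein hH hB φ' φ M π
  have h2 : 0 ≤ ∫ o, excess B ξ (bell M) o φ' φ ^ 2 ∂(E.law M π) :=
    integral_nonneg fun o => sq_nonneg _
  linarith

theorem SquaredEstimation.sqDiv_mem (hS : SquaredEstimation E I B ξ bell) (hH : 0 < H)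
    (hB : 0 < B) (π : Pol) (φ : Φ) (M : Mod) : sqDiv E B ξ bell π φ M ∈ Icc (0 : ℝ) 1 := by
  have := isProbabilityMeasure_law E M π
  rw [hS.sqDiv_eq]
  refine ⟨hS.integral_excess_nonneg hH hB φ φ M π, ?_⟩
  calc ∫ o, excess B ξ (bell M) o φ φ ∂(E.law M π) ≤ ∫ _o, (1 : ℝ) ∂(E.law M π) :=
        integral_mono (hS.integrable_excess hH hB _ φ φ M π) (integrable_const _) fun o =>
          (le_abs_self _).trans (abs_excess_le hH hB hS.ξ_mem _ o φ φ)
    _ = 1 := by simp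

/-- This is the reason for the shape X²/4 - X in the pathwise bound: E X² ≤ 4 E X says precisely
that its mean is nonpositive. -/
theorem SquaredEstimation.integral_quad_nonpos (hS : SquaredEstimation E I B ξ bell) (hH : 0 < H)
    (hB : 0 < B) (φ' φ : Φ) (M : Mod) (π : Pol) :
    ∫ o, (excess B ξ (bell M) o φ' φ ^ 2 / 4 - excess B ξ (bell M) o φ' φ) ∂(E.law M π) ≤ 0 := by
  rw [integral_sub ((hS.integrable_excess_sq hH hB _ φ' φ M π).div_const 4)
    (hS.integrable_excess hH hB _ φ' φ M π), integral_div]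
  linarith [hS.excess_bernstein hH hB φ' φ M π]

/-- T_M φ takes countably many values, each on a measurable set of models, so the function is
measurable piece by piece. -/
theorem SquaredEstimation.measurable_bell_apply [Countable Φ] {Ω' β : Type*}
    {mΩ' : MeasurableSpace Ω'} [MeasurableSpace β]
    (hS : SquaredEstimation E I B ξ bell) {Mo : Ω' → Mod} (hMo : Measurable Mo) (φ : Φ)
    {F : Φ → Ω' → β} (hF : ∀ ψ, Measurable (F ψ)) : Measurable fun x => F (bell (Mo x) φ) x := by
  intro s hs
  have : (fun x => F (bell (Mo x) φ) x) ⁻¹' s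
      = ⋃ ψ, (Mo ⁻¹' {M | bell M φ = ψ} ∩ F ψ ⁻¹' s) := by
    ext x; simp
  rw [this]
  exact MeasurableSet.iUnion fun ψ => (hMo (hS.measurable_bell φ ψ)).inter (hF ψ hs)

end Estimation

/-! ### Posterior probabilities and their logarithms -/

section Posterior

variable {Mod Pol Obs Φ : Type*} [MeasurableSpace Mod] [MeasurableSpace Obs] [Fintype Φ]
  {E : DMSO Mod Pol Obs} {I : InfoSets Mod Pol Φ} {w : Mod × Pol → ℝ≥0∞} {π : Pol} {o : Obs}
  {φs : Φ}

/-- A single positive coordinate excludes the degenerate normalisers 0 and ⊤, for which every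
coordinate would be 0. -/
theorem infoPosterior_mem_stdSimplex (h : 0 < infoPosterior E I w π o φs) :
    infoPosterior E I w π o ∈ stdSimplex ℝ Φ := by
  have h0 : mixLik E I w π o ≠ 0 := fun h0 => by
    have : infoLik E I w π o φs = 0 := le_bot_iff.1 ((infoLik_le_mixLik π o φs).trans h0.le)
    rw [infoPosterior, this] at h
    simp at h
  have h1 : mixLik E I w π o ≠ ⊤ := fun h1 => by
    rw [infoPosterior, h1] at h
    simp at h
  refine ⟨fun φ => ENNReal.toReal_nonneg, ?_⟩
  simp only [infoPosterior]
  rw [← ENNReal.toReal_sum fun φ _ => (ENNReal.div_lt_top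
    (ne_top_of_le_ne_top h1 (infoLik_le_mixLik π o φ)) h0).ne]
  simp only [div_eq_mul_inv]
  rw [← Finset.sum_mul, ← mixLik, ENNReal.mul_inv_cancel h0 h1, ENNReal.toReal_one]

theorem infoPosterior_le_one : infoPosterior E I w π o φs ≤ 1 := by
  rcases le_or_gt (infoPosterior E I w π o φs) 0 with h | h
  · linarith
  · have := infoPosterior_mem_stdSimplex h
    rw [← this.2]
    exact Finset.single_le_sum (fun φ _ => this.1 φ) (Finset.mem_univ φs)

theorem ae_infoPosterior_pos {M : Mod} (hw : w.support.Countable)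
    (h : logLoss E I π w M φs ≠ ⊤) : ∀ᵐ o ∂(E.law M π), 0 < infoPosterior E I w π o φs := by
  filter_upwards [ae_lt_top (measurable_negLog_infoPosterior hw) h] with o ho
  by_contra h0
  rw [negLog_of_nonpos (not_lt.1 h0)] at ho
  exact lt_irrefl _ ho

theorem integrable_log_infoPosterior {M : Mod} (hw : w.support.Countable)
    (h : logLoss E I π w M φs ≠ ⊤) :
    Integrable (fun o => Real.log (infoPosterior E I w π o φs)) (E.law M π) ∧
      ∫ o, Real.log (infoPosterior E I w π o φs) ∂(E.law M π) = -(logLoss E I π w M φs).toReal := by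
  have hm : Measurable fun o => Real.log (infoPosterior E I w π o φs) :=
    Real.measurable_log.comp (measurable_infoPosterior E hw π φs)
  have hnn : ∀ o, 0 ≤ -Real.log (infoPosterior E I w π o φs) := fun o => by
    have := Real.log_nonpos ENNReal.toReal_nonneg (infoPosterior_le_one (E := E) (I := I) (w := w)
      (π := π) (o := o) (φs := φs))
    exact neg_nonneg.2 this
  have e : ∫⁻ o, ENNReal.ofReal (-Real.log (infoPosterior E I w π o φs)) ∂(E.law M π)
      = logLoss E I π w M φs := by
    refine lintegral_congr_ae ?_
    filter_upwards [ae_infoPosterior_pos hw h] with o ho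
    rw [negLog_of_pos ho]
  have hi : Integrable (fun o => -Real.log (infoPosterior E I w π o φs)) (E.law M π) :=
    (lintegral_ofReal_ne_top_iff_integrable hm.neg.aestronglyMeasurable (ae_of_all _ hnn)).1
      (e.trans_ne h)
  refine ⟨by simpa using hi.neg, ?_⟩
  rw [← neg_eq_iff_eq_neg, ← integral_neg, integral_eq_lintegral_of_nonneg_ae (ae_of_all _ hnn)
    hm.neg.aestronglyMeasurable, e]

end Posterior

end DigDEC

namespace DigDEC

/-- A run of the algorithm against an adversary that satisfies all requirements. -/
structure IsRun {Mod Pol Obs Φ Ω : Type*} [MeasurableSpace Mod] [Fintype Pol] [MeasurableSpace Obs]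
    [Fintype Φ] [mΩ : MeasurableSpace Ω] (P : Measure Ω) (ℱ : Filtration ℕ mΩ)
    (E : DMSO Mod Pol Obs) (I : InfoSets Mod Pol Φ) {H : ℕ} (B : ℝ)
    (ξ : Fin H → Φ → Φ → Obs → ℝ) (bell : Mod → Φ → Φ) (η : ℝ) (T : ℕ) (φs : Φ)
    (G : Play Mod Pol Obs Φ Ω) : Prop where
  H_pos : 0 < H
  B_pos : 0 < B
  η_pos : 0 < η
  estimation : SquaredEstimation E I B ξ bell
  interaction : IsInteraction P ℱ E I T φs G
  bell_const : ∀ᵐ ω ∂P, ∀ t < T, ∀ t' < T, ∀ φ, bell (G.model t ω) φ = bell (G.model t' ω) φ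
  algorithm : IsAlgorithm P E I B ξ bell η T G
  mixLik_ne_zero : ∀ᵐ ω ∂P, ∀ t < T, mixLik E I (G.ν t ω) (G.act t ω) (G.obs t ω) ≠ 0

/-! ### Measurability, positivity and integrability in one round -/

section Run

variable {Mod Pol Obs Φ Ω : Type*} [MeasurableSpace Mod] [Fintype Pol] [MeasurableSpace Obs]
  [Fintype Φ] {mΩ : MeasurableSpace Ω} {P : Measure Ω}
  {ℱ : Filtration ℕ mΩ} {E : DMSO Mod Pol Obs} {I : InfoSets Mod Pol Φ} {H : ℕ} {B : ℝ}
  {ξ : Fin H → Φ → Φ → Obs → ℝ} {bell : Mod → Φ → Φ} {η : ℝ} {T : ℕ} {φs : Φ}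
  {G : Play Mod Pol Obs Φ Ω} {t : ℕ}

/-- The quantity `log ν_t(φ⋆ | π, o) - log ρ_t(φ⋆) + ∑_φ ρ_t(φ) (Δ(φ, φ) - Δ(T_M φ, φ))`, whose
conditional expectation is the estimation term of round `t`. -/
noncomputable def roundGain (E : DMSO Mod Pol Obs) (I : InfoSets Mod Pol Φ) (B : ℝ)
    (ξ : Fin H → Φ → Φ → Obs → ℝ) (bell : Mod → Φ → Φ) (φs : Φ) (G : Play Mod Pol Obs Φ Ω) (t : ℕ)
    (π : Pol) (z : Ω × Obs) : ℝ :=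
  Real.log (infoPosterior E I (G.ν t z.1) π z.2 φs) - Real.log (G.ρ t z.1 φs)
    + ∑ φ, G.ρ t z.1 φ * excess B ξ (bell (G.model t z.1)) z.2 φ φ

/-- The estimation term of round `t`. -/
noncomputable def roundEst (E : DMSO Mod Pol Obs) (I : InfoSets Mod Pol Φ)
    (Dbar : Pol → Φ → Mod → ℝ) (φs : Φ) (G : Play Mod Pol Obs Φ Ω) (t : ℕ) (ω : Ω) : ℝ :=
  ∑ π, G.p t ω π * (-Real.log (G.ρ t ω φs) - (logLoss E I π (G.ν t ω) (G.model t ω) φs).toReal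
    + ∑ φ, G.ρ t ω φ * Dbar π φ (G.model t ω))

namespace IsRun

theorem sqDiv_mem (h : IsRun P ℱ E I B ξ bell η T φs G) :
    ∀ π φ M, sqDiv E B ξ bell π φ M ∈ Icc (0 : ℝ) 1 :=
  h.estimation.sqDiv_mem h.H_pos h.B_pos

theorem ae_minimax (h : IsRun P ℱ E I B ξ bell η T φs G) (ht : t < T) :
    ∀ᵐ ω ∂P, IsMinimax E I (sqDiv E B ξ bell) η (G.p t ω) (G.ν t ω) (G.ρ t ω) := by
  filter_upwards [h.algorithm.minimax] with ω hω using hω t ht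

theorem ae_p_mem (h : IsRun P ℱ E I B ξ bell η T φs G) (ht : t < T) :
    ∀ᵐ ω ∂P, G.p t ω ∈ stdSimplex ℝ Pol := by
  filter_upwards [h.ae_minimax ht] with ω hω using hω.p_mem

theorem ae_model_mem (h : IsRun P ℱ E I B ξ bell η T φs G) (ht : t < T) :
    ∀ᵐ ω ∂P, (G.model t ω, I.policy φs) ∈ I.set φs := by
  filter_upwards [h.interaction.restricted] with ω hω using hω t ht

theorem ae_ρ_mem (h : IsRun P ℱ E I B ξ bell η T φs G) (ht : t ≤ T) :
    ∀ᵐ ω ∂P, G.ρ t ω ∈ stdSimplex ℝ Φ := by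
  have hne : Nonempty Φ := ⟨φs⟩
  cases t with
  | zero =>
    refine ae_of_all _ fun ω => ⟨fun φ => ?_, ?_⟩
    · rw [h.algorithm.ρ_init]; positivity
    · simp only [h.algorithm.ρ_init]; simp
  | succ t => filter_upwards [h.algorithm.ρ_mem] with ω hω using hω t ht

/-! #### Measurability -/

theorem measurable_infoPosterior (h : IsRun P ℱ E I B ξ bell η T φs G) (ht : t < T) (π : Pol)
    (φ : Φ) : @Measurable _ _ ((ℱ t).prod inferInstance) _
      fun z : Ω × Obs => infoPosterior E I (G.ν t z.1) π z.2 φ :=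
  ((h.interaction.measurable_ν t ht π φ).div
    (Finset.measurable_sum _ fun φ' _ => h.interaction.measurable_ν t ht π φ')).ennreal_toReal

theorem measurable_excess_model (h : IsRun P ℱ E I B ξ bell η T φs G) (ht : t < T) (φ' φ : Φ) :
    @Measurable _ _ ((ℱ t).prod inferInstance) _
      fun z : Ω × Obs => excess B ξ (bell (G.model t z.1)) z.2 φ' φ := by
  have hs : @Measurable (Ω × Obs) _ ((ℱ t).prod inferInstance) _ Prod.snd :=
    @measurable_snd _ _ (ℱ t) _
  have hf : @Measurable (Ω × Obs) _ ((ℱ t).prod inferInstance) (ℱ t) Prod.fst :=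
    @measurable_fst _ _ (ℱ t) _
  have hd := measurable_delta (B := B) h.estimation.measurable_ξ
  exact ((hd φ' φ).comp hs).sub (h.estimation.measurable_bell_apply
    (mΩ' := (ℱ t).prod inferInstance)
    ((h.interaction.measurable_model t ht).comp hf) φ
    (F := fun ψ z => delta B ξ z.2 ψ φ) fun ψ => (hd ψ φ).comp hs)

theorem measurable_ρ_fst (h : IsRun P ℱ E I B ξ bell η T φs G) (ht : t < T) (φ : Φ) :
    @Measurable _ _ ((ℱ t).prod inferInstance) _ fun z : Ω × Obs => G.ρ t z.1 φ :=
  Measurable.comp (h.interaction.measurable_ρ t ht φ) (@measurable_fst _ _ (ℱ t) _)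

theorem measurable_roundGain (h : IsRun P ℱ E I B ξ bell η T φs G) (ht : t < T) (π : Pol) :
    @Measurable _ _ ((ℱ t).prod inferInstance) _ (roundGain E I B ξ bell φs G t π) :=
  ((Real.measurable_log.comp (h.measurable_infoPosterior ht π φs)).sub
    (Real.measurable_log.comp (h.measurable_ρ_fst ht φs))).add
    (Finset.measurable_sum _ fun φ _ =>
      (h.measurable_ρ_fst ht φ).mul (h.measurable_excess_model ht φ φ))

/-! #### Positivity and integrability -/

variable [IsProbabilityMeasure P]

/-- The assumption concerns the observation actually made. Conditioning on the history turns it into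
a statement about every policy in the support of p_t, which the analysis of the segment requires. -/
theorem ae_mixLik_ne_zero (h : IsRun P ℱ E I B ξ bell η T φs G) (ht : t < T) :
    ∀ᵐ ω ∂P, ∀ π, 0 < G.p t ω π →
      ∀ᵐ o ∂(E.law (G.model t ω) π), mixLik E I (G.ν t ω) π o ≠ 0 := by
  refine (h.interaction.ae_iff ht (h.ae_p_mem ht)
    (N := fun π => {z | mixLik E I (G.ν t z.1) π z.2 = 0}) fun π => ?_).1 ?_
  · have hm : @Measurable _ _ ((ℱ t).prod inferInstance) _
        fun z : Ω × Obs => mixLik E I (G.ν t z.1) π z.2 :=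
      Finset.measurable_sum _ fun φ' _ => h.interaction.measurable_ν t ht π φ'
    exact hm (measurableSet_singleton 0)
  · filter_upwards [h.mixLik_ne_zero] with ω hω using hω t ht

theorem ae_logLoss_ne_top (h : IsRun P ℱ E I B ξ bell η T φs G) (ht : t < T)
    (hpos : ∀ᵐ ω ∂P, 0 < G.ρ t ω φs) : ∀ᵐ ω ∂P, ∀ π, 0 < G.p t ω π →
      logLoss E I π (G.ν t ω) (G.model t ω) φs ≠ ⊤ := by
  filter_upwards [h.ae_minimax ht, h.ae_model_mem ht, h.ae_ρ_mem ht.le, h.ae_mixLik_ne_zero ht,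
    hpos] with ω h1 h2 h3 h4 h5 π hπ
  exact h1.logLoss_ne_top h.sqDiv_mem h.η_pos h3 h5 h2 h4 hπ

theorem ae_posterior_pos (h : IsRun P ℱ E I B ξ bell η T φs G) (ht : t < T)
    (hpos : ∀ᵐ ω ∂P, 0 < G.ρ t ω φs) :
    ∀ᵐ ω ∂P, 0 < infoPosterior E I (G.ν t ω) (G.act t ω) (G.obs t ω) φs := by
  have := (h.interaction.ae_iff ht (h.ae_p_mem ht)
    (N := fun π => {z | infoPosterior E I (G.ν t z.1) π z.2 φs ≤ 0})
    fun π => h.measurable_infoPosterior ht π φs measurableSet_Iic).2 (by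
      filter_upwards [h.ae_logLoss_ne_top ht hpos, h.ae_minimax ht] with ω h1 h2 π hπ
      filter_upwards [ae_infoPosterior_pos (IsWeight.of_pmf h2.ν_mem).countable (h1 π hπ)]
        with o ho
      simpa using ho)
  filter_upwards [this] with ω hω
  simpa using hω

/-- In the first-order condition the gap is at least -1, the value of the game at most 1 and the
mean of Dbar at most 1. Solving for the log loss gives -log ρ_t(φs) + 1 + 2η. -/
theorem ae_sum_logLoss_le (h : IsRun P ℱ E I B ξ bell η T φs G) (ht : t < T)
    (hpos : ∀ᵐ ω ∂P, 0 < G.ρ t ω φs) : ∀ᵐ ω ∂P,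
      ∑ π, ENNReal.ofReal (G.p t ω π) * logLoss E I π (G.ν t ω) (G.model t ω) φs
        ≤ ENNReal.ofReal (-Real.log (G.ρ t ω φs) + (1 + 2 * η)) := by
  filter_upwards [h.ae_minimax ht, h.ae_model_mem ht, h.ae_ρ_mem ht.le, h.ae_mixLik_ne_zero ht,
    hpos, h.ae_logLoss_ne_top ht hpos] with ω h1 h2 h3 h4 h5 h6
  obtain ⟨a, -, ha, hgap⟩ := h1.gap_le h.sqDiv_mem h.η_pos h3 h5 h2 h4
  have hp := h1.p_mem
  have e1 : ∀ π, ENNReal.ofReal (G.p t ω π) * logLoss E I π (G.ν t ω) (G.model t ω) φs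
      = ENNReal.ofReal (G.p t ω π
        * (logLoss E I π (G.ν t ω) (G.model t ω) φs).toReal) := fun π => by
    rcases (hp.1 π).eq_or_lt with h0 | h0
    · rw [← h0]; simp
    · rw [ENNReal.ofReal_mul h0.le, ENNReal.ofReal_toReal (h6 π h0)]
  rw [Finset.sum_congr rfl fun π _ => e1 π, ← ENNReal.ofReal_sum_of_nonneg fun π _ =>
    mul_nonneg (hp.1 π) ENNReal.toReal_nonneg]
  refine ENNReal.ofReal_le_ofReal ?_
  have h7 : -1 ≤ ∑ π, G.p t ω π * (E.value (G.model t ω) (I.policy φs)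
      - E.value (G.model t ω) π) := by
    calc (-1 : ℝ) = ∑ π, G.p t ω π * (-1) := by rw [← Finset.sum_mul, hp.2, one_mul]
      _ ≤ _ := Finset.sum_le_sum fun π _ => mul_le_mul_of_nonneg_left
        (abs_le.1 (abs_gap_le E _ _ _)).1 (hp.1 π)
  have h8 : ∑ π, G.p t ω π * (-Real.log (G.ρ t ω φs)
        - (logLoss E I π (G.ν t ω) (G.model t ω) φs).toReal
        + ∑ φ, G.ρ t ω φ * sqDiv E B ξ bell π φ (G.model t ω))
      ≤ ∑ π, G.p t ω π * (-Real.log (G.ρ t ω φs)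
        - (logLoss E I π (G.ν t ω) (G.model t ω) φs).toReal + 1) :=
    Finset.sum_le_sum fun π _ => mul_le_mul_of_nonneg_left
      (by linarith [(mean_Dbar_mem (π := π) h.sqDiv_mem h3 (G.model t ω)).2]) (hp.1 π)
  have h9 : ∑ π, G.p t ω π * (-Real.log (G.ρ t ω φs)
        - (logLoss E I π (G.ν t ω) (G.model t ω) φs).toReal + 1)
      = -Real.log (G.ρ t ω φs) + 1
        - ∑ π, G.p t ω π * (logLoss E I π (G.ν t ω) (G.model t ω) φs).toReal := by
    have e2 : ∀ π, G.p t ω π * (-Real.log (G.ρ t ω φs)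
        - (logLoss E I π (G.ν t ω) (G.model t ω) φs).toReal + 1)
        = G.p t ω π * (-Real.log (G.ρ t ω φs) + 1)
          - G.p t ω π * (logLoss E I π (G.ν t ω) (G.model t ω) φs).toReal := fun π => by ring
    simp only [e2]
    rw [Finset.sum_sub_distrib, ← Finset.sum_mul, hp.2, one_mul]
  have hη := h.η_pos
  have h10 := (hgap.trans (add_le_add_right (mul_le_mul_of_nonneg_left (h8.trans h9.le)
    (one_div_pos.2 hη).le) a))
  have h11 : -2 ≤ 1 / η * (-Real.log (G.ρ t ω φs) + 1
        - ∑ π, G.p t ω π * (logLoss E I π (G.ν t ω) (G.model t ω) φs).toReal) := by linarith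
  rw [one_div, ← div_eq_inv_mul, le_div_iff₀ hη] at h11
  linarith

/-- -log of the posterior is nonnegative, so its expectation can be computed by conditioning without
integrability; the conditional mean is dominated by -log ρ_t(φs) plus a constant. -/
theorem integrable_log_posterior (h : IsRun P ℱ E I B ξ bell η T φs G) (ht : t < T)
    (hpos : ∀ᵐ ω ∂P, 0 < G.ρ t ω φs) (hint : Integrable (fun ω => Real.log (G.ρ t ω φs)) P) :
    Integrable (fun ω =>
      Real.log (infoPosterior E I (G.ν t ω) (G.act t ω) (G.obs t ω) φs)) P := by
  have hm : Measurable fun ω =>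
      Real.log (infoPosterior E I (G.ν t ω) (G.act t ω) (G.obs t ω) φs) :=
    Real.measurable_log.comp (h.interaction.measurable_of_act ht fun π =>
      h.interaction.measurable_pair ht (h.measurable_infoPosterior ht π φs))
  have hnn : ∀ ω, 0 ≤ -Real.log (infoPosterior E I (G.ν t ω) (G.act t ω) (G.obs t ω) φs) :=
    fun ω => neg_nonneg.2 (Real.log_nonpos ENNReal.toReal_nonneg infoPosterior_le_one)
  have htower := (h.interaction.lintegral_tower ht (h.ae_p_mem ht)
    (F := fun π z => negLog (infoPosterior E I (G.ν t z.1) π z.2 φs)) fun π =>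
      continuous_negLog.measurable.comp (h.measurable_infoPosterior ht π φs)).2
  have e : ∫⁻ ω, ENNReal.ofReal
      (-Real.log (infoPosterior E I (G.ν t ω) (G.act t ω) (G.obs t ω) φs)) ∂P
      = ∫⁻ ω, negLog (infoPosterior E I (G.ν t ω) (G.act t ω) (G.obs t ω) φs) ∂P := by
    refine lintegral_congr_ae ?_
    filter_upwards [h.ae_posterior_pos ht hpos] with ω hω
    rw [negLog_of_pos hω]
  have hle : ∫⁻ ω, ENNReal.ofReal
      (-Real.log (infoPosterior E I (G.ν t ω) (G.act t ω) (G.obs t ω) φs)) ∂P ≠ ⊤ := by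
    rw [e, htower]
    exact ne_top_of_le_ne_top
      (hint.neg.add (integrable_const (1 + 2 * η))).lintegral_lt_top.ne
      (lintegral_mono_ae (h.ae_sum_logLoss_le ht hpos))
  have := (lintegral_ofReal_ne_top_iff_integrable hm.neg.aestronglyMeasurable
    (ae_of_all _ hnn)).1 hle
  simpa using this.neg

end IsRun

end Run

end DigDEC

namespace DigDEC

/-! ### The bottom-level weights as functions of the history -/

section Hedge

variable {Obs Φ : Type*} [Fintype Φ] {H : ℕ} {B : ℝ} {ξ : Fin H → Φ → Φ → Obs → ℝ}

/-- The exponential weights `q_t(φ' | φ)` as a function of `ρ` and the observations. -/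
noncomputable def hedge (B : ℝ) (ξ : Fin H → Φ → Φ → Obs → ℝ) (ρ : ℕ → Φ → ℝ) (o : ℕ → Obs) :
    ℕ → Φ → Φ → ℝ
  | 0, _, _ => 1 / Fintype.card Φ
  | t + 1, φ, φ' => expWeight B ξ ρ o t φ φ' / ∑ φ'', expWeight B ξ ρ o t φ φ''

theorem hedge_mem [Nonempty Φ] (ρ : ℕ → Φ → ℝ) (o : ℕ → Obs) (t : ℕ) (φ : Φ) :
    hedge B ξ ρ o t φ ∈ stdSimplex ℝ Φ := by
  cases t with
  | zero => exact ⟨fun φ' => by simp only [hedge]; positivity, by simp [hedge]⟩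
  | succ t =>
    have hpos : ∀ φ', 0 < expWeight B ξ ρ o t φ φ' := fun φ' => Real.exp_pos _
    exact normalized_mem (fun φ' => (hpos φ').le)
      (Finset.sum_pos (fun φ' _ => hpos φ') Finset.univ_nonempty)

theorem measurable_hedge {Ω : Type*} {mΩ : MeasurableSpace Ω} [MeasurableSpace Obs]
    (hξ : ∀ h φ' φ, Measurable (ξ h φ' φ)) {ρ : ℕ → Ω → Φ → ℝ} {o : ℕ → Ω → Obs} {t : ℕ}
    (hρ : ∀ s < t, ∀ φ, Measurable fun ω => ρ s ω φ) (ho : ∀ s < t, Measurable (o s)) (φ φ' : Φ) :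
    Measurable fun ω => hedge B ξ (fun s => ρ s ω) (fun s => o s ω) t φ φ' := by
  cases t with
  | zero => exact measurable_const
  | succ t =>
    have h1 : ∀ φ', Measurable fun ω =>
        expWeight B ξ (fun s => ρ s ω) (fun s => o s ω) t φ φ' := fun φ' => by
      have hr : Measurable fun ω => rate (fun s => ρ s ω) t φ :=
        ((Measurable.iSup fun s : Fin (t + 1) => hρ s s.2 φ).const_mul 16).const_div 1
      refine Real.measurable_exp.comp (hr.neg.mul (Finset.measurable_sum _ fun s hs => ?_))
      have hs' := Finset.mem_range.1 hs
      exact (hρ s hs' φ).mul ((measurable_delta hξ φ' φ).comp (ho s hs'))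
    exact (h1 φ').div (Finset.measurable_sum _ fun φ'' _ => h1 φ'')

end Hedge

/-! ### Induction over the rounds and the estimation term -/

section Run

variable {Mod Pol Obs Φ Ω : Type*} [MeasurableSpace Mod] [Fintype Pol] [MeasurableSpace Obs]
  [Fintype Φ] {mΩ : MeasurableSpace Ω} {P : Measure Ω}
  {ℱ : Filtration ℕ mΩ} {E : DMSO Mod Pol Obs} {I : InfoSets Mod Pol Φ} {H : ℕ} {B : ℝ}
  {ξ : Fin H → Φ → Φ → Obs → ℝ} {bell : Mod → Φ → Φ} {η : ℝ} {T : ℕ} {φs : Φ}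
  {G : Play Mod Pol Obs Φ Ω} {t : ℕ}

namespace IsRun

/-- No measurability of q is assumed. The explicit weights are a version of q_t measurable with
respect to the history, and conditional expectations are taken with that version. -/
theorem ae_q_eq (h : IsRun P ℱ E I B ξ bell η T φs G) (ht : t ≤ T) :
    ∀ᵐ ω ∂P, G.q t ω = hedge B ξ (fun s => G.ρ s ω) (fun s => G.obs s ω) t := by
  cases t with
  | zero => exact ae_of_all _ fun ω => by ext φ φ'; exact h.algorithm.q_init ω φ φ'
  | succ t =>
    filter_upwards [h.algorithm.q_step] with ω hω
    ext φ φ'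
    exact hω t ht φ φ'

theorem measurable_hedge_play (h : IsRun P ℱ E I B ξ bell η T φs G) (ht : t < T) (φ φ' : Φ) :
    Measurable[ℱ t] fun ω => hedge B ξ (fun s => G.ρ s ω) (fun s => G.obs s ω) t φ φ' :=
  measurable_hedge (mΩ := ℱ t) h.estimation.measurable_ξ
    (fun s hs φ => (h.interaction.measurable_ρ s (hs.trans ht) φ).mono (ℱ.mono hs.le) le_rfl)
    (fun s hs => (h.interaction.measurable_obs s (hs.trans ht)).mono (ℱ.mono hs) le_rfl) φ φ'

theorem ae_forall_ρ_mem (h : IsRun P ℱ E I B ξ bell η T φs G) :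
    ∀ᵐ ω ∂P, ∀ t ≤ T, G.ρ t ω ∈ stdSimplex ℝ Φ := by
  rw [ae_all_iff]; intro t
  rw [Filter.eventually_imp_distrib_left]
  exact fun ht => h.ae_ρ_mem ht

theorem abs_sum_excess_le (h : IsRun P ℱ E I B ξ bell η T φs G) {ρ : Φ → ℝ}
    (hρ : ρ ∈ stdSimplex ℝ Φ) (τ : Φ → Φ) (o : Obs) :
    |∑ φ, ρ φ * excess B ξ τ o φ φ| ≤ 1 := by
  rw [← hρ.2]
  refine (Finset.abs_sum_le_sum_abs _ _).trans (Finset.sum_le_sum fun φ _ => ?_)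
  rw [abs_mul, abs_of_nonneg (hρ.1 φ)]
  exact mul_le_of_le_one_right (hρ.1 φ) (abs_excess_le h.H_pos h.B_pos h.estimation.ξ_mem _ _ _ _)

theorem integral_roundGain_law (h : IsRun P ℱ E I B ξ bell η T φs G) {ω : Ω} {π : Pol}
    (hν : (G.ν t ω).support ⊆ I.union)
    (hJ : logLoss E I π (G.ν t ω) (G.model t ω) φs ≠ ⊤) :
    ∫ o, roundGain E I B ξ bell φs G t π (ω, o) ∂(E.law (G.model t ω) π)
      = -Real.log (G.ρ t ω φs) - (logLoss E I π (G.ν t ω) (G.model t ω) φs).toReal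
        + ∑ φ, G.ρ t ω φ * sqDiv E B ξ bell π φ (G.model t ω) := by
  have := isProbabilityMeasure_law E (G.model t ω) π
  obtain ⟨h1, h2⟩ := integrable_log_infoPosterior (IsWeight.of_pmf hν).countable hJ
  have h3 : ∀ φ, Integrable (fun o => G.ρ t ω φ * excess B ξ (bell (G.model t ω)) o φ φ)
      (E.law (G.model t ω) π) := fun φ =>
    (h.estimation.integrable_excess h.H_pos h.B_pos _ φ φ _ π).const_mul _
  have h4 : Integrable (fun o => Real.log (infoPosterior E I (G.ν t ω) π o φs)
      - Real.log (G.ρ t ω φs)) (E.law (G.model t ω) π) := h1.sub (integrable_const _)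
  simp only [roundGain]
  rw [integral_add h4 (integrable_finsetSum _ fun φ _ => h3 φ),
    integral_sub h1 (integrable_const _), integral_finsetSum _ fun φ _ => h3 φ, h2]
  simp only [integral_const_mul, h.estimation.sqDiv_eq]
  simp
  ring

variable [IsProbabilityMeasure P]

/-- Read from the identity of `topUpdate_spec`: the entropies at the minimiser are nonnegative and
the linear parts bounded, so -log ρ_{t+1}(φs) is controlled by the logarithms of the posterior and
of ρ_t(φs). -/
theorem ae_step (h : IsRun P ℱ E I B ξ bell η T φs G) (hn : 1 < Fintype.card Φ) (ht : t < T)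
    (hpos : ∀ᵐ ω ∂P, 0 < G.ρ t ω φs) :
    ∀ᵐ ω ∂P, 0 < G.ρ (t + 1) ω φs ∧ -Real.log (G.ρ (t + 1) ω φs)
      ≤ (2 + 4 * gam Φ + iota Φ)
        - Real.log (infoPosterior E I (G.ν t ω) (G.act t ω) (G.obs t ω) φs)
        - 1 / gam Φ * Real.log (G.ρ t ω φs) := by
  have hne : Nonempty Φ := ⟨φs⟩
  filter_upwards [h.algorithm.ρ_step, h.ae_forall_ρ_mem, h.ae_posterior_pos ht hpos,
    hpos, h.ae_q_eq ht.le] with ω h1 h2 h3 h4 h5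
  have hγ := gam_pos hn
  have hpost := infoPosterior_mem_stdSimplex h3
  have hr' := h2 (t + 1) ht
  obtain ⟨h6, h7, h8, h9⟩ := topUpdate_spec hγ hr' hpost (h2 t ht.le) h3 h4 (h1 t ht)
  refine ⟨h6, ?_⟩
  have k1 := sum_mul_log_div_nonneg hr' hpost h7
  have k2 := sum_mul_log_div_nonneg hr' (h2 t ht.le) h8
  have hL : ∀ φ, |topLoss B ξ (G.q t ω) (G.obs t ω) φ| ≤ 1 := fun φ =>
    abs_topLoss_le h.H_pos h.B_pos h.estimation.ξ_mem (by rw [h5]; exact hedge_mem _ _ _ _) _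
  have hb : ∀ φ, bias (fun s => G.ρ s ω) t φ ∈ Icc 0 (iota Φ) := fun φ =>
    bias_mem hn fun s hs => (h2 s (hs.trans ht.le)).1 φ
  have hsq : ∀ φ, topLoss B ξ (G.q t ω) (G.obs t ω) φ ^ 2 ≤ 1 := fun φ =>
    (sq_le_one_iff_abs_le_one _).2 (hL φ)
  have e1 : topLoss B ξ (G.q t ω) (G.obs t ω) φs
      + 4 * gam Φ * topLoss B ξ (G.q t ω) (G.obs t ω) φs ^ 2 + bias (fun s => G.ρ s ω) t φs
      ≤ 1 + 4 * gam Φ + iota Φ := by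
    have := mul_le_mul_of_nonneg_left (hsq φs) (by positivity : (0 : ℝ) ≤ 4 * gam Φ)
    linarith [(abs_le.1 (hL φs)).2, (hb φs).2]
  have e2 : -1 ≤ ∑ φ, G.ρ (t + 1) ω φ * (topLoss B ξ (G.q t ω) (G.obs t ω) φ
      + 4 * gam Φ * topLoss B ξ (G.q t ω) (G.obs t ω) φ ^ 2 + bias (fun s => G.ρ s ω) t φ) := by
    calc (-1 : ℝ) = ∑ φ, G.ρ (t + 1) ω φ * (-1) := by rw [← Finset.sum_mul, hr'.2, one_mul]
      _ ≤ _ := Finset.sum_le_sum fun φ _ => mul_le_mul_of_nonneg_left (by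
        have : 0 ≤ 4 * gam Φ * topLoss B ξ (G.q t ω) (G.obs t ω) φ ^ 2 := by positivity
        linarith [(abs_le.1 (hL φ)).1, (hb φ).1]) (hr'.1 φ)
  have e3 := neg_log_nonneg hr' h6
  have hβ : 0 ≤ 1 / gam Φ := (one_div_pos.2 hγ).le
  have e4 := mul_nonneg hβ k2
  have e5 := mul_nonneg hβ e3
  nlinarith

/-- Positivity and integrability go through the induction together: they yield a positive posterior
with integrable logarithm, and `ae_step` passes both on to ρ_{t+1}. At t = T only positivity is
claimed, because ρ_T is not assumed measurable. -/
theorem ae_pos_integrable (h : IsRun P ℱ E I B ξ bell η T φs G) (ht : t ≤ T) :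
    (∀ᵐ ω ∂P, 0 < G.ρ t ω φs) ∧
      (t < T → Integrable (fun ω => Real.log (G.ρ t ω φs)) P) := by
  have hne : Nonempty Φ := ⟨φs⟩
  -- With a single information set ι = 0 and γ = 1/0 = 0, so the analysis of the update does not
  -- apply; but then ρ_t is constantly 1.
  rcases (Nat.one_le_iff_ne_zero.2 Fintype.card_ne_zero : 1 ≤ Fintype.card Φ).eq_or_lt with
    hn | hn
  · have hs : Subsingleton Φ := Fintype.card_le_one_iff_subsingleton.1 hn.symm.le
    have h1 : ∀ᵐ ω ∂P, G.ρ t ω φs = 1 := by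
      filter_upwards [h.ae_ρ_mem ht] with ω hω
      rw [← hω.2, Fintype.sum_subsingleton _ φs]
    refine ⟨?_, fun _ => ?_⟩
    · filter_upwards [h1] with ω hω
      rw [hω]; exact one_pos
    · refine (integrable_const (0 : ℝ)).congr ?_
      filter_upwards [h1] with ω hω
      rw [hω, Real.log_one]
  induction t with
  | zero =>
    refine ⟨ae_of_all _ fun ω => ?_, fun _ => ?_⟩
    · rw [h.algorithm.ρ_init]; positivity
    · simp only [h.algorithm.ρ_init]; exact integrable_const _
  | succ t ih =>
    obtain ⟨h1, h2⟩ := ih (Nat.le_of_succ_le ht)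
    have hstep := h.ae_step hn ht h1
    refine ⟨hstep.mono fun ω hω => hω.1, fun ht' => ?_⟩
    have hdom := ((integrable_const (2 + 4 * gam Φ + iota Φ)).sub
      (h.integrable_log_posterior ht h1 (h2 ht))).sub ((h2 ht).const_mul (1 / gam Φ))
    refine hdom.mono' (Real.measurable_log.comp ((h.interaction.measurable_ρ (t + 1) ht' φs).mono
      (ℱ.le _) le_rfl)).aestronglyMeasurable ?_
    filter_upwards [hstep, h.ae_ρ_mem ht'.le] with ω hω hmem
    rw [Real.norm_eq_abs, ← abs_neg, abs_of_nonneg (neg_log_nonneg hmem hω.1)]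
    exact hω.2

theorem ae_pos (h : IsRun P ℱ E I B ξ bell η T φs G) (ht : t ≤ T) :
    ∀ᵐ ω ∂P, 0 < G.ρ t ω φs := (h.ae_pos_integrable ht).1

/-! #### The estimation term -/

theorem ae_bregFinite_and_eq (h : IsRun P ℱ E I B ξ bell η T φs G) (ht : t < T) :
    ∀ᵐ ω ∂P, ∀ π, 0 < G.p t ω π →
      BregFinite E I (sqDiv E B ξ bell) π (G.ρ t ω) (G.model t ω, I.policy φs) (G.ν t ω) ∧
      (divergence E I (sqDiv E B ξ bell) π (PMF.pure (G.model t ω, I.policy φs)) (G.ρ t ω)).toReal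
        - breg (fun w => (divergence E I (sqDiv E B ξ bell) π w (G.ρ t ω)).toReal)
          (PMF.pure (G.model t ω, I.policy φs)) (G.ν t ω)
      = -Real.log (G.ρ t ω φs) - (logLoss E I π (G.ν t ω) (G.model t ω) φs).toReal
        + ∑ φ, G.ρ t ω φ * sqDiv E B ξ bell π φ (G.model t ω) := by
  filter_upwards [h.ae_minimax ht, h.ae_model_mem ht, h.ae_ρ_mem ht.le, h.ae_mixLik_ne_zero ht,
    h.ae_pos ht.le, h.ae_logLoss_ne_top ht (h.ae_pos ht.le)] with ω h1 h2 h3 h4 h5 h6 π hπ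
  exact bregFinite_and_eq h.sqDiv_mem h1.ν_mem (h1.klTerm_ne_top h.sqDiv_mem h.η_pos h3 h5 h2 hπ) (h4 π hπ) h2
    h3 h5 (h6 π hπ)

theorem ae_est_eq (h : IsRun P ℱ E I B ξ bell η T φs G) :
    ∀ᵐ ω ∂P, est E I (sqDiv E B ξ bell) T φs G ω
      = ∑ t ∈ Finset.range T, roundEst E I (sqDiv E B ξ bell) φs G t ω := by
  have h1 : ∀ᵐ ω ∂P, ∀ t < T, ∀ π, G.p t ω π *
      ((divergence E I (sqDiv E B ξ bell) π (PMF.pure (G.model t ω, I.policy φs))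
        (G.ρ t ω)).toReal
        - breg (fun w => (divergence E I (sqDiv E B ξ bell) π w (G.ρ t ω)).toReal)
          (PMF.pure (G.model t ω, I.policy φs)) (G.ν t ω))
      = G.p t ω π * (-Real.log (G.ρ t ω φs) - (logLoss E I π (G.ν t ω) (G.model t ω) φs).toReal
        + ∑ φ, G.ρ t ω φ * sqDiv E B ξ bell π φ (G.model t ω)) := by
    rw [ae_all_iff]; intro t
    rw [Filter.eventually_imp_distrib_left]; intro ht
    filter_upwards [h.ae_bregFinite_and_eq ht, h.ae_p_mem ht] with ω h2 h3 π
    rcases (h3.1 π).eq_or_lt with h0 | h0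
    · rw [← h0, zero_mul, zero_mul]
    · rw [(h2 π h0).2]
  filter_upwards [h1] with ω hω
  exact Finset.sum_congr rfl fun t ht => Finset.sum_congr rfl fun π _ =>
    hω t (Finset.mem_range.1 ht) π

theorem integrable_roundGain (h : IsRun P ℱ E I B ξ bell η T φs G) (ht : t < T) :
    Integrable (fun ω => roundGain E I B ξ bell φs G t (G.act t ω) (ω, G.obs t ω)) P := by
  obtain ⟨h1, h2⟩ := h.ae_pos_integrable ht.le
  refine ((h.integrable_log_posterior ht h1 (h2 ht)).sub (h2 ht)).add ?_
  refine Integrable.of_bound (h.interaction.measurable_pair ht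
    (f := fun z => ∑ φ, G.ρ t z.1 φ * excess B ξ (bell (G.model t z.1)) z.2 φ φ)
    (Finset.measurable_sum _ fun φ _ => (h.measurable_ρ_fst ht φ).mul
      (h.measurable_excess_model ht φ φ))).aestronglyMeasurable 1 ?_
  filter_upwards [h.ae_ρ_mem ht.le] with ω hω
  exact h.abs_sum_excess_le hω _ _

/-- The estimation term of a round is the conditional mean of `roundGain` given the history, which
links the Bregman expression to the pathwise bound. -/
theorem integral_roundEst (h : IsRun P ℱ E I B ξ bell η T φs G) (ht : t < T) :
    Integrable (roundEst E I (sqDiv E B ξ bell) φs G t) P ∧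
      ∫ ω, roundEst E I (sqDiv E B ξ bell) φs G t ω ∂P
        = ∫ ω, roundGain E I B ξ bell φs G t (G.act t ω) (ω, G.obs t ω) ∂P := by
  obtain ⟨h1, h2⟩ := h.interaction.integral_tower ht (h.ae_p_mem ht)
    (h.measurable_roundGain ht) (h.integrable_roundGain ht)
  have hae : (fun ω => ∑ π, G.p t ω π
      * ∫ o, roundGain E I B ξ bell φs G t π (ω, o) ∂(E.law (G.model t ω) π))
      =ᵐ[P] roundEst E I (sqDiv E B ξ bell) φs G t := by
    filter_upwards [h.ae_minimax ht, h.ae_logLoss_ne_top ht (h.ae_pos ht.le)] with ω h3 h4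
    refine Finset.sum_congr rfl fun π _ => ?_
    rcases (h3.p_mem.1 π).eq_or_lt with h0 | h0
    · rw [← h0, zero_mul, zero_mul]
    · rw [h.integral_roundGain_law h3.ν_mem (h4 π h0)]
  exact ⟨h1.congr hae, (h2.trans (integral_congr_ae hae)).symm⟩

end IsRun

end Run

end DigDEC

namespace DigDEC

theorem excessWeight_mem {Φ : Type*} [Fintype Φ] {ρ : Φ → ℝ} {q : Φ → Φ → ℝ}
    (hρ : ρ ∈ stdSimplex ℝ Φ) {φ : Φ} (hq : q φ ∈ stdSimplex ℝ Φ) (φs φ' : Φ) :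
    excessWeight ρ q φs φ φ' ∈ Icc (0 : ℝ) 2 := by
  classical
  have h1 := mem_Icc_of_mem_stdSimplex hρ φ
  have h2 := mem_Icc_of_mem_stdSimplex hq φ'
  unfold excessWeight
  have h3 : (0 : ℝ) ≤ (if φ = φs then 1 else 0) ∧ (if φ = φs then 1 else 0) ≤ (1 : ℝ) := by
    split_ifs <;> norm_num
  constructor
  · exact mul_nonneg (by linarith [h1.1, h3.1]) h2.1
  · refine (mul_le_of_le_one_right (by linarith [h1.1, h3.1]) h2.2).trans ?_
    linarith [h1.2, h3.2]

theorem abs_sq_div_four_sub_le {x : ℝ} (hx : |x| ≤ 1) : |x ^ 2 / 4 - x| ≤ 2 := by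
  have h := (sq_le_one_iff_abs_le_one x).2 hx
  have h' := abs_le.1 hx
  rw [abs_le]
  constructor <;> nlinarith [sq_nonneg x]

theorem bound_le_log_sq {Φ : Type*} [Fintype Φ] [Nonempty Φ] :
    (1 + 1 / gam Φ) * Real.log (Fintype.card Φ) + iota Φ * (1 + Real.log (Fintype.card Φ))
      ≤ 450 * Real.log (Fintype.card Φ) ^ 2 := by
  have e : 1 / gam Φ = 256 * Real.log (Fintype.card Φ) := by
    rw [gam, one_div_one_div, iota]; ring
  rw [e, iota]
  rcases (Nat.one_le_iff_ne_zero.2 Fintype.card_ne_zero : 1 ≤ Fintype.card Φ).eq_or_lt with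
    hn | hn
  · rw [← hn]; simp
  -- With L = log |Φ| the left side is 320 L² + 65 L, and L > 1/2 turns 65 L into at most 130 L².
  · nlinarith [half_lt_log_card hn]

/-! ### Expectation of the pathwise bound and the regret -/

section Run

variable {Mod Pol Obs Φ Ω : Type*} [MeasurableSpace Mod] [Fintype Pol] [MeasurableSpace Obs]
  [Fintype Φ] {mΩ : MeasurableSpace Ω} {P : Measure Ω}
  {ℱ : Filtration ℕ mΩ} {E : DMSO Mod Pol Obs} {I : InfoSets Mod Pol Φ} {H : ℕ} {B : ℝ}
  {ξ : Fin H → Φ → Φ → Obs → ℝ} {bell : Mod → Φ → Φ} {η : ℝ} {T : ℕ} {φs : Φ}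
  {G : Play Mod Pol Obs Φ Ω} {t : ℕ}

/-- The second order remainder of round `t` in the pathwise bound. -/
noncomputable def remainder (B : ℝ) (ξ : Fin H → Φ → Φ → Obs → ℝ) (bell : Mod → Φ → Φ) (φs : Φ)
    (G : Play Mod Pol Obs Φ Ω) (q : Ω → Φ → Φ → ℝ) (t : ℕ) (z : Ω × Obs) : ℝ :=
  ∑ φ, ∑ φ', excessWeight (G.ρ t z.1) (q z.1) φs φ φ'
    * (excess B ξ (bell (G.model t z.1)) z.2 φ' φ ^ 2 / 4
      - excess B ξ (bell (G.model t z.1)) z.2 φ' φ)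

namespace IsRun

theorem ae_exists_bell (h : IsRun P ℱ E I B ξ bell η T φs G) :
    ∀ᵐ ω ∂P, ∃ τ : Φ → Φ, τ φs = φs ∧ ∀ t < T, bell (G.model t ω) = τ := by
  rcases T.eq_zero_or_pos with hT | hT
  · exact ae_of_all _ fun ω => ⟨id, rfl, fun t ht => by omega⟩
  · filter_upwards [h.bell_const, h.ae_model_mem hT] with ω h1 h2
    exact ⟨bell (G.model 0 ω), h.estimation.bell_eq φs _ h2, fun t ht => funext (h1 t ht 0 hT)⟩

/-- The degenerate case, where the bound to be shown is 0: ρ_t is 1, every excess vanishes, and the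
logarithm of a posterior probability is nonpositive. -/
theorem ae_roundGain_nonpos (h : IsRun P ℱ E I B ξ bell η T φs G) (hn : Fintype.card Φ = 1)
    (ht : t < T) :
    ∀ᵐ ω ∂P, roundGain E I B ξ bell φs G t (G.act t ω) (ω, G.obs t ω) ≤ 0 := by
  have hs : Subsingleton Φ := Fintype.card_le_one_iff_subsingleton.1 hn.le
  filter_upwards [h.ae_ρ_mem ht.le] with ω hω
  have h1 : G.ρ t ω φs = 1 := by rw [← hω.2, Fintype.sum_subsingleton _ φs]
  have h2 : ∀ φ, excess B ξ (bell (G.model t ω)) (G.obs t ω) φ φ = 0 := fun φ => by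
    rw [excess, Subsingleton.elim (bell (G.model t ω) φ) φ, sub_self]
  simp only [roundGain, h1, h2, Real.log_one, mul_zero, Finset.sum_const_zero, sub_zero, add_zero]
  exact Real.log_nonpos ENNReal.toReal_nonneg infoPosterior_le_one

variable [IsProbabilityMeasure P]

/-- The weights are nonnegative and determined by the history, so conditioning reduces the claim to
the Bernstein condition for M_t under each policy. -/
theorem integral_remainder_nonpos (h : IsRun P ℱ E I B ξ bell η T φs G) (ht : t < T) :
    Integrable (fun ω => remainder B ξ bell φs G (G.q t) t (ω, G.obs t ω)) P ∧
      ∫ ω, remainder B ξ bell φs G (G.q t) t (ω, G.obs t ω) ∂P ≤ 0 := by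
  have hne : Nonempty Φ := ⟨φs⟩
  set q : Ω → Φ → Φ → ℝ := fun ω => hedge B ξ (fun s => G.ρ s ω) (fun s => G.obs s ω) t with hq
  have hae : (fun ω => remainder B ξ bell φs G q t (ω, G.obs t ω))
      =ᵐ[P] fun ω => remainder B ξ bell φs G (G.q t) t (ω, G.obs t ω) := by
    filter_upwards [h.ae_q_eq ht.le] with ω hω
    simp only [remainder, hω, hq]
  have hterm : ∀ φ φ', @Measurable (Ω × Obs) ℝ ((ℱ t).prod inferInstance) _ fun z =>
      excessWeight (G.ρ t z.1) (q z.1) φs φ φ'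
        * (excess B ξ (bell (G.model t z.1)) z.2 φ' φ ^ 2 / 4
          - excess B ξ (bell (G.model t z.1)) z.2 φ' φ) := fun φ φ' => by
    have hx := h.measurable_excess_model ht φ' φ
    have hqm : @Measurable (Ω × Obs) ℝ ((ℱ t).prod inferInstance) _ fun z => q z.1 φ φ' :=
      Measurable.comp (g := fun ω => hedge B ξ (fun s => G.ρ s ω) (fun s => G.obs s ω) t φ φ')
        (h.measurable_hedge_play ht φ φ') (@measurable_fst _ _ (ℱ t) _)
    exact ((((h.measurable_ρ_fst ht φ).div_const 3).add_const _).mul hqm).mul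
      (((hx.pow_const 2).div_const 4).sub hx)
  have hmeas : @Measurable (Ω × Obs) ℝ ((ℱ t).prod inferInstance) _
      (remainder B ξ bell φs G q t) :=
    Finset.measurable_sum _ fun φ _ => Finset.measurable_sum _ fun φ' _ => hterm φ φ'
  have hint : Integrable (fun ω => remainder B ξ bell φs G q t (ω, G.obs t ω)) P := by
    refine integrable_finsetSum _ fun φ _ => integrable_finsetSum _ fun φ' _ => ?_
    refine Integrable.of_bound (h.interaction.measurable_pair ht
      (hterm φ φ')).aestronglyMeasurable (2 * 2) ?_
    filter_upwards [h.ae_ρ_mem ht.le] with ω hω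
    have h1 := excessWeight_mem hω (hedge_mem (B := B) (ξ := ξ) (fun s => G.ρ s ω)
      (fun s => G.obs s ω) t φ) φs φ'
    rw [norm_mul]
    refine mul_le_mul ?_ (abs_sq_div_four_sub_le (abs_excess_le h.H_pos h.B_pos
      h.estimation.ξ_mem _ _ _ _)) (norm_nonneg _) (by norm_num)
    rw [Real.norm_eq_abs, abs_of_nonneg h1.1]
    exact h1.2
  refine ⟨hint.congr hae, ?_⟩
  rw [← integral_congr_ae hae, (h.interaction.integral_tower ht (h.ae_p_mem ht)
    (F := fun _ => remainder B ξ bell φs G q t) (fun _ => hmeas) hint).2]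
  refine integral_nonpos_of_ae ?_
  filter_upwards [h.ae_ρ_mem ht.le, h.ae_p_mem ht] with ω hω hp
  refine Finset.sum_nonpos fun π _ => mul_nonpos_of_nonneg_of_nonpos (hp.1 π) ?_
  have hi : ∀ φ φ', Integrable (fun o => excessWeight (G.ρ t ω) (q ω) φs φ φ'
      * (excess B ξ (bell (G.model t ω)) o φ' φ ^ 2 / 4
        - excess B ξ (bell (G.model t ω)) o φ' φ)) (E.law (G.model t ω) π) := fun φ φ' =>
    (((h.estimation.integrable_excess_sq h.H_pos h.B_pos _ φ' φ _ π).div_const 4).sub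
      (h.estimation.integrable_excess h.H_pos h.B_pos _ φ' φ _ π)).const_mul _
  simp only [remainder]
  rw [integral_finsetSum _ fun φ _ => integrable_finsetSum _ fun φ' _ => hi φ φ']
  refine Finset.sum_nonpos fun φ _ => ?_
  rw [integral_finsetSum _ fun φ' _ => hi φ φ']
  refine Finset.sum_nonpos fun φ' _ => ?_
  rw [integral_const_mul]
  exact mul_nonpos_of_nonneg_of_nonpos (excessWeight_mem hω (hedge_mem _ _ t φ) φs φ').1
    (h.estimation.integral_quad_nonpos h.H_pos h.B_pos φ' φ _ π)

theorem ae_sum_roundGain_le (h : IsRun P ℱ E I B ξ bell η T φs G) (hn : 1 < Fintype.card Φ) :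
    ∀ᵐ ω ∂P, ∑ t ∈ Finset.range T, roundGain E I B ξ bell φs G t (G.act t ω) (ω, G.obs t ω)
      ≤ (1 + 1 / gam Φ) * Real.log (Fintype.card Φ) + iota Φ * (1 + Real.log (Fintype.card Φ))
        + ∑ t ∈ Finset.range T, remainder B ξ bell φs G (G.q t) t (ω, G.obs t ω) := by
  have hpos : ∀ᵐ ω ∂P, ∀ t ≤ T, 0 < G.ρ t ω φs := by
    rw [ae_all_iff]; intro t
    rw [Filter.eventually_imp_distrib_left]
    exact fun ht => h.ae_pos ht
  have hpost : ∀ᵐ ω ∂P, ∀ t < T,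
      0 < infoPosterior E I (G.ν t ω) (G.act t ω) (G.obs t ω) φs := by
    rw [ae_all_iff]; intro t
    rw [Filter.eventually_imp_distrib_left]
    exact fun ht => h.ae_posterior_pos ht (h.ae_pos ht.le)
  filter_upwards [hpos, hpost, h.ae_forall_ρ_mem, h.algorithm.ρ_step, h.algorithm.q_step,
    h.ae_exists_bell] with ω h1 h2 h3 h4 h5 ⟨τ, hτ, hbell⟩
  have key := pathwise_bound (T := T) (B := B) (ξ := ξ) (ρ := fun t => G.ρ t ω)
    (post := fun t => infoPosterior E I (G.ν t ω) (G.act t ω) (G.obs t ω))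
    (q := fun t => G.q t ω) (o := fun t => G.obs t ω) (τ := τ) (φs := φs) hn h.H_pos h.B_pos
    h.estimation.ξ_mem hτ (h.algorithm.ρ_init ω) (h.algorithm.q_init ω) h3 h1
    (fun t ht => infoPosterior_mem_stdSimplex (h2 t ht)) h2 h4 h5
  have e1 : ∀ t ∈ Finset.range T, roundGain E I B ξ bell φs G t (G.act t ω) (ω, G.obs t ω)
      = Real.log (infoPosterior E I (G.ν t ω) (G.act t ω) (G.obs t ω) φs)
        - Real.log (G.ρ t ω φs) + ∑ φ, G.ρ t ω φ * excess B ξ τ (G.obs t ω) φ φ := fun t ht => by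
    rw [roundGain, hbell t (Finset.mem_range.1 ht)]
  have e2 : ∀ t ∈ Finset.range T, remainder B ξ bell φs G (G.q t) t (ω, G.obs t ω)
      = ∑ φ, ∑ φ', excessWeight (G.ρ t ω) (G.q t ω) φs φ φ'
        * (excess B ξ τ (G.obs t ω) φ' φ ^ 2 / 4
          - excess B ξ τ (G.obs t ω) φ' φ) := fun t ht => by
    simp only [remainder, hbell t (Finset.mem_range.1 ht)]
  rw [Finset.sum_congr rfl e1, Finset.sum_congr rfl e2]
  exact key

theorem sum_integral_roundGain_le (h : IsRun P ℱ E I B ξ bell η T φs G) :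
    ∑ t ∈ Finset.range T, ∫ ω, roundGain E I B ξ bell φs G t (G.act t ω) (ω, G.obs t ω) ∂P
      ≤ 450 * Real.log (Fintype.card Φ) ^ 2 := by
  have hne : Nonempty Φ := ⟨φs⟩
  rcases (Nat.one_le_iff_ne_zero.2 Fintype.card_ne_zero : 1 ≤ Fintype.card Φ).eq_or_lt with
    hn | hn
  · refine (Finset.sum_nonpos fun t ht => ?_).trans (by positivity)
    exact integral_nonpos_of_ae (h.ae_roundGain_nonpos hn.symm (Finset.mem_range.1 ht))
  have hR := fun t (ht : t ∈ Finset.range T) => h.integral_remainder_nonpos (Finset.mem_range.1 ht)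
  rw [← integral_finsetSum _ fun t ht => h.integrable_roundGain (Finset.mem_range.1 ht)]
  refine (integral_mono_ae (integrable_finsetSum _ fun t ht =>
    h.integrable_roundGain (Finset.mem_range.1 ht)) ((integrable_const _).add
      (integrable_finsetSum _ fun t ht => (hR t ht).1)) (h.ae_sum_roundGain_le hn)).trans ?_
  simp only [Pi.add_apply]
  rw [integral_add (integrable_const _) (integrable_finsetSum _ fun t ht => (hR t ht).1),
    integral_finsetSum _ fun t ht => (hR t ht).1]
  have h1 := Finset.sum_nonpos fun t ht => (hR t ht).2
  have h2 := bound_le_log_sq (Φ := Φ)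
  simp only [integral_const, probReal_univ, one_smul]
  linarith

theorem integral_est (h : IsRun P ℱ E I B ξ bell η T φs G) :
    Integrable (est E I (sqDiv E B ξ bell) T φs G) P ∧
      ∫ ω, est E I (sqDiv E B ξ bell) T φs G ω ∂P
        = ∑ t ∈ Finset.range T, ∫ ω, roundEst E I (sqDiv E B ξ bell) φs G t ω ∂P := by
  have hi := fun t (ht : t ∈ Finset.range T) => (h.integral_roundEst (Finset.mem_range.1 ht)).1
  refine ⟨(integrable_finsetSum _ hi).congr ?_, ?_⟩
  · filter_upwards [h.ae_est_eq] with ω hω using hω.symm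
  · rw [integral_congr_ae h.ae_est_eq, integral_finsetSum _ hi]

theorem integral_est_le (h : IsRun P ℱ E I B ξ bell η T φs G) :
    ∫ ω, est E I (sqDiv E B ξ bell) T φs G ω ∂P ≤ 450 * Real.log (Fintype.card Φ) ^ 2 := by
  rw [h.integral_est.2, Finset.sum_congr rfl fun t ht =>
    (h.integral_roundEst (Finset.mem_range.1 ht)).2]
  exact h.sum_integral_roundGain_le

/-! #### Regret -/

theorem integral_roundRegret (h : IsRun P ℱ E I B ξ bell η T φs G) (ht : t < T) (πs : Pol) :
    Integrable (fun ω => E.value (G.model t ω) πs - E.value (G.model t ω) (G.act t ω)) P ∧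
    Integrable (fun ω =>
      ∑ π, G.p t ω π * (E.value (G.model t ω) πs - E.value (G.model t ω) π)) P ∧
    ∫ ω, (E.value (G.model t ω) πs - E.value (G.model t ω) (G.act t ω)) ∂P
      = ∫ ω, ∑ π, G.p t ω π * (E.value (G.model t ω) πs - E.value (G.model t ω) π) ∂P := by
  have hv : ∀ π, @Measurable (Ω × Obs) ℝ ((ℱ t).prod inferInstance) _ fun z =>
      E.value (G.model t z.1) πs - E.value (G.model t z.1) π := fun π =>
    Measurable.comp (((E.measurable_value πs).comp (h.interaction.measurable_model t ht)).sub
      ((E.measurable_value π).comp (h.interaction.measurable_model t ht)))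
      (@measurable_fst _ _ (ℱ t) _)
  have hint : Integrable (fun ω => E.value (G.model t ω) πs - E.value (G.model t ω) (G.act t ω))
      P :=
    Integrable.of_bound (h.interaction.measurable_of_act ht fun π =>
      h.interaction.measurable_pair ht (hv π)).aestronglyMeasurable 1
      (ae_of_all _ fun ω => abs_gap_le E _ _ _)
  obtain ⟨h1, h2⟩ := h.interaction.integral_tower ht (h.ae_p_mem ht) hv hint
  have e : ∀ ω π, ∫ _o, (E.value (G.model t ω) πs - E.value (G.model t ω) π)
      ∂(E.law (G.model t ω) π) = E.value (G.model t ω) πs - E.value (G.model t ω) π :=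
    fun ω π => by
      have := isProbabilityMeasure_law E (G.model t ω) π
      simp
  simp only [e] at h1 h2
  exact ⟨hint, h1, h2⟩

theorem integrable_regret (h : IsRun P ℱ E I B ξ bell η T φs G) (πs : Pol) :
    Integrable (regret E T πs G) P :=
  integrable_finsetSum _ fun _ ht => (h.integral_roundRegret (Finset.mem_range.1 ht) πs).1

/-- Conditioning replaces the played policy by its average under p_t; then the first-order condition
of each round is summed. The real bound r avoids arithmetic with a coefficient that is an extended
real. -/
theorem integral_regret_le (h : IsRun P ℱ E I B ξ bell η T φs G) {r : ℝ}
    (hr : digDEC E I (sqDiv E B ξ bell) η ≤ (r : EReal)) :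
    ∫ ω, regret E T (I.policy φs) G ω ∂P
      ≤ T * r + 450 * Real.log (Fintype.card Φ) ^ 2 / η := by
  have hround : ∀ t ∈ Finset.range T,
      ∫ ω, (E.value (G.model t ω) (I.policy φs) - E.value (G.model t ω) (G.act t ω)) ∂P
        ≤ r + 1 / η * ∫ ω, roundEst E I (sqDiv E B ξ bell) φs G t ω ∂P := fun t ht => by
    have ht := Finset.mem_range.1 ht
    obtain ⟨-, h2, h3⟩ := h.integral_roundRegret ht (I.policy φs)
    have h4 := (h.integral_roundEst ht).1
    rw [h3]
    have h5 : ∫ ω, (r + 1 / η * roundEst E I (sqDiv E B ξ bell) φs G t ω) ∂P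
        = r + 1 / η * ∫ ω, roundEst E I (sqDiv E B ξ bell) φs G t ω ∂P := by
      rw [integral_add (integrable_const _) (h4.const_mul _), integral_const_mul]
      simp
    rw [← h5]
    refine integral_mono_ae h2 ((integrable_const _).add (h4.const_mul _)) ?_
    filter_upwards [h.ae_minimax ht, h.ae_model_mem ht, h.ae_ρ_mem ht.le, h.ae_mixLik_ne_zero ht,
      h.ae_pos ht.le] with ω k1 k2 k3 k4 k5
    obtain ⟨a, ha, -, hgap⟩ := k1.gap_le h.sqDiv_mem h.η_pos k3 k5 k2 k4
    have har : a ≤ r := by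
      have := (k1.air_le_digDEC k3).trans hr
      rw [ha] at this
      exact EReal.coe_le_coe_iff.1 this
    exact hgap.trans (add_le_add har le_rfl)
  have h1 : ∫ ω, regret E T (I.policy φs) G ω ∂P = ∑ t ∈ Finset.range T,
      ∫ ω, (E.value (G.model t ω) (I.policy φs) - E.value (G.model t ω) (G.act t ω)) ∂P :=
    integral_finsetSum _ fun t ht =>
      (h.integral_roundRegret (Finset.mem_range.1 ht) (I.policy φs)).1
  have h2 : 1 / η * ∫ ω, est E I (sqDiv E B ξ bell) T φs G ω ∂P
      ≤ 1 / η * (450 * Real.log (Fintype.card Φ) ^ 2) :=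
    mul_le_mul_of_nonneg_left h.integral_est_le (one_div_pos.2 h.η_pos).le
  rw [h.integral_est.2] at h2
  rw [h1]
  calc _ ≤ ∑ t ∈ Finset.range T, (r + 1 / η * ∫ ω, roundEst E I (sqDiv E B ξ bell) φs G t ω ∂P) :=
        Finset.sum_le_sum hround
    _ = T * r + 1 / η
          * ∑ t ∈ Finset.range T, ∫ ω, roundEst E I (sqDiv E B ξ bell) φs G t ω ∂P := by
        rw [Finset.sum_add_distrib, Finset.mul_sum]; simp
    _ ≤ T * r + 1 / η * (450 * Real.log (Fintype.card Φ) ^ 2) := by linarith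
    _ = _ := by ring

theorem integral_regret_le_sqrt (h : IsRun P ℱ E I B ξ bell η T φs G) {d : ℝ} (hd : 0 < d)
    (hη : η = Real.log (Fintype.card Φ) / Real.sqrt (d * T))
    (hr : digDEC E I (sqDiv E B ξ bell) η ≤ ((d * η : ℝ) : EReal)) :
    ∫ ω, regret E T (I.policy φs) G ω ∂P
      ≤ 451 * Real.log (Fintype.card Φ) * Real.sqrt (d * T) := by
  have h1 := h.integral_regret_le hr
  have hη0 := h.η_pos
  -- Positivity of η rules out T = 0 and |Φ| = 1, where the prescribed η would be 0.
  have hs : Real.sqrt (d * T) ≠ 0 := fun h0 => by rw [hη, h0, div_zero] at hη0; exact hη0.false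
  have hl : Real.log (Fintype.card Φ) ≠ 0 := fun h0 => by
    rw [hη, h0, zero_div] at hη0; exact hη0.false
  have e1 : T * (d * η) = Real.log (Fintype.card Φ) * Real.sqrt (d * T) := by
    have h2 : Real.sqrt (d * T) * Real.sqrt (d * T) = d * T := Real.mul_self_sqrt (by positivity)
    have h3 : T * (d * (Real.log (Fintype.card Φ) / Real.sqrt (d * T)))
        = Real.log (Fintype.card Φ) * (d * T / Real.sqrt (d * T)) := by ring
    rw [hη, h3, ← (eq_div_iff hs).2 h2]
  have e2 : 450 * Real.log (Fintype.card Φ) ^ 2 / η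
      = 450 * (Real.log (Fintype.card Φ) * Real.sqrt (d * T)) := by
    rw [hη]; field_simp
  rw [e1, e2] at h1
  linarith

end IsRun

end Run

end DigDEC

theorem mainTheorem3 :
    ∃ C : ℝ, 0 < C ∧
      ∀ (Mod : Type u₁) (Pol : Type u₂) (Obs : Type u₃) (Φ : Type u₄) (Ω : Type u₅)
        [MeasurableSpace Mod] [Fintype Pol] [MeasurableSpace Obs] [Fintype Φ]
        [mΩ : MeasurableSpace Ω] (P : Measure Ω) [IsProbabilityMeasure P] (ℱ : Filtration ℕ mΩ)
        (E : DigDEC.DMSO Mod Pol Obs) (I : DigDEC.InfoSets Mod Pol Φ)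
        (H : ℕ) (B : ℝ) (ξ : Fin H → Φ → Φ → Obs → ℝ) (bell : Mod → Φ → Φ)
        (η : ℝ) (T : ℕ) (φs : Φ) (G : DigDEC.Play Mod Pol Obs Φ Ω),
        0 < H → 0 < B → 0 < η →
        DigDEC.SquaredEstimation E I B ξ bell →
        DigDEC.IsInteraction P ℱ E I T φs G →
        -- restriction on the adversary: `T_{M_t} = T_{M_{t'}}`
        (∀ᵐ ω ∂P, ∀ t < T, ∀ t' < T, ∀ φ, bell (G.model t ω) φ = bell (G.model t' ω) φ) →
        DigDEC.IsAlgorithm P E I B ξ bell η T G →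
        -- Bayes' rule defines the posterior `ν_t(· | π_t, o_t)` used in the update
        (∀ᵐ ω ∂P, ∀ t < T, DigDEC.mixLik E I (G.ν t ω) (G.act t ω) (G.obs t ω) ≠ 0) →
        -- `Est` is well defined and integrable, and `E[Est] ≲ log² |Φ|`
        (∀ᵐ ω ∂P, ∀ t < T, ∀ π, 0 < G.p t ω π →
          DigDEC.BregFinite E I (DigDEC.sqDiv E B ξ bell) π (G.ρ t ω)
            (G.model t ω, I.policy φs) (G.ν t ω)) ∧
        Integrable (DigDEC.est E I (DigDEC.sqDiv E B ξ bell) T φs G) P ∧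
        ∫ ω, DigDEC.est E I (DigDEC.sqDiv E B ξ bell) T φs G ω ∂P
          ≤ C * Real.log (Fintype.card Φ) ^ 2 ∧
        -- the resulting regret bounds
        Integrable (DigDEC.regret E T (I.policy φs) G) P ∧
        (∀ r : ℝ, DigDEC.digDEC E I (DigDEC.sqDiv E B ξ bell) η ≤ (r : EReal) →
          ∫ ω, DigDEC.regret E T (I.policy φs) G ω ∂P
            ≤ T * r + C * Real.log (Fintype.card Φ) ^ 2 / η) ∧
        (∀ d : ℝ, 0 < d → η = Real.log (Fintype.card Φ) / Real.sqrt (d * T) →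
          DigDEC.digDEC E I (DigDEC.sqDiv E B ξ bell) η ≤ ((d * η : ℝ) : EReal) →
          ∫ ω, DigDEC.regret E T (I.policy φs) G ω ∂P
            ≤ C * Real.log (Fintype.card Φ) * Real.sqrt (d * T)) := by
  -- 450 bounds the estimation term; the additional 1 is T d η = log |Φ| √(dT) in the tuned regret
  -- bound.
  refine ⟨451, by norm_num, ?_⟩
  intro Mod Pol Obs Φ Ω _ _ _ _ mΩ P _ ℱ E I H B ξ bell η T φs G hH hB hη hS hG hbell hA hmix
  have h : DigDEC.IsRun P ℱ E I B ξ bell η T φs G := ⟨hH, hB, hη, hS, hG, hbell, hA, hmix⟩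
  have hL : 0 ≤ Real.log (Fintype.card Φ) ^ 2 := sq_nonneg _
  refine ⟨?_, h.integral_est.1, h.integral_est_le.trans (by linarith),
    h.integrable_regret _, fun r hr => (h.integral_regret_le hr).trans ?_,
    fun d hd hηd hr => h.integral_regret_le_sqrt hd hηd hr⟩
  · rw [ae_all_iff]; intro t
    rw [Filter.eventually_imp_distrib_left]; intro ht
    filter_upwards [h.ae_bregFinite_and_eq ht] with ω hω π hπ using (hω π hπ).1
  · gcongr
    norm_num
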